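/- **Setting.** Let $\bar v>0$, let $w\in C^3(\mathbb R^2,\mathbb R^2)$ with $\|w(x)\|<\bar v$ for all $x$, and let $x_O,x_D\in\mathbb R^2$. Let $X$ be the set of $\xi\in W^{1,\infty}(]0,1[,\mathbb R^2)$ (Lipschitz paths) with $\xi(0)=x_O$, $\xi(1)=x_D$, and let $\delta X=W^{1,\infty}_0(]0,1[,\mathbb R^2)$. Consider the problem $$\min_{\xi\in X,\,L\in\mathbb R} T(\xi)=\int_0^1 f(\xi,\xi_\tau)\,d\tau\quad\text{s.t.}\quad h(L,\xi):=\|\xi_\tau\|^2-L^2=0\ \text{ a.e. in }]0,1[,$$ $$f(x,y)=\frac{-y^Tw(x)+\sqrt{(y^Tw(x))^2+(\bar v^2-\|w(x)\|^2)\|y\|^2}}{\bar v^2-\|w(x)\|^2}.$$ Write $z=(L,\xi)$ and $\chi=(z,\lambda)\in Y:=\mathbb R\times X\times L^\infty(]0,1[)$, let $\delta Y:=\mathbb R\times\delta X\times L^\infty(]0,1[)$, let $\mathcal L(\chi)=T(\xi)+\int_0^1\lambda\,h(z)\,d\tau$, and let $F=\mathcal L'$. Thus $F(\chi)[\delta\chi]$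 and $F'(\chi)[\Delta\chi][\delta\chi]$ are the first and second directional derivatives of $\mathcal L$ in directions of $\delta Y$. A point $\chi\in Y$ is a KKT point if $F(\chi)=0$. A Newton step at $\chi$ is a $\Delta\chi\in\delta Y$ with $F'(\chi)[\Delta\chi]=-F(\chi)$, and Newton iterates satisfy $\chi^{k+1}=\chi^k+\Delta\chi^k$ with $\Delta\chi^k$ a Newton step at $\chi^k$. Put $$\|z\|_{2}=|L|+\|\xi\|_{L^2}+\|\xi_\tau\|_{L^2},\qquad \|\chi\|_2=\|z\|_2+\|\lambda\|_{L^2},\qquad \|\chi\|_\infty=|L|+\|\xi\|_{L^\infty}+\|\xi_\tau\|_{L^\infty}+\|\lambda\|_{L^\infty},$$ and $\mathcal N_R(\chi^*)=\{\chi\in Y:\|\chi-\chi^*\|_\infty\le R\}$. **Assumptions.** Let $\chi^*=(L^*,\xi^*,\lambda^*)$ be such that $(L^*,\xi^*)$ is a global minimizer of the problem, and * (first order condition) $F(\chi^*)=0$; * (second order condition) for some $B>0$, $\mathcal L_{zz}(\chi^*)[\delta z]^2\ge B\,\|\delta z\|_2^2$ for all $\delta z=(\delta L,\delta\xi)\in\mathbb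 R\times\delta X$ with $\delta\xi_\tau^T\xi^*_\tau=\delta L\,L^*$ a.e.; * there are $c>0$ and $u\in\mathbb R^2$, $\|u\|=1$, with $u^T\xi^*_\tau\ge c$ a.e. in $]0,1[$. (The inf-sup part of the LBB conditions follows from the last assumption and need not be assumed separately.) Let $\Omega$ be a filled ellipse with foci $x_O,x_D$ that contains the path $\xi^*$, and let $\|w\|\le c_0<\bar v$, $\|w_x\|\le c_1$, $\|w_{xx}\|\le c_2$ on $\Omega$. Put $\tilde L=\|x_D-x_O\|$, $\underline v=\sqrt{\bar v^2-c_0^2}$, $\beta_0=14c_1^2/\underline v^3+4c_2/\underline v^2$, $\beta_1=7c_1/\underline v^2$, $\beta_2=4/\underline v$, and $$\kappa(R)=(c-R)\Big[\tfrac38+2\Big(\tfrac{\bar v+c_0}{\bar v-c_0}+\tfrac R{\tilde L}\Big)^2\Big]^{-1/2},\qquad \bar B(R)=\beta_1+\max\Big\{\Big(\tfrac{\bar v+c_0}{\bar v-c_0}\tilde L+R\Big)\beta_0,\ \tfrac{\beta_2}{\tilde L+R}\Big\},$$ $$\omega_1(R)=\sqrt2\,\max\Big\{\tfrac4B,\ \tfrac1{\kappa(R)}\Big(1+\tfrac{4(\bar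 B(R)+R)}B\Big),\ \tfrac{\bar B(R)+R}{\kappa(R)^2}\Big\}.$$ **Theorem.** There are $\hat B\in[0,\infty[$ and $R_0>0$ such that for every $R_C\in\,]0,R_0]$ the following holds with $\omega_2=(8+\hat B)R_C$ and $\omega=\omega_1(R_C)\,\omega_2$. 1. For all $\chi_1,\chi_2\in\mathcal N_{R_C}(\chi^*)$ and $\delta\chi\in\delta Y$, $|(F'(\chi_2)-F'(\chi_1))[\chi_2-\chi_1][\delta\chi]|\le\omega_2\,\|\chi_2-\chi_1\|_2\,\|\delta\chi\|_2$. 2. $\omega<2$. 3. At every $\chi\in\mathcal N_{R_C}(\chi^*)$ there is exactly one Newton step. 4. If Newton iterates $\chi^0,\chi^1,\dots$ all lie in $\mathcal N_{R_C}(\chi^*)$, then $\|\chi^{k+1}-\chi^*\|_2\le\frac\omega2\|\chi^k-\chi^*\|_2$ for all $k$, and $\|\chi^k-\chi^*\|_2\to0$. 5. $\chi^*$ is the only KKT point in $\mathcal N_{R_C}(\chi^*)$. -/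

import Mathlib

noncomputable section

namespace FreeFlight

open MeasureTheory

/-- The Euclidean plane. -/
abbrev Plane : Type := EuclideanSpace ℝ (Fin 2)

/-- Lebesgue measure on the pseudo-time interval `]0,1[`. -/
def unitMeasure : Measure ℝ := volume.restrict (Set.Ioo (0 : ℝ) 1)

/-- The `L^∞(]0,1[)` norm, built on the Euclidean norm of the values. -/
def normInf {G : Type*} [NormedAddCommGroup G] (φ : ℝ → G) : ℝ :=
  (eLpNorm φ ⊤ unitMeasure).toReal

/-- The `L²(]0,1[)` norm, built on the Euclidean norm of the values. -/
def normTwo {G : Type*} [NormedAddCommGroup G] (φ : ℝ → G) : ℝ :=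
  (eLpNorm φ 2 unitMeasure).toReal

/-- Triples `χ = (L, ξ, lam)`: length, path, multiplier.  Only the values of the path on `[0,1]`
and the almost-everywhere class of the multiplier on `]0,1[` are relevant. -/
abbrev Triple : Type := ℝ × (ℝ → Plane) × (ℝ → ℝ)

/-- Two triples represent the same element of `ℝ × W^{1,∞} × L^∞`. -/
def Same (χ χ' : Triple) : Prop :=
  χ.1 = χ'.1 ∧ Set.EqOn χ.2.1 χ'.2.1 (Set.Icc 0 1) ∧ χ.2.2 =ᵐ[unitMeasure] χ'.2.2

/-- `ξ` belongs to `W^{1,∞}(]0,1[, ℝ²)` (that is, it is Lipschitz continuous) and runs from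
`a` to `b`.  Its derivative `deriv ξ` exists almost everywhere on `]0,1[` by Rademacher's
theorem and is the weak derivative. -/
def IsPath (a b : Plane) (ξ : ℝ → Plane) : Prop :=
  (∃ K : NNReal, LipschitzOnWith K ξ (Set.Icc 0 1)) ∧ ξ 0 = a ∧ ξ 1 = b

/-- The space `Y = ℝ × X × L^∞(]0,1[)` where `X` consists of the paths from `xO` to `xD`. -/
def MemY (xO xD : Plane) (χ : Triple) : Prop :=
  IsPath xO xD χ.2.1 ∧ MemLp χ.2.2 ⊤ unitMeasure

/-- The linear space `ℝ × W^{1,∞}_0(]0,1[, ℝ²) × L^∞(]0,1[)` of directions. -/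
def MemDeltaY (δ : Triple) : Prop := MemY 0 0 δ

/-- `‖χ‖ = |L| + ‖ξ‖_∞ + ‖ξ_τ‖_∞ + ‖lam‖_∞`. -/
def yInf (χ : Triple) : ℝ :=
  |χ.1| + normInf χ.2.1 + normInf (deriv χ.2.1) + normInf χ.2.2

/-- `‖(L, ξ)‖ = |L| + ‖ξ‖_2 + ‖ξ_τ‖_2`. -/
def zTwo (L : ℝ) (ξ : ℝ → Plane) : ℝ :=
  |L| + normTwo ξ + normTwo (deriv ξ)

/-- `‖χ‖ = |L| + ‖ξ‖_2 + ‖ξ_τ‖_2 + ‖lam‖_2`. -/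
def yTwo (χ : Triple) : ℝ := zTwo χ.1 χ.2.1 + normTwo χ.2.2

/-- The closed `L^∞`-neighbourhood of radius `R` of `χs` in `Y`. -/
def Nhood (xO xD : Plane) (χs : Triple) (R : ℝ) : Set Triple :=
  {χ | MemY xO xD χ ∧ yInf (χ - χs) ≤ R}

/-- The integrand `f(x, y) = t_τ` of the flight duration, at position `x` and path velocity `y`,
for airspeed `v` and wind `w`. -/
def timeRate (v : ℝ) (w : Plane → Plane) (x y : Plane) : ℝ :=
  (-(inner ℝ y (w x)) +
      Real.sqrt ((inner ℝ y (w x)) ^ 2 + (v ^ 2 - ‖w x‖ ^ 2) * ‖y‖ ^ 2)) /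
    (v ^ 2 - ‖w x‖ ^ 2)

/-- The flight duration `T(ξ)`. -/
def flightTime (v : ℝ) (w : Plane → Plane) (ξ : ℝ → Plane) : ℝ :=
  ∫ τ, timeRate v w (ξ τ) (deriv ξ τ) ∂unitMeasure

/-- The constraint function `h(L, ξ) = ξ_τᵀ ξ_τ - L²`. -/
def speedConstraint (L : ℝ) (ξ : ℝ → Plane) (τ : ℝ) : ℝ :=
  ‖deriv ξ τ‖ ^ 2 - L ^ 2

/-- `(L, ξ)` is feasible: `ξ ∈ X` and `‖ξ_τ‖² = L²` almost everywhere. -/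
def Feasible (xO xD : Plane) (L : ℝ) (ξ : ℝ → Plane) : Prop :=
  IsPath xO xD ξ ∧ ∀ᵐ τ ∂unitMeasure, speedConstraint L ξ τ = 0

/-- `(L, ξ)` is a global minimizer of the flight duration under the constant-ground-speed
constraint. -/
def IsGlobalSolution (v : ℝ) (w : Plane → Plane) (xO xD : Plane) (L : ℝ) (ξ : ℝ → Plane) : Prop :=
  Feasible xO xD L ξ ∧
    ∀ (L' : ℝ) (ξ' : ℝ → Plane), Feasible xO xD L' ξ' → flightTime v w ξ ≤ flightTime v w ξ'

/-- The Lagrangian `T(ξ) + ⟨lam, h(L, ξ)⟩`. -/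
def lagrangian (v : ℝ) (w : Plane → Plane) (χ : Triple) : ℝ :=
  flightTime v w χ.2.1 + ∫ τ, χ.2.2 τ * speedConstraint χ.1 χ.2.1 τ ∂unitMeasure

/-- The derivative `F(χ)[δ]` of the Lagrangian at `χ` in direction `δ`. -/
def kktMap (v : ℝ) (w : Plane → Plane) (χ δ : Triple) : ℝ :=
  deriv (fun t : ℝ => lagrangian v w (χ + t • δ)) 0

/-- The derivative `F'(χ)[Δ][δ]` of `χ ↦ F(χ)[δ]` at `χ` in direction `Δ`. -/
def kktDeriv (v : ℝ) (w : Plane → Plane) (χ Δ δ : Triple) : ℝ :=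
  deriv (fun s : ℝ => kktMap v w (χ + s • Δ) δ) 0

/-- `χ` solves `F(χ) = 0`, i.e. the first order necessary (KKT) conditions. -/
def IsKKT (v : ℝ) (w : Plane → Plane) (xO xD : Plane) (χ : Triple) : Prop :=
  MemY xO xD χ ∧ ∀ δ : Triple, MemDeltaY δ → kktMap v w χ δ = 0

/-- The second order condition with constant `B`: the Hessian of the Lagrangian with respect to
`z = (L, ξ)` is bounded below by `B` times the squared `L²`-type norm on the kernel of the
linearized constraint. -/
def SecondOrderCondition (v : ℝ) (w : Plane → Plane) (χ : Triple) (B : ℝ) : Prop :=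
  ∀ (δL : ℝ) (δξ : ℝ → Plane), IsPath 0 0 δξ →
    (∀ᵐ τ ∂unitMeasure, inner ℝ (deriv δξ τ) (deriv χ.2.1 τ) = δL * χ.1) →
      B * zTwo δL δξ ^ 2 ≤ kktDeriv v w χ (δL, δξ, 0) (δL, δξ, 0)

/-- `Δ` is a Newton step at `χ`: `F'(χ)[Δ] = -F(χ)`. -/
def IsNewtonStep (v : ℝ) (w : Plane → Plane) (χ Δ : Triple) : Prop :=
  MemDeltaY Δ ∧ ∀ δ : Triple, MemDeltaY δ → kktDeriv v w χ Δ δ = -kktMap v w χ δ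

/-- A sequence of ordinary Newton iterates. -/
def IsNewtonSequence (v : ℝ) (w : Plane → Plane) (χ : ℕ → Triple) : Prop :=
  ∀ k, ∃ Δ, IsNewtonStep v w (χ k) Δ ∧ χ (k + 1) = χ k + Δ

/-- The (filled) ellipse with foci `xO`, `xD` and major axis of length `ℓ`. -/
def ellipse (xO xD : Plane) (ℓ : ℝ) : Set Plane := {p | ‖p - xO‖ + ‖p - xD‖ ≤ ℓ}

/-- `κ(R) = (c - R) [3/8 + 2 ((v + c₀)/(v - c₀) + R/D)²]^{-1/2}`, with `D = ‖xD - xO‖`. -/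
def kappa (v c₀ D c R : ℝ) : ℝ :=
  (c - R) / Real.sqrt (3 / 8 + 2 * ((v + c₀) / (v - c₀) + R / D) ^ 2)

/-- The upper bound `β₁ + max {((v + c₀)/(v - c₀) D + R) β₀, β₂ / (D + R)}` for `T''`, where
`u² = v² - c₀²`, `β₀ = 14 c₁²/u³ + 4 c₂/u²`, `β₁ = 7 c₁/u²`, `β₂ = 4/u`. -/
def upperB (v c₀ c₁ c₂ D R : ℝ) : ℝ :=
  let u := Real.sqrt (v ^ 2 - c₀ ^ 2)
  7 * c₁ / u ^ 2 +
    max (((v + c₀) / (v - c₀) * D + R) * (14 * c₁ ^ 2 / u ^ 3 + 4 * c₂ / u ^ 2))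
      (4 / u / (D + R))

/-- `ω₁(R)`. -/
def omegaOne (v c₀ c₁ c₂ D c B R : ℝ) : ℝ :=
  let κ := kappa v c₀ D c R
  let β := upperB v c₀ c₁ c₂ D R
  Real.sqrt 2 * max (max (4 / B) (1 / κ * (1 + 4 * (β + R) / B))) ((β + R) / κ ^ 2)

/-- `ω₂(R) = (8 + Bhat) R`. -/
def omegaTwo (Bhat R : ℝ) : ℝ := (8 + Bhat) * R

end FreeFlight

end

open FreeFlight

/-!
The multiplier and the length enter the Lagrangian algebraically and the path enters through `ξ` and
`ξ'` only, so that the Lagrangian is an integral `∫ Φ(L, ξ, ξ', lam)`.  Along an advancing path the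
velocity stays away from `0`, where alone the integrand fails to be smooth; a cutoff replaces it by
a compactly supported `C³` function `Φ` on jets (`exists_smooth_extension`).  The derivatives `F` and
`F'` are then integrals of the differentials of `Φ` (`kktMap_eq_integral`, `kktDeriv_eq_integral`),
and since `D²Φ` is Lipschitz, `F'` at two `L^∞`-close points differs little as a bilinear form on
`L²` (`abs_hess_sub_hess_le`).

The linearization at the solution is stable in `L²` (`stability_of_coercive`).  This is Brezzi's
argument: the second order condition is coercivity on the kernel of the linearized constraint, and
the advance in the direction `u` provides a bounded right inverse of the constraint
(`exists_constraint_rightInverse`).  By perturbation, stability holds in a neighbourhood.  Together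
with the Taylor expansion of `F` it yields uniqueness of Newton steps, the contraction of the error,
and uniqueness of the KKT point.

Existence of a Newton step asks for a solution in `L^∞` and does not follow from `L²` estimates alone.
The second order condition, tested with variations that concentrate near a point, implies a
strengthened Legendre condition (`ae_le_transversal`).  It permits solving the Newton system
pointwise for the variations of velocity and multiplier in terms of the variation of the path and an
adjoint variable, which leaves a linear differential equation with bounded measurable coefficients
(`exists_linear_ode_solution`).  The boundary conditions are met by shooting: the shooting map is an
endomorphism of a finite-dimensional space, and it is injective by stability
(`exists_newton_direction`).

The constant `Bhat` is chosen large compared with the Lipschitz constant of `D²Φ` and the stability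
constant; as `ω₁` is bounded from below by `4 / B` and bounded from above for small radii, `ω / 2`
then dominates the contraction factor and is less than `1` for a small radius.
-/

noncomputable section

namespace FreeFlight

open MeasureTheory Set
open scoped ENNReal NNReal Topology

/-! ### Lipschitz paths and essentially bounded functions -/

instance : IsProbabilityMeasure unitMeasure :=
  ⟨by simp [unitMeasure]⟩

theorem ae_unitMeasure_mem : ∀ᵐ τ ∂unitMeasure, τ ∈ Ioo (0 : ℝ) 1 :=
  ae_restrict_mem measurableSet_Ioo

theorem integral_unitMeasure {G : Type*} [NormedAddCommGroup G] [NormedSpace ℝ G] (g : ℝ → G) :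
    ∫ τ, g τ ∂unitMeasure = ∫ τ in (0 : ℝ)..1, g τ := by
  rw [intervalIntegral.integral_of_le zero_le_one, integral_Ioc_eq_integral_Ioo, unitMeasure]

section Bounded

variable {G H : Type*} [NormedAddCommGroup G] [NormedAddCommGroup H]

theorem ae_norm_le_normInf {φ : ℝ → G} (h : MemLp φ ⊤ unitMeasure) :
    ∀ᵐ τ ∂unitMeasure, ‖φ τ‖ ≤ normInf φ := by
  filter_upwards [ae_le_eLpNormEssSup (f := φ) (μ := unitMeasure)] with τ hτ
  rw [← eLpNorm_exponent_top] at hτ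
  simpa only [toReal_enorm, normInf] using ENNReal.toReal_mono h.2.ne hτ

theorem exists_ae_norm_le {φ : ℝ → G} (h : MemLp φ ⊤ unitMeasure) :
    ∃ C : ℝ, 0 ≤ C ∧ ∀ᵐ τ ∂unitMeasure, ‖φ τ‖ ≤ C :=
  ⟨normInf φ, ENNReal.toReal_nonneg, ae_norm_le_normInf h⟩

theorem integrable_of_memLp_top {φ : ℝ → G} (h : MemLp φ ⊤ unitMeasure) :
    Integrable φ unitMeasure :=
  h.integrable le_top

theorem normTwo_nonneg (φ : ℝ → G) : 0 ≤ normTwo φ := ENNReal.toReal_nonneg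

theorem normTwo_sq {φ : ℝ → G} (h : MemLp φ ⊤ unitMeasure) :
    normTwo φ ^ 2 = ∫ τ, ‖φ τ‖ ^ 2 ∂unitMeasure := by
  have h2 : MemLp φ 2 unitMeasure := h.mono_exponent le_top
  rw [normTwo, h2.eLpNorm_eq_integral_rpow_norm two_ne_zero ENNReal.ofNat_ne_top,
    ENNReal.toReal_ofReal (by positivity)]
  simp only [ENNReal.toReal_ofNat]
  rw [← Real.rpow_natCast, ← Real.rpow_mul (by positivity)]
  norm_num

theorem integrable_norm_sq {φ : ℝ → G} (h : MemLp φ ⊤ unitMeasure) :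
    Integrable (fun τ => ‖φ τ‖ ^ 2) unitMeasure :=
  (h.mono_exponent (q := ⊤) (p := 2) le_top).integrable_norm_pow two_ne_zero

theorem normTwo_congr {φ ψ : ℝ → G} (h : φ =ᵐ[unitMeasure] ψ) : normTwo φ = normTwo ψ := by
  rw [normTwo, normTwo, eLpNorm_congr_ae h]

theorem normTwo_add_le {φ ψ : ℝ → G} (hφ : MemLp φ ⊤ unitMeasure) (hψ : MemLp ψ ⊤ unitMeasure) :
    normTwo (φ + ψ) ≤ normTwo φ + normTwo ψ := by
  have h1 : MemLp φ 2 unitMeasure := hφ.mono_exponent le_top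
  have h2 : MemLp ψ 2 unitMeasure := hψ.mono_exponent le_top
  rw [normTwo, normTwo, normTwo, ← ENNReal.toReal_add h1.2.ne h2.2.ne]
  exact ENNReal.toReal_mono (ENNReal.add_ne_top.2 ⟨h1.2.ne, h2.2.ne⟩)
    (eLpNorm_add_le h1.1 h2.1 (by norm_num))

/-- Pointwise domination carries over to `L²` norms. -/
theorem normTwo_le_mul {φ : ℝ → G} {ψ : ℝ → H} (hψ : MemLp ψ ⊤ unitMeasure) {C : ℝ} (hC : 0 ≤ C)
    (h : ∀ᵐ τ ∂unitMeasure, ‖φ τ‖ ≤ C * ‖ψ τ‖) : normTwo φ ≤ C * normTwo ψ := by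
  have h2 : MemLp ψ 2 unitMeasure := hψ.mono_exponent le_top
  have := eLpNorm_le_mul_eLpNorm_of_ae_le_mul h 2
  have h3 := ENNReal.toReal_mono (ENNReal.mul_ne_top ENNReal.ofReal_ne_top h2.2.ne) this
  rwa [ENNReal.toReal_mul, ENNReal.toReal_ofReal hC] at h3

theorem normTwo_const (a : G) : normTwo (fun _ => a) = ‖a‖ := by
  rw [normTwo, eLpNorm_const _ two_ne_zero (IsProbabilityMeasure.ne_zero _)]
  simp

theorem normTwo_smul [NormedSpace ℝ G] (a : ℝ) (φ : ℝ → G) :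
    normTwo (a • φ) = |a| * normTwo φ := by
  rw [normTwo, eLpNorm_const_smul, ENNReal.toReal_mul]
  simp [normTwo]

theorem ae_eq_zero_of_normTwo_eq_zero {φ : ℝ → G} (h : MemLp φ ⊤ unitMeasure)
    (h0 : normTwo φ = 0) : φ =ᵐ[unitMeasure] 0 := by
  have h2 : MemLp φ 2 unitMeasure := h.mono_exponent le_top
  rw [normTwo, ENNReal.toReal_eq_zero_iff] at h0
  exact (eLpNorm_eq_zero_iff h2.1 two_ne_zero).1 (h0.resolve_right h2.2.ne)

/-- The Cauchy–Schwarz inequality. -/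
theorem integral_norm_mul_norm_le {φ : ℝ → G} {ψ : ℝ → H} (hφ : MemLp φ ⊤ unitMeasure)
    (hψ : MemLp ψ ⊤ unitMeasure) :
    ∫ τ, ‖φ τ‖ * ‖ψ τ‖ ∂unitMeasure ≤ normTwo φ * normTwo ψ := by
  have h1 : MemLp (fun τ => ‖φ τ‖) (ENNReal.ofReal 2) unitMeasure :=
    (hφ.mono_exponent le_top).norm
  have h2 : MemLp (fun τ => ‖ψ τ‖) (ENNReal.ofReal 2) unitMeasure :=
    (hψ.mono_exponent le_top).norm
  have hpq : (2 : ℝ).HolderConjugate 2 := Real.HolderConjugate.two_two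
  refine (integral_mul_le_Lp_mul_Lq_of_nonneg hpq (.of_forall fun _ => norm_nonneg _)
    (.of_forall fun _ => norm_nonneg _) h1 h2).trans_eq ?_
  simp only [Real.rpow_ofNat]
  rw [← normTwo_sq hφ, ← normTwo_sq hψ, ← Real.sqrt_eq_rpow, ← Real.sqrt_eq_rpow,
    Real.sqrt_sq (normTwo_nonneg _), Real.sqrt_sq (normTwo_nonneg _)]

theorem abs_integral_le_of_ae_le_mul {g : ℝ → ℝ} {φ : ℝ → G} {ψ : ℝ → H}
    (hφ : MemLp φ ⊤ unitMeasure) (hψ : MemLp ψ ⊤ unitMeasure) {C : ℝ} (hC : 0 ≤ C)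
    (h : ∀ᵐ τ ∂unitMeasure, ‖g τ‖ ≤ C * (‖φ τ‖ * ‖ψ τ‖)) :
    |∫ τ, g τ ∂unitMeasure| ≤ C * (normTwo φ * normTwo ψ) := by
  have hi : Integrable (fun τ => ‖φ τ‖ * ‖ψ τ‖) unitMeasure := by
    have h1 : MemLp (fun τ => ‖φ τ‖) 2 unitMeasure := (hφ.mono_exponent le_top).norm
    have h2 : MemLp (fun τ => ‖ψ τ‖) 2 unitMeasure := (hψ.mono_exponent le_top).norm
    exact h1.integrable_mul h2
  calc |∫ τ, g τ ∂unitMeasure| ≤ ∫ τ, C * (‖φ τ‖ * ‖ψ τ‖) ∂unitMeasure :=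
        norm_integral_le_of_norm_le (hi.const_mul C) h
    _ = C * ∫ τ, ‖φ τ‖ * ‖ψ τ‖ ∂unitMeasure := integral_const_mul _ _
    _ ≤ _ := mul_le_mul_of_nonneg_left (integral_norm_mul_norm_le hφ hψ) hC

end Bounded

section Paths

variable {V : Type*} [NormedAddCommGroup V] [NormedSpace ℝ V] [FiniteDimensional ℝ V]

theorem ae_differentiableAt_of_lipschitzOnWith {ξ : ℝ → V} {K : ℝ≥0}
    (h : LipschitzOnWith K ξ (Icc 0 1)) : ∀ᵐ τ ∂unitMeasure, DifferentiableAt ℝ ξ τ := by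
  have h1 := (h.mono Ioo_subset_Icc_self).ae_differentiableWithinAt (μ := volume)
    measurableSet_Ioo
  filter_upwards [h1, ae_unitMeasure_mem] with τ h2 h3
  exact h2.differentiableAt (Ioo_mem_nhds h3.1 h3.2)

omit [FiniteDimensional ℝ V] in
theorem norm_deriv_le_of_lipschitzOnWith_Icc {ξ : ℝ → V} {K : ℝ≥0}
    (h : LipschitzOnWith K ξ (Icc 0 1)) {τ : ℝ} (hτ : τ ∈ Ioo (0 : ℝ) 1) : ‖deriv ξ τ‖ ≤ K :=
  norm_deriv_le_of_lipschitzOn (Icc_mem_nhds hτ.1 hτ.2) h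

theorem memLp_deriv_of_lipschitzOnWith {ξ : ℝ → V} {K : ℝ≥0}
    (h : LipschitzOnWith K ξ (Icc 0 1)) : MemLp (deriv ξ) ⊤ unitMeasure := by
  have : CompleteSpace V := FiniteDimensional.complete ℝ V
  refine memLp_top_of_bound (stronglyMeasurable_deriv ξ).aestronglyMeasurable K ?_
  filter_upwards [ae_unitMeasure_mem] with τ hτ
  exact norm_deriv_le_of_lipschitzOnWith_Icc h hτ

theorem memLp_of_continuousOn {ξ : ℝ → V} (h : ContinuousOn ξ (Icc 0 1)) :
    MemLp ξ ⊤ unitMeasure := by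
  obtain ⟨C, hC⟩ := isCompact_Icc.exists_bound_of_continuousOn h
  refine memLp_top_of_bound
    ((h.mono Ioo_subset_Icc_self).aestronglyMeasurable measurableSet_Ioo) C ?_
  filter_upwards [ae_unitMeasure_mem] with τ hτ
  exact hC τ (Ioo_subset_Icc_self hτ)

omit [NormedSpace ℝ V] [FiniteDimensional ℝ V] in
theorem eqOn_zero_of_ae_eq_zero {ξ : ℝ → V} (h : ContinuousOn ξ (Icc 0 1))
    (h0 : ξ =ᵐ[unitMeasure] 0) : EqOn ξ 0 (Icc 0 1) := by
  have h1 : EqOn ξ 0 (Ioo 0 1) :=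
    Measure.eqOn_open_of_ae_eq h0 isOpen_Ioo (h.mono Ioo_subset_Icc_self) continuousOn_const
  exact h1.of_subset_closure h continuousOn_const Ioo_subset_Icc_self
    (by rw [closure_Ioo zero_ne_one])

/-- The fundamental theorem of calculus for Lipschitz functions. -/
theorem integral_deriv_of_lipschitzOnWith {g : ℝ → ℝ} {K : ℝ≥0}
    (h : LipschitzOnWith K g (Icc 0 1)) : ∫ τ, deriv g τ ∂unitMeasure = g 1 - g 0 := by
  rw [integral_unitMeasure]
  refine AbsolutelyContinuousOnInterval.integral_deriv_eq_sub ?_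
  refine LipschitzOnWith.absolutelyContinuousOnInterval (K := K) ?_
  rwa [uIcc_of_le zero_le_one]

/-- Integration by parts for Lipschitz paths in a Euclidean space, the second of which vanishes at
both ends. -/
theorem integral_inner_deriv_add {π ξ : ℝ → Plane} {K L : ℝ≥0}
    (hπ : LipschitzOnWith K π (Icc 0 1)) (hξ : LipschitzOnWith L ξ (Icc 0 1))
    (h0 : ξ 0 = 0) (h1 : ξ 1 = 0) :
    ∫ τ, (inner ℝ (deriv π τ) (ξ τ) + inner ℝ (π τ) (deriv ξ τ)) ∂unitMeasure = 0 := by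
  have key : ∀ i : Fin 2, ∫ τ, (deriv (fun t => π t i) τ * ξ τ i +
      π τ i * deriv (fun t => ξ t i) τ) ∂unitMeasure = 0 := by
    intro i
    have hc : LipschitzWith 1 (fun p : Plane => p i) :=
      LipschitzWith.of_dist_le_mul fun a b => by
        simpa [dist_eq_norm] using PiLp.norm_apply_le (a - b) i
    have hp : LipschitzOnWith (1 * K) (fun t => π t i) (uIcc 0 1) := by
      rw [uIcc_of_le zero_le_one]; exact hc.comp_lipschitzOnWith hπ
    have hx : LipschitzOnWith (1 * L) (fun t => ξ t i) (uIcc 0 1) := by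
      rw [uIcc_of_le zero_le_one]; exact hc.comp_lipschitzOnWith hξ
    rw [integral_unitMeasure,
      hp.absolutelyContinuousOnInterval.integral_deriv_mul_eq_sub
        hx.absolutelyContinuousOnInterval]
    simp [h0, h1]
  have hint : ∀ i : Fin 2, Integrable (fun τ => deriv (fun t => π t i) τ * ξ τ i +
      π τ i * deriv (fun t => ξ t i) τ) unitMeasure := by
    intro i
    have hc : LipschitzWith 1 (fun p : Plane => p i) :=
      LipschitzWith.of_dist_le_mul fun a b => by
        simpa [dist_eq_norm] using PiLp.norm_apply_le (a - b) i
    have hp := hc.comp_lipschitzOnWith hπ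
    have hx := hc.comp_lipschitzOnWith hξ
    have a1 := memLp_deriv_of_lipschitzOnWith hp
    have a2 := memLp_deriv_of_lipschitzOnWith hx
    have a3 := memLp_of_continuousOn hp.continuousOn
    have a4 := memLp_of_continuousOn hx.continuousOn
    exact (integrable_of_memLp_top (a4.mul a1)).add (integrable_of_memLp_top (a2.mul a3))
  have hsum : ∫ τ, ∑ i : Fin 2, (deriv (fun t => π t i) τ * ξ τ i +
      π τ i * deriv (fun t => ξ t i) τ) ∂unitMeasure = 0 := by
    rw [integral_finsetSum _ fun i _ => hint i]
    exact Finset.sum_eq_zero fun i _ => key i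
  rw [← hsum]
  refine integral_congr_ae ?_
  filter_upwards [ae_differentiableAt_of_lipschitzOnWith hπ,
    ae_differentiableAt_of_lipschitzOnWith hξ] with τ h2 h3
  have e1 : ∀ i : Fin 2, deriv (fun t => π t i) τ = deriv π τ i := fun i =>
    ((EuclideanSpace.proj i : Plane →L[ℝ] ℝ).hasFDerivAt.comp_hasDerivAt τ h2.hasDerivAt).deriv
  have e2 : ∀ i : Fin 2, deriv (fun t => ξ t i) τ = deriv ξ τ i := fun i =>
    ((EuclideanSpace.proj i : Plane →L[ℝ] ℝ).hasFDerivAt.comp_hasDerivAt τ h3.hasDerivAt).deriv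
  simp only [e1, e2, Fin.sum_univ_two, PiLp.inner_apply, RCLike.inner_apply, conj_trivial]
  ring

/-- The primitive of an integrable function, vanishing at `0`. -/
def primitive (η : ℝ → V) (t : ℝ) : V := ∫ s in (0 : ℝ)..t, η s

omit [NormedSpace ℝ V] [FiniteDimensional ℝ V] in
theorem intervalIntegrable_of_memLp {η : ℝ → V} (h : MemLp η ⊤ unitMeasure) {a b : ℝ}
    (ha : a ∈ Icc (0 : ℝ) 1) (hb : b ∈ Icc (0 : ℝ) 1) : IntervalIntegrable η volume a b := by
  have h1 : IntervalIntegrable η volume 0 1 := by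
    rw [intervalIntegrable_iff_integrableOn_Ioo_of_le zero_le_one]
    exact integrable_of_memLp_top h
  refine h1.mono_set ?_
  rw [uIcc_of_le zero_le_one]
  exact uIcc_subset_Icc ha hb

omit [FiniteDimensional ℝ V] in
theorem primitive_zero (η : ℝ → V) : primitive η 0 = 0 := by simp [primitive]

omit [FiniteDimensional ℝ V] in
theorem primitive_one (η : ℝ → V) : primitive η 1 = ∫ τ, η τ ∂unitMeasure :=
  (integral_unitMeasure η).symm

omit [FiniteDimensional ℝ V] in
theorem lipschitzOnWith_primitive {η : ℝ → V} (h : MemLp η ⊤ unitMeasure) :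
    ∃ K : ℝ≥0, LipschitzOnWith K (primitive η) (Icc 0 1) := by
  obtain ⟨C, hC, hb⟩ := exists_ae_norm_le h
  refine ⟨⟨C, hC⟩, LipschitzOnWith.of_dist_le_mul fun a ha b hb' => ?_⟩
  rw [dist_eq_norm, primitive, primitive, intervalIntegral.integral_interval_sub_left
    (intervalIntegrable_of_memLp h (by simp) ha) (intervalIntegrable_of_memLp h (by simp) hb'),
    Real.dist_eq]
  refine intervalIntegral.norm_integral_le_of_norm_le_const_ae ?_
  have hb2 : ∀ᵐ τ, τ ∈ Ioo (0 : ℝ) 1 → ‖η τ‖ ≤ C := (ae_restrict_iff' measurableSet_Ioo).1 hb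
  have hne : ∀ᵐ τ : ℝ, τ ≠ 1 := by simp [ae_iff, measure_singleton]
  filter_upwards [hb2, hne] with τ h1 h2 h3
  rw [uIoc, mem_Ioc] at h3
  refine h1 ⟨lt_of_le_of_lt (le_min hb'.1 ha.1) h3.1,
    lt_of_le_of_ne (h3.2.trans (max_le hb'.2 ha.2)) h2⟩

theorem ae_hasDerivAt_primitive {η : ℝ → V} (h : MemLp η ⊤ unitMeasure) :
    ∀ᵐ τ ∂unitMeasure, HasDerivAt (primitive η) (η τ) τ := by
  have : CompleteSpace V := FiniteDimensional.complete ℝ V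
  have h1 :=
    (intervalIntegrable_of_memLp h (a := 0) (b := 1) (by simp) (by simp)).ae_hasDerivAt_integral
  filter_upwards [ae_restrict_of_ae h1, ae_unitMeasure_mem] with τ h2 h3
  rw [uIcc_of_le zero_le_one] at h2
  exact h2 (Ioo_subset_Icc_self h3) 0 (by simp)

omit [FiniteDimensional ℝ V] in
theorem norm_primitive_le {η : ℝ → V} (h : MemLp η ⊤ unitMeasure) {t : ℝ} (ht : t ∈ Icc (0 : ℝ) 1) :
    ‖primitive η t‖ ≤ ∫ τ, ‖η τ‖ ∂unitMeasure := by
  rw [integral_unitMeasure]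
  refine (intervalIntegral.norm_integral_le_integral_norm ht.1).trans ?_
  exact intervalIntegral.integral_mono_interval le_rfl ht.1 ht.2
    (.of_forall fun _ => norm_nonneg _)
    (intervalIntegrable_of_memLp h (by simp) (by simp)).norm

end Paths

/-! ### The spaces of triples and their one-jets -/

theorem IsPath.combine {a b a' b' : Plane} {ξ η : ℝ → Plane} (hξ : IsPath a b ξ)
    (hη : IsPath a' b' η) (s : ℝ) : IsPath (a + s • a') (b + s • b') (ξ + s • η) := by
  obtain ⟨⟨K, hK⟩, h0, h1⟩ := hξ
  obtain ⟨⟨L, hL⟩, h0', h1'⟩ := hη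
  refine ⟨⟨K + ‖s‖₊ * L, ?_⟩, by simp [h0, h0'], by simp [h1, h1']⟩
  refine LipschitzOnWith.of_dist_le_mul fun x hx y hy => ?_
  have e1 := hK.dist_le_mul x hx y hy
  have e2 := hL.dist_le_mul x hx y hy
  simp only [Pi.add_apply, Pi.smul_apply, NNReal.coe_add, NNReal.coe_mul, coe_nnnorm]
  calc dist (ξ x + s • η x) (ξ y + s • η y) ≤ dist (ξ x) (ξ y) + dist (s • η x) (s • η y) :=
        dist_add_add_le _ _ _ _
    _ ≤ K * dist x y + ‖s‖ * (L * dist x y) := by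
        rw [dist_smul₀]; gcongr
    _ = _ := by ring

theorem MemY.combine {a b a' b' : Plane} {χ δ : Triple} (hχ : MemY a b χ) (hδ : MemY a' b' δ)
    (s : ℝ) : MemY (a + s • a') (b + s • b') (χ + s • δ) :=
  ⟨hχ.1.combine hδ.1 s, hχ.2.add (hδ.2.const_smul s)⟩

theorem MemY.add_smul {a b : Plane} {χ δ : Triple} (hχ : MemY a b χ) (hδ : MemDeltaY δ)
    (s : ℝ) : MemY a b (χ + s • δ) := by
  simpa using MemY.combine hχ hδ s

theorem MemY.sub {a b : Plane} {χ χ' : Triple} (hχ : MemY a b χ) (hχ' : MemY a b χ') :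
    MemDeltaY (χ - χ') := by
  simpa [sub_eq_add_neg, MemDeltaY] using MemY.combine hχ hχ' (-1)

theorem IsPath.continuousOn {a b : Plane} {ξ : ℝ → Plane} (h : IsPath a b ξ) :
    ContinuousOn ξ (Icc 0 1) := by
  obtain ⟨⟨K, hK⟩, -⟩ := h
  exact hK.continuousOn

theorem IsPath.ae_differentiableAt {a b : Plane} {ξ : ℝ → Plane} (h : IsPath a b ξ) :
    ∀ᵐ τ ∂unitMeasure, DifferentiableAt ℝ ξ τ := by
  obtain ⟨⟨K, hK⟩, -⟩ := h
  exact ae_differentiableAt_of_lipschitzOnWith hK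

theorem IsPath.memLp_deriv {a b : Plane} {ξ : ℝ → Plane} (h : IsPath a b ξ) :
    MemLp (deriv ξ) ⊤ unitMeasure := by
  obtain ⟨⟨K, hK⟩, -⟩ := h
  exact memLp_deriv_of_lipschitzOnWith hK

theorem IsPath.memLp {a b : Plane} {ξ : ℝ → Plane} (h : IsPath a b ξ) :
    MemLp ξ ⊤ unitMeasure :=
  memLp_of_continuousOn h.continuousOn

/-- The primitive of an essentially bounded function with mean zero is an admissible variation. -/
theorem isPath_primitive {η : ℝ → Plane} (h : MemLp η ⊤ unitMeasure)
    (h0 : ∫ τ, η τ ∂unitMeasure = 0) : IsPath 0 0 (primitive η) :=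
  ⟨lipschitzOnWith_primitive h, primitive_zero η, by rw [primitive_one, h0]⟩

theorem ae_deriv_primitive {η : ℝ → Plane} (h : MemLp η ⊤ unitMeasure) :
    deriv (primitive η) =ᵐ[unitMeasure] η := by
  filter_upwards [ae_hasDerivAt_primitive h] with τ hτ using hτ.deriv

/-- The values `(L, x, y, lam)` of length, position, path velocity and multiplier on which the
integrand of the Lagrangian depends, with the maximum norm. -/
abbrev Jet : Type := ℝ × Plane × Plane × ℝ

/-- The jet `τ ↦ (L, ξ τ, ξ' τ, lam τ)` of a triple. -/
def jet (χ : Triple) (τ : ℝ) : Jet := (χ.1, χ.2.1 τ, deriv χ.2.1 τ, χ.2.2 τ)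

theorem MemY.memLp_jet {a b : Plane} {χ : Triple} (h : MemY a b χ) :
    MemLp (jet χ) ⊤ unitMeasure :=
  memLp_prod_iff.2 ⟨memLp_const χ.1, memLp_prod_iff.2 ⟨h.1.memLp,
    memLp_prod_iff.2 ⟨h.1.memLp_deriv, h.2⟩⟩⟩

theorem MemDeltaY.memLp_jet {δ : Triple} (h : MemDeltaY δ) : MemLp (jet δ) ⊤ unitMeasure :=
  MemY.memLp_jet h

theorem MemY.ae_jet_add_smul {a b a' b' : Plane} {χ δ : Triple} (hχ : MemY a b χ)
    (hδ : MemY a' b' δ) :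
    ∀ᵐ τ ∂unitMeasure, ∀ s : ℝ, jet (χ + s • δ) τ = jet χ τ + s • jet δ τ := by
  filter_upwards [hχ.1.ae_differentiableAt, hδ.1.ae_differentiableAt] with τ h1 h2 s
  have : deriv (χ.2.1 + s • δ.2.1) τ = deriv χ.2.1 τ + s • deriv δ.2.1 τ :=
    (h1.hasDerivAt.add (h2.hasDerivAt.const_smul s)).deriv
  simp [jet, this]

theorem MemY.ae_jet_sub {a b a' b' : Plane} {χ χ' : Triple} (hχ : MemY a b χ)
    (hχ' : MemY a' b' χ') :
    ∀ᵐ τ ∂unitMeasure, jet (χ - χ') τ = jet χ τ - jet χ' τ := by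
  filter_upwards [hχ.ae_jet_add_smul hχ'] with τ h
  simpa [sub_eq_add_neg] using h (-1)

theorem MemY.ae_jet_add {a b a' b' : Plane} {χ χ' : Triple} (hχ : MemY a b χ)
    (hχ' : MemY a' b' χ') :
    ∀ᵐ τ ∂unitMeasure, jet (χ + χ') τ = jet χ τ + jet χ' τ := by
  filter_upwards [hχ.ae_jet_add_smul hχ'] with τ h
  simpa using h 1

theorem norm_jet_le_sum (χ : Triple) (τ : ℝ) :
    ‖jet χ τ‖ ≤ |χ.1| + ‖χ.2.1 τ‖ + ‖deriv χ.2.1 τ‖ + ‖χ.2.2 τ‖ := by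
  have h1 := abs_nonneg χ.1
  have h2 := norm_nonneg (χ.2.1 τ)
  have h3 := norm_nonneg (deriv χ.2.1 τ)
  have h4 := norm_nonneg (χ.2.2 τ)
  simp only [jet, Prod.norm_def, sup_le_iff, Real.norm_eq_abs] at *
  refine ⟨?_, ?_, ?_, ?_⟩ <;> linarith

theorem yTwo_nonneg (χ : Triple) : 0 ≤ yTwo χ := by
  have h1 := normTwo_nonneg χ.2.1
  have h2 := normTwo_nonneg (deriv χ.2.1)
  have h3 := normTwo_nonneg χ.2.2
  have h4 := abs_nonneg χ.1
  unfold yTwo zTwo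
  linarith

theorem MemY.normTwo_jet_le {a b : Plane} {χ : Triple} (h : MemY a b χ) :
    normTwo (jet χ) ≤ yTwo χ := by
  have m1 : MemLp (fun _ : ℝ => |χ.1|) ⊤ unitMeasure := memLp_const _
  have m2 := h.1.memLp.norm
  have m3 := h.1.memLp_deriv.norm
  have m4 := h.2.norm
  have m := ((m1.add m2).add m3).add m4
  have e : ∀ {G : Type} [NormedAddCommGroup G] (φ : ℝ → G),
      normTwo (fun τ => ‖φ τ‖) = normTwo φ := fun φ => by
    rw [normTwo, normTwo, eLpNorm_norm]
  calc normTwo (jet χ) ≤ 1 * normTwo ((((fun _ : ℝ => |χ.1|) + fun τ => ‖χ.2.1 τ‖) +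
          fun τ => ‖deriv χ.2.1 τ‖) + fun τ => ‖χ.2.2 τ‖) := by
        refine normTwo_le_mul m zero_le_one (.of_forall fun τ => ?_)
        rw [one_mul]
        exact (norm_jet_le_sum χ τ).trans (le_abs_self _)
    _ ≤ yTwo χ := by
        rw [one_mul]
        refine (normTwo_add_le ((m1.add m2).add m3) m4).trans ?_
        rw [yTwo, zTwo, e χ.2.2]
        gcongr
        refine (normTwo_add_le (m1.add m2) m3).trans ?_
        rw [e (deriv χ.2.1)]
        gcongr
        refine (normTwo_add_le m1 m2).trans ?_
        rw [e χ.2.1, normTwo_const]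
        simp

theorem Nhood.ae_norm_jet_sub_le {xO xD : Plane} {χ χs : Triple} {R : ℝ}
    (hs : MemY xO xD χs) (h : χ ∈ Nhood xO xD χs R) :
    ∀ᵐ τ ∂unitMeasure, ‖jet χ τ - jet χs τ‖ ≤ R := by
  have hd : MemDeltaY (χ - χs) := h.1.sub hs
  filter_upwards [h.1.ae_jet_sub hs, ae_norm_le_normInf hd.1.memLp,
    ae_norm_le_normInf hd.1.memLp_deriv, ae_norm_le_normInf hd.2] with τ h1 h2 h3 h4
  rw [← h1]
  refine (norm_jet_le_sum _ τ).trans (le_trans ?_ h.2)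
  unfold yInf
  gcongr

/-- Two triples with vanishing `L²`-distance represent the same element. -/
theorem same_of_yTwo_sub_eq_zero {a b : Plane} {χ χ' : Triple} (h : MemY a b χ)
    (h' : MemY a b χ') (h0 : yTwo (χ - χ') = 0) : Same χ χ' := by
  have hd : MemDeltaY (χ - χ') := h.sub h'
  have n1 := normTwo_nonneg (χ - χ').2.1
  have n2 := normTwo_nonneg (deriv (χ - χ').2.1)
  have n3 := normTwo_nonneg (χ - χ').2.2
  have n4 := abs_nonneg (χ - χ').1
  unfold yTwo zTwo at h0
  refine ⟨?_, ?_, ?_⟩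
  · have : |(χ - χ').1| = 0 := by linarith
    exact sub_eq_zero.1 (abs_eq_zero.1 this)
  · have e := eqOn_zero_of_ae_eq_zero hd.1.continuousOn
      (ae_eq_zero_of_normTwo_eq_zero hd.1.memLp (by linarith))
    exact fun t ht => sub_eq_zero.1 (e ht)
  · filter_upwards [ae_eq_zero_of_normTwo_eq_zero hd.2 (by linarith)] with τ hτ
    exact sub_eq_zero.1 hτ

/-! ### Differentiation of integral functionals -/

section Functionals

theorem memLp_comp_continuous {E F : Type*} [NormedAddCommGroup E] [NormedAddCommGroup F]
    {p : ℝ → E} {Ψ : E → F}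
    [ProperSpace E] (hΨ : Continuous Ψ) (hp : MemLp p ⊤ unitMeasure) :
    MemLp (fun τ => Ψ (p τ)) ⊤ unitMeasure := by
  obtain ⟨C, -, hC⟩ := exists_ae_norm_le hp
  obtain ⟨M, hM⟩ := (isCompact_closedBall (0 : E) C).exists_bound_of_continuousOn
    hΨ.continuousOn
  refine memLp_top_of_bound (hΨ.comp_aestronglyMeasurable hp.1) M ?_
  filter_upwards [hC] with τ hτ
  exact hM _ (by simpa using hτ)

/-- A functional `p ↦ ∫ Ψ(τ, p)` with an integrand whose differential is bounded is differentiable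
along lines, and the derivative may be taken under the integral. -/
theorem hasDerivAt_integral_line {g g' : ℝ → ℝ → ℝ} {C : ℝ}
    (hg : ∀ s, AEStronglyMeasurable (g s) unitMeasure) (hg0 : Integrable (g 0) unitMeasure)
    (hg' : AEStronglyMeasurable (g' 0) unitMeasure)
    (hC : ∀ᵐ τ ∂unitMeasure, ∀ s, |g' s τ| ≤ C)
    (hd : ∀ᵐ τ ∂unitMeasure, ∀ s, HasDerivAt (fun s => g s τ) (g' s τ) s) :
    HasDerivAt (fun s => ∫ τ, g s τ ∂unitMeasure) (∫ τ, g' 0 τ ∂unitMeasure) 0 :=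
  (hasDerivAt_integral_of_dominated_loc_of_deriv_le (bound := fun _ => C) (s := univ)
    Filter.univ_mem (.of_forall hg) hg0 hg' (hC.mono fun _ h s _ => h s)
    (integrable_const C) (hd.mono fun _ h s _ => h s)).2

variable {E : Type*} [NormedAddCommGroup E] [NormedSpace ℝ E] [FiniteDimensional ℝ E]

theorem hasDerivAt_integral_comp_line {Ψ : E → ℝ} (hΨ : ContDiff ℝ 1 Ψ) {C : ℝ}
    (hC : ∀ p, ‖fderiv ℝ Ψ p‖ ≤ C) {p d : ℝ → E} (hp : MemLp p ⊤ unitMeasure)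
    (hd : MemLp d ⊤ unitMeasure) :
    HasDerivAt (fun s : ℝ => ∫ τ, Ψ (p τ + s • d τ) ∂unitMeasure)
      (∫ τ, fderiv ℝ Ψ (p τ) (d τ) ∂unitMeasure) 0 := by
  have hpr : ProperSpace E := FiniteDimensional.proper ℝ E
  obtain ⟨D, hD0, hD⟩ := exists_ae_norm_le hd
  have hm : ∀ s : ℝ, MemLp (fun τ => p τ + s • d τ) ⊤ unitMeasure := fun s =>
    hp.add (hd.const_smul s)
  have hc : Continuous (fderiv ℝ Ψ) := hΨ.continuous_fderiv one_ne_zero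
  have := hasDerivAt_integral_line (g := fun s τ => Ψ (p τ + s • d τ))
    (g' := fun s τ => fderiv ℝ Ψ (p τ + s • d τ) (d τ)) (C := C * D)
    (fun s => (memLp_comp_continuous hΨ.continuous (hm s)).1)
    (integrable_of_memLp_top (memLp_comp_continuous hΨ.continuous (hm 0)))
    ((isBoundedBilinearMap_apply (𝕜 := ℝ)).continuous.comp_aestronglyMeasurable
      ((memLp_comp_continuous hc (hm 0)).1.prodMk hd.1)) ?_ ?_
  · simpa using this
  · filter_upwards [hD] with τ hτ s
    exact ((fderiv ℝ Ψ _).le_opNorm _).trans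
      (mul_le_mul (hC _) hτ (norm_nonneg _) ((norm_nonneg _).trans (hC 0)))
  · refine .of_forall fun τ s => ?_
    have h1 : HasDerivAt (fun s : ℝ => p τ + s • d τ) (d τ) s := by
      simpa using ((hasDerivAt_id s).smul_const (d τ)).const_add (p τ)
    exact ((hΨ.differentiable one_ne_zero).differentiableAt.hasFDerivAt.comp_hasDerivAt s h1)

theorem hasDerivAt_integral_comp_line_apply {Ψ : E → E →L[ℝ] ℝ} (hΨ : ContDiff ℝ 1 Ψ) {C : ℝ}
    (hC : ∀ p, ‖fderiv ℝ Ψ p‖ ≤ C) {p d e : ℝ → E} (hp : MemLp p ⊤ unitMeasure)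
    (hd : MemLp d ⊤ unitMeasure) (he : MemLp e ⊤ unitMeasure) :
    HasDerivAt (fun s : ℝ => ∫ τ, Ψ (p τ + s • d τ) (e τ) ∂unitMeasure)
      (∫ τ, fderiv ℝ Ψ (p τ) (d τ) (e τ) ∂unitMeasure) 0 := by
  have hpr : ProperSpace E := FiniteDimensional.proper ℝ E
  obtain ⟨D, hD0, hD⟩ := exists_ae_norm_le hd
  obtain ⟨D', hD0', hD'⟩ := exists_ae_norm_le he
  have hm : ∀ s : ℝ, MemLp (fun τ => (p τ + s • d τ, e τ)) ⊤ unitMeasure := fun s =>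
    memLp_prod_iff.2 ⟨hp.add (hd.const_smul s), he⟩
  have hm' : MemLp (fun τ => (p τ, d τ, e τ)) ⊤ unitMeasure :=
    memLp_prod_iff.2 ⟨hp, memLp_prod_iff.2 ⟨hd, he⟩⟩
  have hc : Continuous (fderiv ℝ Ψ) := hΨ.continuous_fderiv one_ne_zero
  have hc0 := hΨ.continuous
  have hc1 : Continuous fun q : E × E => Ψ q.1 q.2 := by fun_prop
  have hc2 : Continuous fun q : E × E × E => fderiv ℝ Ψ q.1 q.2.1 q.2.2 := by fun_prop
  have := hasDerivAt_integral_line (g := fun s τ => Ψ (p τ + s • d τ) (e τ))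
    (g' := fun s τ => fderiv ℝ Ψ (p τ + s • d τ) (d τ) (e τ)) (C := C * D * D')
    (fun s => (memLp_comp_continuous hc1 (hm s)).1)
    (integrable_of_memLp_top (memLp_comp_continuous hc1 (hm 0)))
    (by simpa using (memLp_comp_continuous hc2 hm').1) ?_ ?_
  · simpa using this
  · filter_upwards [hD, hD'] with τ hτ hτ' s
    refine ((fderiv ℝ Ψ _ (d τ)).le_opNorm _).trans ?_
    have hC0 : 0 ≤ C := (norm_nonneg (fderiv ℝ Ψ 0)).trans (hC 0)
    refine mul_le_mul ?_ hτ' (norm_nonneg _) (by positivity)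
    exact ((fderiv ℝ Ψ _).le_opNorm _).trans (mul_le_mul (hC _) hτ (norm_nonneg _) hC0)
  · refine .of_forall fun τ s => ?_
    have h1 : HasDerivAt (fun s : ℝ => p τ + s • d τ) (d τ) s := by
      simpa using ((hasDerivAt_id s).smul_const (d τ)).const_add (p τ)
    have h2 := (hΨ.differentiable one_ne_zero).differentiableAt.hasFDerivAt.comp_hasDerivAt s h1
    exact (ContinuousLinearMap.apply ℝ ℝ (e τ)).hasFDerivAt.comp_hasDerivAt s h2

end Functionals

/-! ### Smooth localization of the integrand -/

/-- The integrand of the Lagrangian as a function of the jet. -/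
def integrand (v : ℝ) (w : Plane → Plane) (p : Jet) : ℝ :=
  timeRate v w p.2.1 p.2.2.1 + p.2.2.2 * (‖p.2.2.1‖ ^ 2 - p.1 ^ 2)

/-- The open convex set of jets of size less than `ρ` whose velocity advances in the direction
`u` at a rate larger than `r`. -/
def goodSet (u : Plane) (r ρ : ℝ) : Set Jet := {p | ‖p‖ < ρ ∧ r < inner ℝ u p.2.2.1}

theorem isOpen_goodSet (u : Plane) (r ρ : ℝ) : IsOpen (goodSet u r ρ) :=
  (isOpen_lt continuous_norm continuous_const).inter
    (isOpen_lt (f := fun _ : Jet => r) (g := fun p : Jet => inner ℝ u p.2.2.1) continuous_const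
      (by fun_prop))

section Integrand

variable {v : ℝ} {w : Plane → Plane}

theorem sq_sub_norm_sq_pos (hwv : ∀ x, ‖w x‖ < v) (x : Plane) : 0 < v ^ 2 - ‖w x‖ ^ 2 := by
  have h1 := hwv x
  have h2 := norm_nonneg (w x)
  nlinarith

theorem continuous_timeRate (hw : Continuous w) (hwv : ∀ x, ‖w x‖ < v) :
    Continuous fun q : Plane × Plane => timeRate v w q.1 q.2 := by
  unfold timeRate
  refine Continuous.div (by fun_prop) (by fun_prop) fun q => (sq_sub_norm_sq_pos hwv q.1).ne'

theorem contDiffAt_integrand (hw : ContDiff ℝ 3 w) (hwv : ∀ x, ‖w x‖ < v) {p : Jet}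
    (hp : p.2.2.1 ≠ 0) : ContDiffAt ℝ 3 (integrand v w) p := by
  have hpos := sq_sub_norm_sq_pos hwv p.2.1
  have hW : ContDiffAt ℝ 3 (fun p : Jet => w p.2.1) p :=
    hw.contDiffAt.comp p (by fun_prop)
  have hI : ContDiffAt ℝ 3 (fun p : Jet => inner ℝ p.2.2.1 (w p.2.1)) p :=
    ContDiffAt.inner ℝ (by fun_prop) hW
  have hN : ContDiffAt ℝ 3 (fun p : Jet => v ^ 2 - ‖w p.2.1‖ ^ 2) p :=
    contDiffAt_const.sub (hW.norm_sq ℝ)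
  have hY : ContDiffAt ℝ 3 (fun p : Jet => ‖p.2.2.1‖ ^ 2) p :=
    ContDiffAt.norm_sq ℝ (by fun_prop)
  have hS := ((hI.pow 2).add (hN.mul hY)).sqrt (by
    have : 0 < ‖p.2.2.1‖ := norm_pos_iff.2 hp
    positivity)
  have hL : ContDiffAt ℝ 3 (fun p : Jet => p.2.2.2 * (‖p.2.2.1‖ ^ 2 - p.1 ^ 2)) p :=
    ContDiffAt.mul (by fun_prop) (hY.sub (by fun_prop))
  exact ((hI.neg.add hS).div hN hpos.ne').add hL

/-- The integrand agrees on `goodSet u r ρ` with a compactly supported `C³` function. -/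
theorem exists_smooth_extension (hw : ContDiff ℝ 3 w) (hwv : ∀ x, ‖w x‖ < v) (u : Plane)
    {r ρ : ℝ} (hr : 0 < r) (hρ : 0 < ρ) :
    ∃ Φ : Jet → ℝ, ContDiff ℝ 3 Φ ∧ HasCompactSupport Φ ∧
      EqOn Φ (integrand v w) (goodSet u r ρ) := by
  let b : ContDiffBump (0 : Jet) := ⟨ρ, ρ + 1, hρ, by linarith⟩
  let s : Jet → ℝ := fun p => Real.smoothTransition (2 / r * inner ℝ u p.2.2.1 - 1)
  have hs : ContDiff ℝ 3 s := Real.smoothTransition.contDiff.comp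
    ((contDiff_const.mul (contDiff_const.inner ℝ (by fun_prop))).sub contDiff_const)
  refine ⟨fun p => b p * (s p * integrand v w p), ?_, b.hasCompactSupport.mul_right, ?_⟩
  · refine contDiff_iff_contDiffAt.2 fun p => b.contDiff.contDiffAt.mul ?_
    rcases lt_or_ge 0 (inner ℝ u p.2.2.1) with h | h
    · refine hs.contDiffAt.mul (contDiffAt_integrand hw hwv ?_)
      rintro h0
      simp [h0] at h
    · -- the cutoff vanishes where the rate of advance is at most `r / 2`
      have h1 : ∀ᶠ q in 𝓝 p, inner ℝ u q.2.2.1 < r / 2 := by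
        refine ContinuousAt.eventually_lt (by fun_prop) continuousAt_const ?_
        linarith
      refine (contDiffAt_const (c := (0 : ℝ))).congr_of_eventuallyEq ?_
      filter_upwards [h1] with q hq
      have : s q = 0 := Real.smoothTransition.zero_of_nonpos (by
        have : 2 / r * inner ℝ u q.2.2.1 ≤ 2 / r * (r / 2) := by gcongr
        have e : 2 / r * (r / 2) = 1 := by field_simp
        linarith)
      simp [this]
  · intro p hp
    have h1 : b p = 1 := b.one_of_mem_closedBall (by simpa using hp.1.le)
    have h2 : s p = 1 := Real.smoothTransition.one_of_one_le (by
      have : 2 / r * r ≤ 2 / r * inner ℝ u p.2.2.1 := by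
        gcongr; exact hp.2.le
      have e : 2 / r * r = 2 := by field_simp
      linarith)
    simp [h1, h2]

end Integrand

/-- Constants bounding the first two differentials of a compactly supported `C³` function, and a
Lipschitz constant for the second. -/
theorem exists_bounds_fderiv {E : Type*} [NormedAddCommGroup E] [NormedSpace ℝ E] {Φ : E → ℝ}
    (hΦ : ContDiff ℝ 3 Φ) (hc : HasCompactSupport Φ) :
    ∃ C : ℝ, 0 < C ∧ (∀ p, ‖fderiv ℝ Φ p‖ ≤ C) ∧ (∀ p, ‖fderiv ℝ (fderiv ℝ Φ) p‖ ≤ C) ∧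
      (∀ p q, ‖fderiv ℝ (fderiv ℝ Φ) p - fderiv ℝ (fderiv ℝ Φ) q‖ ≤ C * ‖p - q‖) := by
  have s1 : ContDiff ℝ 2 (fderiv ℝ Φ) := hΦ.fderiv_right (by norm_num)
  have s2 : ContDiff ℝ 1 (fderiv ℝ (fderiv ℝ Φ)) := s1.fderiv_right (by norm_num)
  have c1 : HasCompactSupport (fderiv ℝ Φ) := hc.fderiv ℝ
  have c2 : HasCompactSupport (fderiv ℝ (fderiv ℝ Φ)) := c1.fderiv ℝ
  have b1 : ∃ C, ∀ p, ‖fderiv ℝ Φ p‖ ≤ C := c1.exists_bound_of_continuous s1.continuous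
  have b2 : ∃ K, LipschitzWith K (fderiv ℝ Φ) :=
    s1.lipschitzWith_of_hasCompactSupport c1 two_ne_zero
  have b3 : ∃ K, LipschitzWith K (fderiv ℝ (fderiv ℝ Φ)) :=
    s2.lipschitzWith_of_hasCompactSupport c2 one_ne_zero
  obtain ⟨C1, h1⟩ := b1
  obtain ⟨C2, h2⟩ := b2
  obtain ⟨K, hK⟩ := b3
  refine ⟨max (max C1 C2) (max K 1), lt_max_of_lt_right (lt_max_of_lt_right one_pos),
    fun p => ?_, fun p => ?_, fun p q => ?_⟩
  · exact (h1 p).trans ((le_max_left _ _).trans (le_max_left _ _))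
  · exact (norm_fderiv_le_of_lipschitz ℝ h2).trans ((le_max_right _ _).trans (le_max_left _ _))
  · refine (lipschitzWith_iff_norm_sub_le.1 hK p q).trans
      (mul_le_mul_of_nonneg_right ?_ (norm_nonneg _))
    exact (le_max_left _ _).trans (le_max_right _ _)

/-! ### Jets of coordinate directions -/

/-- The direction of the length coordinate. -/
def dirL : Jet := (1, 0, 0, 0)

/-- The directions of the position coordinates. -/
def dirX : Plane →L[ℝ] Jet :=
  (0 : Plane →L[ℝ] ℝ).prod ((ContinuousLinearMap.id ℝ Plane).prod
    ((0 : Plane →L[ℝ] Plane).prod (0 : Plane →L[ℝ] ℝ)))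

/-- The directions of the velocity coordinates. -/
def dirY : Plane →L[ℝ] Jet :=
  (0 : Plane →L[ℝ] ℝ).prod ((0 : Plane →L[ℝ] Plane).prod
    ((ContinuousLinearMap.id ℝ Plane).prod (0 : Plane →L[ℝ] ℝ)))

/-- The direction of the multiplier coordinate. -/
def dirM : Jet := (0, 0, 0, 1)

theorem dirX_apply (x : Plane) : dirX x = (0, x, 0, 0) := rfl

theorem dirY_apply (y : Plane) : dirY y = (0, 0, y, 0) := rfl

theorem jet_decomposition (p : Jet) :
    p = p.1 • dirL + dirX p.2.1 + dirY p.2.2.1 + p.2.2.2 • dirM := by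
  simp [dirL, dirX_apply, dirY_apply, dirM]

section Structure

variable {v : ℝ} {w : Plane → Plane} {u : Plane} {r ρ : ℝ} {Φ : Jet → ℝ}

/-- The partial derivative of the localized integrand in the multiplier is the constraint. -/
theorem fderiv_dirM (hΦ : ContDiff ℝ 3 Φ) (he : EqOn Φ (integrand v w) (goodSet u r ρ)) {p : Jet}
    (hp : p ∈ goodSet u r ρ) : fderiv ℝ Φ p dirM = ‖p.2.2.1‖ ^ 2 - p.1 ^ 2 := by
  have h1 : HasDerivAt (fun s : ℝ => p + s • dirM) dirM 0 := by
    simpa using ((hasDerivAt_id (0 : ℝ)).smul_const dirM).const_add p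
  have hd : HasFDerivAt Φ (fderiv ℝ Φ p) (p + (0 : ℝ) • dirM) := by
    simpa using (hΦ.differentiable (by norm_num)).differentiableAt.hasFDerivAt
  have h2 := hd.comp_hasDerivAt (0 : ℝ) h1
  have h3 : HasDerivAt (fun s : ℝ => integrand v w (p + s • dirM))
      (‖p.2.2.1‖ ^ 2 - p.1 ^ 2) 0 := by
    have e : (fun s : ℝ => integrand v w (p + s • dirM)) = fun s : ℝ =>
        timeRate v w p.2.1 p.2.2.1 + (p.2.2.2 + s) * (‖p.2.2.1‖ ^ 2 - p.1 ^ 2) := by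
      funext s
      simp [integrand, dirM]
    rw [e]
    simpa using (((hasDerivAt_id (0 : ℝ)).const_add p.2.2.2).mul_const
      (‖p.2.2.1‖ ^ 2 - p.1 ^ 2)).const_add (timeRate v w p.2.1 p.2.2.1)
  refine h2.unique (h3.congr_of_eventuallyEq ?_)
  have hn : ∀ᶠ s : ℝ in 𝓝 0, p + s • dirM ∈ goodSet u r ρ :=
    h1.continuousAt.eventually_mem ((isOpen_goodSet u r ρ).mem_nhds (by simpa using hp))
  filter_upwards [hn] with s hs
  exact he hs

theorem fderiv_fderiv_dirM (hΦ : ContDiff ℝ 3 Φ) (he : EqOn Φ (integrand v w) (goodSet u r ρ))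
    {p : Jet} (hp : p ∈ goodSet u r ρ) (d : Jet) :
    fderiv ℝ (fderiv ℝ Φ) p d dirM = 2 * (inner ℝ p.2.2.1 d.2.2.1 - p.1 * d.1) := by
  have s1 : ContDiff ℝ 2 (fderiv ℝ Φ) := hΦ.fderiv_right (by norm_num)
  have h1 : HasFDerivAt (fun q => fderiv ℝ Φ q dirM)
      ((ContinuousLinearMap.apply ℝ ℝ dirM).comp (fderiv ℝ (fderiv ℝ Φ) p)) p :=
    (ContinuousLinearMap.apply ℝ ℝ dirM).hasFDerivAt.comp p
      (s1.differentiable (by norm_num)).differentiableAt.hasFDerivAt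
  let Y : Jet →L[ℝ] Plane := (ContinuousLinearMap.fst ℝ Plane ℝ).comp
    ((ContinuousLinearMap.snd ℝ Plane (Plane × ℝ)).comp
      (ContinuousLinearMap.snd ℝ ℝ (Plane × Plane × ℝ)))
  have hy : HasFDerivAt (fun q : Jet => q.2.2.1) Y p := Y.hasFDerivAt
  have hL : HasFDerivAt (fun q : Jet => q.1)
      (ContinuousLinearMap.fst ℝ ℝ (Plane × Plane × ℝ)) p := hasFDerivAt_fst
  have h2 := hy.norm_sq.sub (hL.pow 2)
  have h3 := h1.unique (h2.congr_of_eventuallyEq (by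
    filter_upwards [(isOpen_goodSet u r ρ).mem_nhds hp] with q hq
    exact fderiv_dirM hΦ he hq))
  have h4 := congrArg (fun T : Jet →L[ℝ] ℝ => T d) h3
  simp [Y] at h4
  rw [h4]
  ring

theorem fderiv_fderiv_dirM_left (hΦ : ContDiff ℝ 3 Φ)
    (he : EqOn Φ (integrand v w) (goodSet u r ρ)) {p : Jet} (hp : p ∈ goodSet u r ρ) (d : Jet) :
    fderiv ℝ (fderiv ℝ Φ) p dirM d = 2 * (inner ℝ p.2.2.1 d.2.2.1 - p.1 * d.1) := by
  rw [← fderiv_fderiv_dirM hΦ he hp d]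
  exact (hΦ.contDiffAt.isSymmSndFDerivAt (by simp; norm_num)) dirM d

/-! ### The derivatives of the Lagrangian -/

/-- The jets of a triple stay in `goodSet u r ρ`, with a margin. -/
def Inside (u : Plane) (r ρ : ℝ) (χ : Triple) : Prop :=
  ∃ ε : ℝ, 0 < ε ∧ ∀ᵐ τ ∂unitMeasure, Metric.closedBall (jet χ τ) ε ⊆ goodSet u r ρ

theorem Inside.ae_mem {χ : Triple} (h : Inside u r ρ χ) :
    ∀ᵐ τ ∂unitMeasure, jet χ τ ∈ goodSet u r ρ := by
  obtain ⟨ε, hε, h⟩ := h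
  filter_upwards [h] with τ hτ
  exact hτ (Metric.mem_closedBall_self hε.le)

theorem Inside.eventually_add_smul {a b : Plane} {χ δ : Triple} (h : Inside u r ρ χ)
    (hχ : MemY a b χ) (hδ : MemDeltaY δ) : ∀ᶠ s : ℝ in 𝓝 0, Inside u r ρ (χ + s • δ) := by
  obtain ⟨ε, hε, h⟩ := h
  obtain ⟨D, hD0, hD⟩ := exists_ae_norm_le hδ.memLp_jet
  have hs : ∀ᶠ s : ℝ in 𝓝 0, |s| * D < ε / 2 := by
    refine ContinuousAt.eventually_lt (by fun_prop) continuousAt_const ?_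
    simpa using half_pos hε
  filter_upwards [hs] with s hs
  refine ⟨ε / 2, half_pos hε, ?_⟩
  filter_upwards [h, hD, hχ.ae_jet_add_smul hδ] with τ h1 h2 h3
  refine subset_trans (Metric.closedBall_subset_closedBall' ?_) h1
  rw [h3 s, dist_eq_norm, add_sub_cancel_left, norm_smul, Real.norm_eq_abs]
  have : |s| * ‖jet δ τ‖ ≤ |s| * D := by gcongr
  linarith

theorem lagrangian_eq_integral (hw : Continuous w) (hwv : ∀ x, ‖w x‖ < v)
    (he : EqOn Φ (integrand v w) (goodSet u r ρ)) {a b : Plane} {χ : Triple} (hχ : MemY a b χ)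
    (h : Inside u r ρ χ) : lagrangian v w χ = ∫ τ, Φ (jet χ τ) ∂unitMeasure := by
  have hc1 : Continuous fun p : Jet => timeRate v w p.2.1 p.2.2.1 :=
    (continuous_timeRate hw hwv).comp (f := fun p : Jet => (p.2.1, p.2.2.1)) (by fun_prop)
  have hc2 : Continuous fun p : Jet => p.2.2.2 * (‖p.2.2.1‖ ^ 2 - p.1 ^ 2) := by fun_prop
  have i1 := integrable_of_memLp_top (memLp_comp_continuous hc1 hχ.memLp_jet)
  have i2 := integrable_of_memLp_top (memLp_comp_continuous hc2 hχ.memLp_jet)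
  rw [lagrangian, flightTime, ← integral_add (by exact i1) (by exact i2)]
  refine integral_congr_ae ?_
  filter_upwards [h.ae_mem] with τ hτ
  rw [he hτ]
  rfl

theorem kktMap_eq_integral (hw : Continuous w) (hwv : ∀ x, ‖w x‖ < v) (hΦ : ContDiff ℝ 3 Φ)
    (hcs : HasCompactSupport Φ) (he : EqOn Φ (integrand v w) (goodSet u r ρ)) {a b : Plane}
    {χ δ : Triple} (hχ : MemY a b χ) (hδ : MemDeltaY δ) (h : Inside u r ρ χ) :
    kktMap v w χ δ = ∫ τ, fderiv ℝ Φ (jet χ τ) (jet δ τ) ∂unitMeasure := by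
  obtain ⟨C, -, hC, -⟩ := exists_bounds_fderiv hΦ hcs
  have h1 := hasDerivAt_integral_comp_line (hΦ.of_le (by norm_num)) hC hχ.memLp_jet hδ.memLp_jet
  refine (h1.congr_of_eventuallyEq ?_).deriv
  filter_upwards [h.eventually_add_smul hχ hδ] with s hs
  rw [lagrangian_eq_integral hw hwv he (hχ.add_smul hδ s) hs]
  refine integral_congr_ae ?_
  filter_upwards [hχ.ae_jet_add_smul hδ] with τ hτ
  rw [hτ s]

theorem kktDeriv_eq_integral (hw : Continuous w) (hwv : ∀ x, ‖w x‖ < v) (hΦ : ContDiff ℝ 3 Φ)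
    (hcs : HasCompactSupport Φ) (he : EqOn Φ (integrand v w) (goodSet u r ρ)) {a b : Plane}
    {χ Δ δ : Triple} (hχ : MemY a b χ) (hΔ : MemDeltaY Δ) (hδ : MemDeltaY δ)
    (h : Inside u r ρ χ) :
    kktDeriv v w χ Δ δ =
      ∫ τ, fderiv ℝ (fderiv ℝ Φ) (jet χ τ) (jet Δ τ) (jet δ τ) ∂unitMeasure := by
  obtain ⟨C, -, -, hC, -⟩ := exists_bounds_fderiv hΦ hcs
  have s1 : ContDiff ℝ 2 (fderiv ℝ Φ) := hΦ.fderiv_right (by norm_num)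
  have h1 := hasDerivAt_integral_comp_line_apply (s1.of_le (by norm_num)) hC hχ.memLp_jet
    hΔ.memLp_jet hδ.memLp_jet
  refine (h1.congr_of_eventuallyEq ?_).deriv
  filter_upwards [h.eventually_add_smul hχ hΔ] with s hs
  rw [kktMap_eq_integral hw hwv hΦ hcs he (hχ.add_smul hΔ s) hδ hs]
  refine integral_congr_ae ?_
  filter_upwards [hχ.ae_jet_add_smul hΔ] with τ hτ
  rw [hτ s]

end Structure

/-! ### The second derivative as a bilinear form -/

/-- The second derivative of the localized Lagrangian `∫ Φ(jet χ)`. -/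
def hess (Φ : Jet → ℝ) (χ Δ δ : Triple) : ℝ :=
  ∫ τ, fderiv ℝ (fderiv ℝ Φ) (jet χ τ) (jet Δ τ) (jet δ τ) ∂unitMeasure

/-- The first derivative of the localized Lagrangian `∫ Φ(jet χ)`. -/
def grad (Φ : Jet → ℝ) (χ δ : Triple) : ℝ :=
  ∫ τ, fderiv ℝ Φ (jet χ τ) (jet δ τ) ∂unitMeasure

section Forms

variable {Φ : Jet → ℝ} {a b a' b' : Plane} {χ χ' Δ Δ' δ : Triple}

theorem continuous_fderiv_fderiv (hΦ : ContDiff ℝ 3 Φ) : Continuous (fderiv ℝ (fderiv ℝ Φ)) := by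
  have s1 : ContDiff ℝ 2 (fderiv ℝ Φ) := hΦ.fderiv_right (by norm_num)
  exact s1.continuous_fderiv two_ne_zero

theorem memLp_fderiv_fderiv (hΦ : ContDiff ℝ 3 Φ) {p q d : ℝ → Jet} (hp : MemLp p ⊤ unitMeasure)
    (hq : MemLp q ⊤ unitMeasure) (hd : MemLp d ⊤ unitMeasure) :
    MemLp (fun τ => fderiv ℝ (fderiv ℝ Φ) (p τ) (q τ) (d τ)) ⊤ unitMeasure := by
  have h := continuous_fderiv_fderiv hΦ
  have h2 : Continuous fun x : Jet × Jet × Jet =>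
      fderiv ℝ (fderiv ℝ Φ) x.1 x.2.1 x.2.2 := by fun_prop
  exact memLp_comp_continuous (p := fun τ => (p τ, q τ, d τ)) h2
    (memLp_prod_iff.2 ⟨hp, memLp_prod_iff.2 ⟨hq, hd⟩⟩)

theorem memLp_fderiv (hΦ : ContDiff ℝ 3 Φ) {p d : ℝ → Jet} (hp : MemLp p ⊤ unitMeasure)
    (hd : MemLp d ⊤ unitMeasure) :
    MemLp (fun τ => fderiv ℝ Φ (p τ) (d τ)) ⊤ unitMeasure := by
  have h : Continuous (fderiv ℝ Φ) := hΦ.continuous_fderiv (by norm_num)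
  have h2 : Continuous fun x : Jet × Jet => fderiv ℝ Φ x.1 x.2 := by fun_prop
  exact memLp_comp_continuous (p := fun τ => (p τ, d τ)) h2 (memLp_prod_iff.2 ⟨hp, hd⟩)

theorem hess_add_left (hΦ : ContDiff ℝ 3 Φ) (hχ : MemY a b χ) (hΔ : MemDeltaY Δ)
    (hΔ' : MemDeltaY Δ') (hδ : MemDeltaY δ) :
    hess Φ χ (Δ + Δ') δ = hess Φ χ Δ δ + hess Φ χ Δ' δ := by
  rw [hess, hess, hess, ← integral_add
    (integrable_of_memLp_top (memLp_fderiv_fderiv hΦ hχ.memLp_jet hΔ.memLp_jet hδ.memLp_jet))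
    (integrable_of_memLp_top (memLp_fderiv_fderiv hΦ hχ.memLp_jet hΔ'.memLp_jet hδ.memLp_jet))]
  refine integral_congr_ae ?_
  filter_upwards [MemY.ae_jet_add hΔ hΔ'] with τ hτ
  rw [hτ]
  simp

theorem hess_sub_left (hΦ : ContDiff ℝ 3 Φ) (hχ : MemY a b χ) (hΔ : MemDeltaY Δ)
    (hΔ' : MemDeltaY Δ') (hδ : MemDeltaY δ) :
    hess Φ χ (Δ - Δ') δ = hess Φ χ Δ δ - hess Φ χ Δ' δ := by
  rw [hess, hess, hess, ← integral_sub
    (integrable_of_memLp_top (memLp_fderiv_fderiv hΦ hχ.memLp_jet hΔ.memLp_jet hδ.memLp_jet))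
    (integrable_of_memLp_top (memLp_fderiv_fderiv hΦ hχ.memLp_jet hΔ'.memLp_jet hδ.memLp_jet))]
  refine integral_congr_ae ?_
  filter_upwards [MemY.ae_jet_sub hΔ hΔ'] with τ hτ
  rw [hτ]
  simp

theorem abs_hess_le {C : ℝ} (hC0 : 0 ≤ C) (hC : ∀ p, ‖fderiv ℝ (fderiv ℝ Φ) p‖ ≤ C)
    (hΔ : MemDeltaY Δ) (hδ : MemDeltaY δ) : |hess Φ χ Δ δ| ≤ C * (yTwo Δ * yTwo δ) := by
  refine (abs_integral_le_of_ae_le_mul hΔ.memLp_jet hδ.memLp_jet hC0 (.of_forall fun τ => ?_)).trans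
    (mul_le_mul_of_nonneg_left (mul_le_mul (MemY.normTwo_jet_le hΔ) (MemY.normTwo_jet_le hδ)
      (normTwo_nonneg _) (yTwo_nonneg _)) hC0)
  refine ((fderiv ℝ (fderiv ℝ Φ) (jet χ τ)).le_opNorm₂ _ _).trans ?_
  rw [mul_assoc]
  exact mul_le_mul_of_nonneg_right (hC _) (by positivity)

/-- The second derivatives at `L^∞`-close points are close as bilinear forms on `L²`. -/
theorem abs_hess_sub_hess_le (hΦ : ContDiff ℝ 3 Φ) {C R : ℝ} (hC0 : 0 ≤ C) (hR : 0 ≤ R)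
    (hC : ∀ p q, ‖fderiv ℝ (fderiv ℝ Φ) p - fderiv ℝ (fderiv ℝ Φ) q‖ ≤ C * ‖p - q‖)
    (hχ : MemY a b χ) (hχ' : MemY a' b' χ')
    (hd : ∀ᵐ τ ∂unitMeasure, ‖jet χ τ - jet χ' τ‖ ≤ R)
    (hΔ : MemDeltaY Δ) (hδ : MemDeltaY δ) :
    |hess Φ χ Δ δ - hess Φ χ' Δ δ| ≤ C * R * (yTwo Δ * yTwo δ) := by
  rw [hess, hess, ← integral_sub
    (integrable_of_memLp_top (memLp_fderiv_fderiv hΦ hχ.memLp_jet hΔ.memLp_jet hδ.memLp_jet))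
    (integrable_of_memLp_top (memLp_fderiv_fderiv hΦ hχ'.memLp_jet hΔ.memLp_jet hδ.memLp_jet))]
  refine (abs_integral_le_of_ae_le_mul hΔ.memLp_jet hδ.memLp_jet (mul_nonneg hC0 hR) ?_).trans
    (mul_le_mul_of_nonneg_left (mul_le_mul (MemY.normTwo_jet_le hΔ) (MemY.normTwo_jet_le hδ)
      (normTwo_nonneg _) (yTwo_nonneg _)) (mul_nonneg hC0 hR))
  filter_upwards [hd] with τ hτ
  have e := (fderiv ℝ (fderiv ℝ Φ) (jet χ τ) - fderiv ℝ (fderiv ℝ Φ) (jet χ' τ)).le_opNorm₂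
    (jet Δ τ) (jet δ τ)
  simp only [sub_apply] at e
  refine e.trans ?_
  rw [mul_assoc]
  exact mul_le_mul_of_nonneg_right ((hC _ _).trans (by gcongr)) (by positivity)

/-- First order Taylor expansion of the gradient, with the remainder estimated in `L²`. -/
theorem abs_grad_sub_grad_sub_hess_le (hΦ : ContDiff ℝ 3 Φ) {C R : ℝ} (hC0 : 0 ≤ C) (hR : 0 ≤ R)
    (hC : ∀ p q, ‖fderiv ℝ (fderiv ℝ Φ) p - fderiv ℝ (fderiv ℝ Φ) q‖ ≤ C * ‖p - q‖)
    (hχ : MemY a b χ) (hχ' : MemY a b χ')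
    (hd : ∀ᵐ τ ∂unitMeasure, ‖jet χ τ - jet χ' τ‖ ≤ R) (hδ : MemDeltaY δ) :
    |grad Φ χ δ - grad Φ χ' δ - hess Φ χ' (χ - χ') δ| ≤ C * R * (yTwo (χ - χ') * yTwo δ) := by
  have hΔ : MemDeltaY (χ - χ') := hχ.sub hχ'
  have i1 := integrable_of_memLp_top (memLp_fderiv hΦ hχ.memLp_jet hδ.memLp_jet)
  have i2 := integrable_of_memLp_top (memLp_fderiv hΦ hχ'.memLp_jet hδ.memLp_jet)
  have i3 := integrable_of_memLp_top
    (memLp_fderiv_fderiv hΦ hχ'.memLp_jet hΔ.memLp_jet hδ.memLp_jet)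
  rw [grad, grad, hess, ← integral_sub i1 i2, ← integral_sub (by exact i1.sub i2) i3]
  refine (abs_integral_le_of_ae_le_mul hΔ.memLp_jet hδ.memLp_jet (mul_nonneg hC0 hR) ?_).trans
    (mul_le_mul_of_nonneg_left (mul_le_mul (MemY.normTwo_jet_le hΔ) (MemY.normTwo_jet_le hδ)
      (normTwo_nonneg _) (yTwo_nonneg _)) (mul_nonneg hC0 hR))
  have s1 : ContDiff ℝ 2 (fderiv ℝ Φ) := hΦ.fderiv_right (by norm_num)
  filter_upwards [hd, hχ.ae_jet_sub hχ'] with τ hτ hj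
  have key : ‖fderiv ℝ Φ (jet χ τ) - fderiv ℝ Φ (jet χ' τ) -
      fderiv ℝ (fderiv ℝ Φ) (jet χ' τ) (jet χ τ - jet χ' τ)‖ ≤ C * R * ‖jet χ τ - jet χ' τ‖ := by
    refine (convex_segment (jet χ' τ) (jet χ τ)).norm_image_sub_le_of_norm_fderiv_le'
      (𝕜 := ℝ) (fun p _ => (s1.differentiable two_ne_zero).differentiableAt) (fun p hp => ?_)
      (left_mem_segment ℝ _ _) (right_mem_segment ℝ _ _)
    refine (hC _ _).trans (mul_le_mul_of_nonneg_left ?_ hC0)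
    refine le_trans ?_ hτ
    rw [norm_sub_rev (jet χ τ)]
    have := norm_sub_le_of_mem_segment hp
    rwa [norm_sub_rev (jet χ τ)] at this
  rw [hj]
  have e := (fderiv ℝ Φ (jet χ τ) - fderiv ℝ Φ (jet χ' τ) -
      fderiv ℝ (fderiv ℝ Φ) (jet χ' τ) (jet χ τ - jet χ' τ)).le_opNorm (jet δ τ)
  simp only [sub_apply] at e ⊢
  refine e.trans ?_
  rw [← mul_assoc]
  exact mul_le_mul_of_nonneg_right key (norm_nonneg _)

end Forms

/-! ### Stability of the linearized system -/

theorem normTwo_primitive_le {η : ℝ → Plane} (h : MemLp η ⊤ unitMeasure) :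
    normTwo (primitive η) ≤ normTwo η := by
  have h1 : ∫ τ, ‖η τ‖ ∂unitMeasure ≤ normTwo η := by
    have := integral_norm_mul_norm_le h (memLp_const (1 : ℝ) (μ := unitMeasure) (p := ⊤))
    simpa [normTwo_const] using this
  have h2 := normTwo_le_mul (φ := primitive η) (memLp_const (1 : ℝ) (μ := unitMeasure) (p := ⊤))
    (normTwo_nonneg η) (by
      filter_upwards [ae_unitMeasure_mem] with τ hτ
      simpa using (norm_primitive_le h (Ioo_subset_Icc_self hτ)).trans h1)
  simpa [normTwo_const] using h2

theorem yTwo_mk_zero (L : ℝ) (ξ : ℝ → Plane) : yTwo (L, ξ, 0) = zTwo L ξ := by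
  simp [yTwo, normTwo]

theorem yTwo_zero_mk (m : ℝ → ℝ) : yTwo (0, 0, m) = normTwo m := by
  have : deriv (0 : ℝ → Plane) = 0 := by
    funext t; exact deriv_const t (0 : Plane)
  simp [yTwo, zTwo, this]
  simp [normTwo]

theorem memDeltaY_mk_zero {L : ℝ} {ξ : ℝ → Plane} (h : IsPath 0 0 ξ) : MemDeltaY (L, ξ, 0) :=
  ⟨h, MemLp.zero⟩

theorem memDeltaY_zero_mk {m : ℝ → ℝ} (h : MemLp m ⊤ unitMeasure) : MemDeltaY (0, 0, m) :=
  ⟨⟨⟨0, LipschitzWith.const (0 : Plane) |>.lipschitzOnWith⟩, rfl, rfl⟩, h⟩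

theorem jet_zero_mk (m : ℝ → ℝ) (τ : ℝ) : jet (0, 0, m) τ = m τ • dirM := by
  have : deriv (0 : ℝ → Plane) τ = 0 := deriv_const τ (0 : Plane)
  simp [jet, dirM, this]

/-- The linearized constraint has a right inverse that is bounded in `L²`: the velocity of the
variation is taken parallel to the direction `u` in which the path advances, and the length is
adjusted so that the variation vanishes at both ends. -/
theorem exists_constraint_rightInverse {y : ℝ → Plane} (hy : MemLp y ⊤ unitMeasure) {L c : ℝ}
    {u : Plane} (hc : 0 < c) (hu : ‖u‖ = 1) (hL : L ≠ 0) (hyL : ∀ᵐ τ ∂unitMeasure, ‖y τ‖ = |L|)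
    (hadv : ∀ᵐ τ ∂unitMeasure, c ≤ inner ℝ u (y τ)) :
    ∃ C : ℝ, 0 < C ∧ ∀ m : ℝ → ℝ, MemLp m ⊤ unitMeasure → ∃ (δL : ℝ) (δξ : ℝ → Plane),
      IsPath 0 0 δξ ∧ zTwo δL δξ ≤ C * normTwo m ∧
      ∀ᵐ τ ∂unitMeasure, inner ℝ (y τ) (deriv δξ τ) - L * δL = m τ := by
  have hLpos : 0 < |L| := abs_pos.2 hL
  refine ⟨1 / c + 2 * (1 / c * (1 + |L| * (1 / c))), by positivity, fun m hm => ?_⟩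
  -- the reciprocal of the rate of advance
  set k : ℝ → ℝ := fun τ => (inner ℝ u (y τ))⁻¹ with hk
  have hkm : MemLp k ⊤ unitMeasure := by
    refine memLp_top_of_bound ?_ (1 / c) ?_
    · have : AEStronglyMeasurable (fun τ => inner ℝ u (y τ)) unitMeasure :=
        (by fun_prop : Continuous fun p : Plane => inner ℝ u p).comp_aestronglyMeasurable hy.1
      exact this.aemeasurable.inv.aestronglyMeasurable
    · filter_upwards [hadv] with τ hτ
      rw [hk, Real.norm_eq_abs, abs_inv, abs_of_pos (hc.trans_le hτ), one_div]
      exact inv_anti₀ hc hτ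
  have hkb : ∀ᵐ τ ∂unitMeasure, ‖k τ‖ ≤ 1 / c ∧ 1 / |L| ≤ k τ := by
    filter_upwards [hadv, hyL] with τ hτ hτ'
    refine ⟨?_, ?_⟩
    · rw [hk, Real.norm_eq_abs, abs_inv, abs_of_pos (hc.trans_le hτ), one_div]
      exact inv_anti₀ hc hτ
    · rw [hk, one_div]
      refine inv_anti₀ (hc.trans_le hτ) ?_
      have := real_inner_le_norm u (y τ)
      rwa [hu, hτ', one_mul] at this
  have hK : 1 / |L| ≤ ∫ τ, k τ ∂unitMeasure := by
    have := integral_mono_ae (integrable_const (1 / |L|)) (integrable_of_memLp_top hkm)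
      (hkb.mono fun τ h => h.2)
    simpa using this
  have hKpos : 0 < ∫ τ, k τ ∂unitMeasure := lt_of_lt_of_le (by positivity) hK
  set K := ∫ τ, k τ ∂unitMeasure with hKdef
  set I := ∫ τ, m τ * k τ ∂unitMeasure with hI
  have hmk : MemLp (fun τ => m τ * k τ) ⊤ unitMeasure := hkm.mul hm
  have hIle : |I| ≤ 1 / c * normTwo m := by
    have := abs_integral_le_of_ae_le_mul (g := fun τ => m τ * k τ) hm
      (memLp_const (1 : ℝ) (μ := unitMeasure) (p := ⊤)) (C := 1 / c) (by positivity) (by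
        filter_upwards [hkb] with τ h
        rw [norm_mul, norm_one, mul_one, mul_comm]
        exact mul_le_mul_of_nonneg_right h.1 (norm_nonneg _))
    simpa [normTwo_const] using this
  set δL : ℝ := -I / (L * K) with hδL
  have hδLle : |δL| ≤ 1 / c * normTwo m := by
    rw [hδL, abs_div, abs_neg, abs_mul, abs_of_pos hKpos]
    refine div_le_of_le_mul₀ (by positivity) (by have := normTwo_nonneg m; positivity) ?_
    have h1 : 1 ≤ |L| * K := by
      have := mul_le_mul_of_nonneg_left hK hLpos.le
      rwa [mul_one_div_cancel hLpos.ne'] at this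
    have h0 : 0 ≤ 1 / c * normTwo m := by have := normTwo_nonneg m; positivity
    nlinarith
  set η : ℝ → Plane := fun τ => ((m τ + L * δL) * k τ) • u with hη
  have hs : MemLp (fun τ => (m τ + L * δL) * k τ) ⊤ unitMeasure :=
    hkm.mul (hm.add (memLp_const (L * δL)))
  have hηm : MemLp η ⊤ unitMeasure := by
    refine memLp_comp_continuous (Ψ := fun s : ℝ => s • u) (by fun_prop) hs
  have hη0 : ∫ τ, η τ ∂unitMeasure = 0 := by
    rw [hη, integral_smul_const]
    have : ∫ τ, (m τ + L * δL) * k τ ∂unitMeasure = I + L * δL * K := by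
      rw [hI, hKdef, ← integral_const_mul, ← integral_add (integrable_of_memLp_top hmk)
        ((integrable_of_memLp_top hkm).const_mul _)]
      exact integral_congr_ae (.of_forall fun τ => by ring)
    have e : I + L * δL * K = 0 := by rw [hδL]; field_simp; ring
    rw [this, e, zero_smul]
  have hder := ae_deriv_primitive hηm
  have hηle : normTwo η ≤ 1 / c * (1 + |L| * (1 / c)) * normTwo m := by
    have e1 : normTwo η ≤ 1 / c * normTwo (m + fun _ => L * δL) := by
      refine normTwo_le_mul (hm.add (memLp_const (L * δL))) (by positivity) ?_
      filter_upwards [hkb] with τ h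
      rw [hη, norm_smul, hu, mul_one, norm_mul, mul_comm]
      exact mul_le_mul_of_nonneg_right h.1 (norm_nonneg _)
    have e2 := normTwo_add_le hm (memLp_const (L * δL))
    rw [normTwo_const, Real.norm_eq_abs, abs_mul] at e2
    have e3 : |L| * |δL| ≤ |L| * (1 / c * normTwo m) := by gcongr
    have e4 : normTwo (m + fun _ => L * δL) ≤ normTwo m + |L| * (1 / c * normTwo m) := by linarith
    calc _ ≤ _ := e1
      _ ≤ 1 / c * (normTwo m + |L| * (1 / c * normTwo m)) := by gcongr
      _ = _ := by ring
  refine ⟨δL, primitive η, isPath_primitive hηm hη0, ?_, ?_⟩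
  · have e1 := normTwo_primitive_le hηm
    rw [zTwo, normTwo_congr hder]
    calc _ ≤ 1 / c * normTwo m + 1 / c * (1 + |L| * (1 / c)) * normTwo m +
          1 / c * (1 + |L| * (1 / c)) * normTwo m := by gcongr; exact e1.trans hηle
      _ = _ := by ring
  · filter_upwards [hder, hadv] with τ h1 h2
    rw [h1, hη, hk]
    simp only [inner_smul_right]
    rw [real_inner_comm u (y τ), mul_assoc, inv_mul_cancel₀ (hc.trans_le h2).ne']
    ring

/-- The part of the second derivative that involves a variation of the multiplier is twice the
linearized constraint. -/
def ConstraintStructure (Φ : Jet → ℝ) (χ : Triple) : Prop :=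
  ∀ᵐ τ ∂unitMeasure, ∀ d, fderiv ℝ (fderiv ℝ Φ) (jet χ τ) d dirM =
      2 * (inner ℝ (deriv χ.2.1 τ) d.2.2.1 - χ.1 * d.1) ∧
    fderiv ℝ (fderiv ℝ Φ) (jet χ τ) dirM d =
      2 * (inner ℝ (deriv χ.2.1 τ) d.2.2.1 - χ.1 * d.1)

theorem hess_multiplier_right {Φ : Jet → ℝ} {χ : Triple} (hM : ConstraintStructure Φ χ)
    (D : Triple) (m : ℝ → ℝ) : hess Φ χ D (0, 0, m) =
      ∫ τ, 2 * (m τ * (inner ℝ (deriv χ.2.1 τ) (deriv D.2.1 τ) - χ.1 * D.1)) ∂unitMeasure := by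
  refine integral_congr_ae ?_
  filter_upwards [hM] with τ hτ
  rw [jet_zero_mk, map_smul, (hτ _).1]
  simp only [jet, smul_eq_mul]
  ring

theorem hess_multiplier_left {Φ : Jet → ℝ} {χ : Triple} (hM : ConstraintStructure Φ χ)
    (D : Triple) (m : ℝ → ℝ) : hess Φ χ (0, 0, m) D =
      ∫ τ, 2 * (m τ * (inner ℝ (deriv χ.2.1 τ) (deriv D.2.1 τ) - χ.1 * D.1)) ∂unitMeasure := by
  refine integral_congr_ae ?_
  filter_upwards [hM] with τ hτ
  rw [jet_zero_mk, map_smul, smul_apply, (hτ _).2]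
  simp only [jet, smul_eq_mul]
  ring

theorem yTwo_add_le {Δ δ : Triple} (hΔ : MemDeltaY Δ) (hδ : MemDeltaY δ) :
    yTwo (Δ + δ) ≤ yTwo Δ + yTwo δ := by
  have e : deriv (Δ + δ).2.1 =ᵐ[unitMeasure] deriv Δ.2.1 + deriv δ.2.1 := by
    filter_upwards [MemY.ae_jet_add hΔ hδ] with τ h
    exact congrArg (fun p : Jet => p.2.2.1) h
  have e1 := normTwo_add_le hΔ.1.memLp hδ.1.memLp
  have e2 := normTwo_add_le hΔ.1.memLp_deriv hδ.1.memLp_deriv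
  have e3 := abs_add_le Δ.1 δ.1
  have e6 := normTwo_add_le hΔ.2 hδ.2
  rw [← normTwo_congr e] at e2
  have e4 : (Δ + δ).1 = Δ.1 + δ.1 := rfl
  have e5 : (Δ + δ).2.1 = Δ.2.1 + δ.2.1 := rfl
  have e7 : (Δ + δ).2.2 = Δ.2.2 + δ.2.2 := rfl
  unfold yTwo zTwo
  rw [e4, e7]
  rw [← e5] at e1
  linarith

theorem MemDeltaY.add {Δ δ : Triple} (hΔ : MemDeltaY Δ) (hδ : MemDeltaY δ) :
    MemDeltaY (Δ + δ) := by
  have h := MemY.add_smul hΔ hδ 1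
  rwa [one_smul] at h

theorem le_of_mul_sq_le {B x K : ℝ} (hB : 0 < B) (hx : 0 ≤ x) (hK : 0 ≤ K)
    (h : B * x ^ 2 ≤ K * x) : x ≤ K / B := by
  rw [le_div_iff₀ hB]
  rcases hx.eq_or_lt with h0 | h0
  · rw [← h0, zero_mul]; exact hK
  · exact le_of_mul_le_mul_right (by nlinarith) h0

/-- The `L²`-size of the linearized constraint is controlled by pairing with multipliers. -/
theorem normTwo_constraint_le {Φ : Jet → ℝ} {a b : Plane} {χ : Triple} (hχ : MemY a b χ)
    (hM : ConstraintStructure Φ χ) {Δ : Triple} (hΔ : MemDeltaY Δ) {ε : ℝ} (hε : 0 ≤ ε)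
    (hres : ∀ δ, MemDeltaY δ → |hess Φ χ Δ δ| ≤ ε * yTwo δ) :
    ∃ m : ℝ → ℝ, MemLp m ⊤ unitMeasure ∧ normTwo m ≤ ε / 2 ∧
      ∀ τ, m τ = inner ℝ (deriv χ.2.1 τ) (deriv Δ.2.1 τ) - χ.1 * Δ.1 := by
  have hmm : MemLp (fun τ => inner ℝ (deriv χ.2.1 τ) (deriv Δ.2.1 τ) - χ.1 * Δ.1) ⊤
      unitMeasure :=
    memLp_comp_continuous (p := fun τ => (deriv χ.2.1 τ, deriv Δ.2.1 τ))
      (Ψ := fun q : Plane × Plane => inner ℝ q.1 q.2 - χ.1 * Δ.1) (by fun_prop)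
      (memLp_prod_iff.2 ⟨hχ.1.memLp_deriv, hΔ.1.memLp_deriv⟩)
  refine ⟨_, hmm, ?_, fun _ => rfl⟩
  have h1 := hres _ (memDeltaY_zero_mk hmm)
  rw [hess_multiplier_right hM, yTwo_zero_mk, integral_const_mul] at h1
  have h2 := normTwo_sq hmm
  simp only [Real.norm_eq_abs, sq_abs] at h2
  simp only [← sq] at h1
  rw [← h2, abs_of_nonneg (by positivity)] at h1
  exact le_of_mul_sq_le two_pos (normTwo_nonneg _) hε h1

/-- Brezzi's stability estimate: coercivity on the kernel of the linearized constraint and a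
bounded right inverse of the constraint bound a direction by the dual `L²`-norm of its image under
the second derivative. -/
theorem stability_of_coercive {Φ : Jet → ℝ} (hΦ : ContDiff ℝ 3 Φ) {a b : Plane} {χ : Triple}
    (hχ : MemY a b χ) {C : ℝ} (hC0 : 0 < C) (hC : ∀ p, ‖fderiv ℝ (fderiv ℝ Φ) p‖ ≤ C)
    (hM : ConstraintStructure Φ χ)
    {S : ℝ} (hS0 : 0 < S) (hS : ∀ m : ℝ → ℝ, MemLp m ⊤ unitMeasure →
      ∃ (δL : ℝ) (δξ : ℝ → Plane), IsPath 0 0 δξ ∧ zTwo δL δξ ≤ S * normTwo m ∧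
        ∀ᵐ τ ∂unitMeasure, inner ℝ (deriv χ.2.1 τ) (deriv δξ τ) - χ.1 * δL = m τ)
    {B : ℝ} (hB : 0 < B) (hcoer : ∀ (δL : ℝ) (δξ : ℝ → Plane), IsPath 0 0 δξ →
      (∀ᵐ τ ∂unitMeasure, inner ℝ (deriv δξ τ) (deriv χ.2.1 τ) = δL * χ.1) →
        B * zTwo δL δξ ^ 2 ≤ hess Φ χ (δL, δξ, 0) (δL, δξ, 0)) :
    ∃ γ : ℝ, 0 < γ ∧ ∀ Δ : Triple, MemDeltaY Δ → ∀ ε : ℝ, 0 ≤ ε →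
      (∀ δ, MemDeltaY δ → |hess Φ χ Δ δ| ≤ ε * yTwo δ) → yTwo Δ ≤ γ * ε := by
  obtain ⟨G1, hG1⟩ : ∃ G1, G1 = (1 + C * S) / B := ⟨_, rfl⟩
  obtain ⟨G2, hG2⟩ : ∃ G2, G2 = G1 + S := ⟨_, rfl⟩
  have hG1p : 0 < G1 := by rw [hG1]; positivity
  have hG2p : 0 < G2 := by rw [hG2]; positivity
  refine ⟨G2 + S * (1 + C * G2), by positivity, fun Δ hΔ ε hε hres => ?_⟩
  obtain ⟨m, hmm, hmle, hm⟩ := normTwo_constraint_le hχ hM hΔ hε hres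
  obtain ⟨σL, σξ, hσ, hσle, hσm⟩ := hS m hmm
  have hσY : MemDeltaY (σL, σξ, 0) := memDeltaY_mk_zero hσ
  have hσ2 : yTwo (σL, σξ, 0) ≤ S * ε := by
    rw [yTwo_mk_zero]
    exact hσle.trans (mul_le_mul_of_nonneg_left (by linarith) hS0.le)
  -- the kernel component
  obtain ⟨z, hz⟩ : ∃ z : Triple, z = (Δ.1 - σL, Δ.2.1 - σξ, 0) := ⟨_, rfl⟩
  obtain ⟨σ, hσdef⟩ : ∃ σ : Triple, σ = (σL, σξ, 0) := ⟨_, rfl⟩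
  rw [← hσdef] at hσY hσ2
  have hzp : IsPath 0 0 z.2.1 := by
    simpa [hz, sub_eq_add_neg] using hΔ.1.combine hσ (-1)
  have hz2 : z = (z.1, z.2.1, 0) := by rw [hz]
  have hzY : MemDeltaY z := by rw [hz2]; exact memDeltaY_mk_zero hzp
  have hμY : MemDeltaY (0, 0, Δ.2.2) := memDeltaY_zero_mk hΔ.2
  have hzσY : MemDeltaY (z + σ) := MemDeltaY.add hzY hσY
  have hdec : Δ = z + σ + (0, 0, Δ.2.2) := by
    simp [hz, hσdef]
  have hΔz : z + σ = (Δ.1, Δ.2.1, 0) := by simp [hz, hσdef]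
  have hzd : ∀ᵐ τ ∂unitMeasure,
      inner ℝ (deriv χ.2.1 τ) (deriv z.2.1 τ) - χ.1 * z.1 = 0 := by
    filter_upwards [hσm, MemY.ae_jet_sub hΔ hσY] with τ h1 h2
    have h3 : deriv z.2.1 τ = deriv Δ.2.1 τ - deriv σξ τ := by
      rw [hσdef] at h2
      rw [hz]
      exact congrArg (fun p : Jet => p.2.2.1) h2
    have h4 : z.1 = Δ.1 - σL := by rw [hz]
    rw [h3, h4, inner_sub_right]
    rw [hm] at h1
    linarith
  have hzker := hcoer z.1 z.2.1 hzp (by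
    filter_upwards [hzd] with τ h
    rw [real_inner_comm]
    linarith)
  have hzσ : hess Φ χ Δ z = hess Φ χ z z + hess Φ χ σ z := by
    have h0 : hess Φ χ (0, 0, Δ.2.2) z = 0 := by
      rw [hess_multiplier_left hM]
      refine integral_eq_zero_of_ae ?_
      filter_upwards [hzd] with τ h
      simp [h]
    have h1 := hess_add_left hΦ hχ hzσY hμY hzY
    rw [← hdec, hess_add_left hΦ hχ hzY hσY hzY, h0, add_zero] at h1
    exact h1
  have hz0 := yTwo_nonneg z
  have hzle : yTwo z ≤ G1 * ε := by
    have h1 := abs_le.1 (hres z hzY)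
    have h2 := abs_le.1 (abs_hess_le (χ := χ) hC0.le hC hσY hzY)
    have h3 : C * (yTwo σ * yTwo z) ≤ C * (S * ε * yTwo z) :=
      mul_le_mul_of_nonneg_left (mul_le_mul_of_nonneg_right hσ2 hz0) hC0.le
    have h4 : B * yTwo z ^ 2 ≤ hess Φ χ z z := by
      rw [← hz2] at hzker
      rw [hz2, yTwo_mk_zero, ← hz2]
      exact hzker
    have h5 := le_of_mul_sq_le (K := (1 + C * S) * ε) hB hz0 (by positivity) (by linarith)
    rw [hG1]
    exact h5.trans_eq (by ring)
  have hzσ2 : yTwo (z + σ) ≤ G2 * ε := by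
    have h1 := yTwo_add_le hzY hσY
    rw [hG2, add_mul]
    linarith
  -- the multiplier component
  have hμ2 : normTwo Δ.2.2 ≤ S * (1 + C * G2) * ε := by
    obtain ⟨tL, tξ, ht, htle, htm⟩ := hS Δ.2.2 hΔ.2
    have htY : MemDeltaY (tL, tξ, 0) := memDeltaY_mk_zero ht
    have h1 : hess Φ χ (0, 0, Δ.2.2) (tL, tξ, 0) = 2 * normTwo Δ.2.2 ^ 2 := by
      rw [hess_multiplier_left hM, normTwo_sq hΔ.2, ← integral_const_mul]
      refine integral_congr_ae ?_
      filter_upwards [htm] with τ h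
      rw [h, Real.norm_eq_abs, sq_abs]
      ring
    have ht2 : yTwo (tL, tξ, 0) ≤ S * normTwo Δ.2.2 := by rw [yTwo_mk_zero]; exact htle
    obtain ⟨t, htdef⟩ : ∃ t : Triple, t = (tL, tξ, 0) := ⟨_, rfl⟩
    rw [← htdef] at htY h1 ht2
    have h2 := hess_add_left hΦ hχ hzσY hμY htY
    rw [← hdec] at h2
    have h3 := abs_le.1 (hres t htY)
    have h4 := abs_le.1 (abs_hess_le (χ := χ) hC0.le hC hzσY htY)
    have ht0 := yTwo_nonneg t
    have h5 : C * (yTwo (z + σ) * yTwo t) ≤ C * (G2 * ε * yTwo t) :=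
      mul_le_mul_of_nonneg_left (mul_le_mul_of_nonneg_right hzσ2 ht0) hC0.le
    have h7 : (1 + C * G2) * ε * yTwo t ≤ (1 + C * G2) * ε * (S * normTwo Δ.2.2) :=
      mul_le_mul_of_nonneg_left ht2 (by positivity)
    have h8 := normTwo_nonneg Δ.2.2
    have h9 : 0 ≤ S * (1 + C * G2) * ε := by positivity
    have h10 := le_of_mul_sq_le (K := S * (1 + C * G2) * ε) two_pos h8 h9 (by linarith)
    linarith
  have hfin : yTwo Δ = yTwo (z + σ) + normTwo Δ.2.2 := by
    rw [hΔz, yTwo_mk_zero]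
    rfl
  rw [hfin, add_mul]
  linarith

/-! ### The strengthened Legendre condition -/

/-- Rotation of the plane by a right angle. -/
def rot (y : Plane) : Plane := !₂[-(y 1), y 0]

theorem continuous_rot : Continuous rot := by
  unfold rot
  fun_prop

theorem norm_sq_plane (y : Plane) : ‖y‖ ^ 2 = y 0 ^ 2 + y 1 ^ 2 := by
  rw [EuclideanSpace.norm_sq_eq]
  simp

theorem inner_plane (x y : Plane) : inner ℝ x y = x 0 * y 0 + x 1 * y 1 := by
  simp [PiLp.inner_apply, Fin.sum_univ_two, mul_comm]

theorem norm_rot (y : Plane) : ‖rot y‖ = ‖y‖ := by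
  rw [← sq_eq_sq₀ (norm_nonneg _) (norm_nonneg _), norm_sq_plane, norm_sq_plane]
  simp [rot]
  ring

theorem inner_rot_self (y : Plane) : inner ℝ (rot y) y = 0 := by
  rw [inner_plane]
  simp [rot]
  ring

theorem norm_sq_smul_eq (y x : Plane) :
    ‖y‖ ^ 2 • x = inner ℝ y x • y + inner ℝ (rot y) x • rot y := by
  rw [norm_sq_plane, inner_plane, inner_plane]
  ext i
  fin_cases i <;> simp [rot] <;> ring

/-- On every set of positive measure there live arbitrarily concentrated nonzero amplitudes that
are orthogonal to a given vector field. -/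
theorem exists_concentrated_amplitude {S : Set ℝ} (hS : MeasurableSet S) (hS0 : unitMeasure S ≠ 0)
    {n : ℝ → Plane} (hn : MemLp n ⊤ unitMeasure) {σ : ℝ} (hσ : 0 < σ) :
    ∃ φ : ℝ → ℝ, MemLp φ ⊤ unitMeasure ∧ 0 < normTwo φ ∧ ∫ τ, φ τ • n τ ∂unitMeasure = 0 ∧
      (∀ τ ∉ S, φ τ = 0) ∧ ∫ τ, ‖φ τ‖ ∂unitMeasure ≤ σ * normTwo φ := by
  obtain ⟨x, -, hx⟩ := exists_mem_forall_mem_nhdsWithin_pos_measure hS0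
  set r := σ ^ 2 / 2 with hr
  have hr0 : 0 < r := by positivity
  set S' := S ∩ Metric.ball x r with hS'
  have hS'm : MeasurableSet S' := hS.inter Metric.isOpen_ball.measurableSet
  have hS'0 : 0 < unitMeasure S' := hx S' (Filter.inter_mem self_mem_nhdsWithin
    (mem_nhdsWithin_of_mem_nhds (Metric.ball_mem_nhds x hr0)))
  have hS'le : unitMeasure.real S' ≤ σ ^ 2 := by
    refine ENNReal.toReal_le_of_le_ofReal (by positivity) ?_
    calc unitMeasure S' ≤ volume S' := Measure.restrict_apply_le _ _
      _ ≤ volume (Metric.ball x r) := measure_mono inter_subset_right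
      _ = ENNReal.ofReal (σ ^ 2) := by rw [Real.volume_ball, hr]; congr 1; ring
  -- three moments in the plane are linearly dependent
  have hmono : ∀ i : Fin 3, MemLp (S'.indicator fun τ : ℝ => τ ^ (i : ℕ)) ⊤ unitMeasure :=
    fun i => (memLp_of_continuousOn (by fun_prop)).indicator hS'm
  have hmn : ∀ i : Fin 3, MemLp (fun τ => (S'.indicator fun τ : ℝ => τ ^ (i : ℕ)) τ • n τ) ⊤
      unitMeasure := fun i => MemLp.smul hn (hmono i)
  set V : Fin 3 → Plane := fun i =>
    ∫ τ, (S'.indicator fun τ : ℝ => τ ^ (i : ℕ)) τ • n τ ∂unitMeasure with hV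
  have hdep : ¬ LinearIndependent ℝ V := fun h => by
    have := h.fintype_card_le_finrank
    simp at this
  obtain ⟨g, hg, i₀, hi₀⟩ := Fintype.not_linearIndependent_iff.1 hdep
  set φ : ℝ → ℝ := fun τ => ∑ i : Fin 3, g i * (S'.indicator fun τ : ℝ => τ ^ (i : ℕ)) τ with hφ
  have hφm : MemLp φ ⊤ unitMeasure :=
    memLp_finsetSum _ fun i _ => (hmono i).const_mul (g i)
  have hout : ∀ τ ∉ S', φ τ = 0 := fun τ hτ => by simp [hφ, hτ]
  have hN : 0 < normTwo φ := by
    refine (normTwo_nonneg φ).lt_of_ne' fun h0 => ?_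
    have hz := ae_eq_zero_of_normTwo_eq_zero hφm h0
    set P : Polynomial ℝ := ∑ i : Fin 3, Polynomial.monomial (i : ℕ) (g i) with hP
    have hP0 : P ≠ 0 := fun h => hi₀ (by
      have h1 := congrArg (fun Q : Polynomial ℝ => Q.coeff i₀) h
      simp only [hP, Polynomial.finsetSum_coeff, Polynomial.coeff_monomial,
        Polynomial.coeff_zero] at h1
      rw [Finset.sum_eq_single i₀ (fun j _ hj => by simp [Fin.val_ne_of_ne hj])
        (by simp)] at h1
      simpa using h1)
    have hfin : ({τ | P.IsRoot τ} : Set ℝ).Finite := Polynomial.finite_setOfPred_isRoot hP0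
    have hnull : unitMeasure {τ | P.IsRoot τ} = 0 :=
      le_antisymm ((Measure.restrict_apply_le _ _).trans (hfin.measure_zero volume).le) bot_le
    have hae : ∀ᵐ τ ∂unitMeasure, τ ∉ S' := by
      filter_upwards [hz, measure_eq_zero_iff_ae_notMem.1 hnull] with τ h1 h2 h3
      refine h2 ?_
      have e : P.eval τ = φ τ := by
        simp [hP, hφ, h3, Polynomial.eval_finsetSum]
      change P.eval τ = 0
      rw [e, h1]
      rfl
    exact hS'0.ne' (measure_eq_zero_iff_ae_notMem.2 hae)
  refine ⟨φ, hφm, hN, ?_, fun τ hτ => hout τ fun h => hτ h.1, ?_⟩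
  · rw [← hg]
    have : (fun τ => φ τ • n τ) = fun τ => ∑ i : Fin 3,
        g i • ((S'.indicator fun τ : ℝ => τ ^ (i : ℕ)) τ • n τ) := by
      funext τ
      simp only [hφ, Finset.sum_smul, mul_smul]
    have hi : ∀ i ∈ Finset.univ, Integrable (fun τ =>
        g i • ((S'.indicator fun τ : ℝ => τ ^ (i : ℕ)) τ • n τ)) unitMeasure :=
      fun i _ => (integrable_of_memLp_top (hmn i)).smul (g i)
    rw [this, integral_finsetSum _ hi]
    exact Finset.sum_congr rfl fun i _ => integral_smul _ _
  · have hone : MemLp (S'.indicator fun _ : ℝ => (1 : ℝ)) ⊤ unitMeasure :=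
      (memLp_const 1).indicator hS'm
    have h1 := integral_norm_mul_norm_le hφm hone
    have h2 : normTwo (S'.indicator fun _ : ℝ => (1 : ℝ)) ≤ σ := by
      rw [← sq_le_sq₀ (normTwo_nonneg _) hσ.le, normTwo_sq hone]
      have : (fun τ => ‖S'.indicator (fun _ : ℝ => (1 : ℝ)) τ‖ ^ 2) =
          S'.indicator fun _ : ℝ => (1 : ℝ) := by
        funext τ
        by_cases h : τ ∈ S' <;> simp [h]
      rw [this, integral_indicator_const _ hS'm]
      simpa using hS'le
    have h3 : ∫ τ, ‖φ τ‖ * ‖S'.indicator (fun _ : ℝ => (1 : ℝ)) τ‖ ∂unitMeasure =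
        ∫ τ, ‖φ τ‖ ∂unitMeasure := by
      refine integral_congr_ae (.of_forall fun τ => ?_)
      by_cases h : τ ∈ S'
      · simp [h]
      · simp [h, hout τ h]
    rw [h3] at h1
    calc _ ≤ _ := h1
      _ ≤ normTwo φ * σ := mul_le_mul_of_nonneg_left h2 (normTwo_nonneg _)
      _ = _ := mul_comm _ _

/-- The second derivative of the integrand in the velocity, transversally to the velocity. -/
def transversal (Φ : Jet → ℝ) (p : Jet) : ℝ :=
  fderiv ℝ (fderiv ℝ Φ) p (dirY (rot p.2.2.1)) (dirY (rot p.2.2.1))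

theorem continuous_transversal {Φ : Jet → ℝ} (hΦ : ContDiff ℝ 3 Φ) :
    Continuous (transversal Φ) := by
  have h := continuous_fderiv_fderiv hΦ
  have h1 : Continuous fun p : Jet => dirY (rot p.2.2.1) :=
    dirY.continuous.comp (continuous_rot.comp (by fun_prop))
  unfold transversal
  exact (h.clm_apply h1).clm_apply h1

theorem norm_dirX (x : Plane) : ‖dirX x‖ = ‖x‖ := by
  simp [dirX_apply, Prod.norm_def]

theorem norm_dirY (x : Plane) : ‖dirY x‖ = ‖x‖ := by
  simp [dirY_apply, Prod.norm_def]

/-- Coercivity of the second derivative on the kernel of the linearized constraint forces its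
principal part to be positive: variations that concentrate near a point leave only the term
quadratic in the velocity. -/
theorem ae_le_transversal {Φ : Jet → ℝ} (hΦ : ContDiff ℝ 3 Φ) {a b : Plane} {χ : Triple}
    (hχ : MemY a b χ) {C : ℝ} (hC0 : 0 < C) (hC : ∀ p, ‖fderiv ℝ (fderiv ℝ Φ) p‖ ≤ C)
    (hL : χ.1 ≠ 0) (hyL : ∀ᵐ τ ∂unitMeasure, ‖deriv χ.2.1 τ‖ = |χ.1|)
    {B : ℝ} (hB : 0 < B) (hcoer : ∀ (δL : ℝ) (δξ : ℝ → Plane), IsPath 0 0 δξ →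
      (∀ᵐ τ ∂unitMeasure, inner ℝ (deriv δξ τ) (deriv χ.2.1 τ) = δL * χ.1) →
        B * zTwo δL δξ ^ 2 ≤ hess Φ χ (δL, δξ, 0) (δL, δξ, 0)) :
    ∀ᵐ τ ∂unitMeasure, B / 2 * χ.1 ^ 2 ≤ transversal Φ (jet χ τ) := by
  have hqm : MemLp (fun τ => transversal Φ (jet χ τ)) ⊤ unitMeasure :=
    memLp_comp_continuous (continuous_transversal hΦ) hχ.memLp_jet
  obtain ⟨q, hqs, hq⟩ := hqm.1
  set S : Set ℝ := {τ | q τ < B / 2 * χ.1 ^ 2} with hS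
  have hSm : MeasurableSet S := measurableSet_lt hqs.measurable measurable_const
  by_contra hcon
  have hS0 : unitMeasure S ≠ 0 := fun h => hcon (by
    filter_upwards [measure_eq_zero_iff_ae_notMem.1 h, hq] with τ h1 h2
    rw [h2]
    exact not_lt.1 h1)
  have hnm : MemLp (fun τ => rot (deriv χ.2.1 τ)) ⊤ unitMeasure :=
    memLp_comp_continuous continuous_rot hχ.1.memLp_deriv
  set σ := Real.sqrt (B / (12 * C)) with hσ
  have hσ0 : 0 < σ := Real.sqrt_pos.2 (by positivity)
  have hσ2 : σ ^ 2 = B / (12 * C) := Real.sq_sqrt (by positivity)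
  obtain ⟨φ, hφm, hN, hφ0, hout, hL1⟩ := exists_concentrated_amplitude hSm hS0 hnm hσ0
  set N := normTwo φ with hNdef
  set η : ℝ → Plane := fun τ => φ τ • rot (deriv χ.2.1 τ) with hη
  have hηm : MemLp η ⊤ unitMeasure := MemLp.smul hnm hφm
  have hηn : ∀ᵐ τ ∂unitMeasure, ‖η τ‖ = |χ.1| * ‖φ τ‖ := by
    filter_upwards [hyL] with τ h
    rw [hη, norm_smul, norm_rot, h, mul_comm]
  have hpath := isPath_primitive hηm hφ0
  have hder := ae_deriv_primitive hηm
  have hker : ∀ᵐ τ ∂unitMeasure,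
      inner ℝ (deriv (primitive η) τ) (deriv χ.2.1 τ) = 0 * χ.1 := by
    filter_upwards [hder] with τ h
    rw [h, hη, inner_smul_left, inner_rot_self]
    simp
  have hlow := hcoer 0 (primitive η) hpath hker
  set A := |χ.1| * (σ * N) with hA
  have hA0 : 0 < A := by have := abs_pos.2 hL; positivity
  have hη1 : ∫ τ, ‖η τ‖ ∂unitMeasure ≤ A := by
    rw [integral_congr_ae hηn, integral_const_mul]
    exact mul_le_mul_of_nonneg_left hL1 (abs_nonneg _)
  have hz : |χ.1| * N ≤ zTwo 0 (primitive η) := by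
    have h1 : |χ.1| * N = normTwo (deriv (primitive η)) := by
      rw [normTwo_congr hder]
      have h2 : normTwo η = normTwo (|χ.1| • φ) := by
        have e : eLpNorm η 2 unitMeasure = eLpNorm (|χ.1| • φ) 2 unitMeasure := by
          refine eLpNorm_congr_norm_ae ?_
          filter_upwards [hηn] with τ h
          rw [h, Pi.smul_apply, norm_smul, Real.norm_eq_abs |χ.1|, abs_abs]
        rw [normTwo, normTwo, e]
      rw [h2, normTwo_smul, abs_abs]
    rw [h1, zTwo]
    have := normTwo_nonneg (primitive η)
    simp only [abs_zero, zero_add]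
    linarith
  have hup : hess Φ χ (0, primitive η, 0) (0, primitive η, 0) ≤
      ∫ τ, (B / 2 * χ.1 ^ 2 * ‖φ τ‖ ^ 2 + (2 * C * A * ‖η τ‖ + C * A ^ 2)) ∂unitMeasure := by
    have i1 : Integrable (fun τ => B / 2 * χ.1 ^ 2 * ‖φ τ‖ ^ 2) unitMeasure :=
      (integrable_norm_sq hφm).const_mul _
    have i2 : Integrable (fun τ => 2 * C * A * ‖η τ‖ + C * A ^ 2) unitMeasure :=
      ((integrable_of_memLp_top hηm).norm.const_mul _).add (integrable_const _)
    have hY : MemDeltaY (0, primitive η, 0) := memDeltaY_mk_zero hpath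
    refine integral_mono_ae (integrable_of_memLp_top
      (memLp_fderiv_fderiv hΦ hχ.memLp_jet hY.memLp_jet hY.memLp_jet)) (i1.add i2) ?_
    filter_upwards [hder, hq, ae_unitMeasure_mem] with τ h1 h2 h3
    have hj : jet (0, primitive η, 0) τ = dirX (primitive η τ) + dirY (η τ) := by
      simp [jet, dirX_apply, dirY_apply, h1]
    have hx : ‖primitive η τ‖ ≤ A := (norm_primitive_le hηm (Ioo_subset_Icc_self h3)).trans hη1
    have hquad : fderiv ℝ (fderiv ℝ Φ) (jet χ τ) (dirY (η τ)) (dirY (η τ)) =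
        φ τ ^ 2 * transversal Φ (jet χ τ) := by
      simp only [hη, map_smul, smul_apply, transversal, jet, smul_eq_mul]
      ring
    have hquad' : φ τ ^ 2 * transversal Φ (jet χ τ) ≤ B / 2 * χ.1 ^ 2 * ‖φ τ‖ ^ 2 := by
      rw [Real.norm_eq_abs, sq_abs]
      by_cases hτ : τ ∈ S
      · rw [h2, mul_comm]
        exact mul_le_mul_of_nonneg_right (le_of_lt hτ) (sq_nonneg _)
      · simp [hout τ hτ]
    have hb : ∀ x y : Plane, ∀ s t : Plane →L[ℝ] Jet, (∀ z, ‖s z‖ = ‖z‖) → (∀ z, ‖t z‖ = ‖z‖) →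
        fderiv ℝ (fderiv ℝ Φ) (jet χ τ) (s x) (t y) ≤ C * (‖x‖ * ‖y‖) := by
      intro x y s t hs ht
      refine (le_abs_self _).trans (((fderiv ℝ (fderiv ℝ Φ) (jet χ τ)).le_opNorm₂ _ _).trans ?_)
      rw [hs, ht, mul_assoc]
      exact mul_le_mul_of_nonneg_right (hC _) (by positivity)
    have b1 := hb (primitive η τ) (primitive η τ) dirX dirX norm_dirX norm_dirX
    have b2 := hb (primitive η τ) (η τ) dirX dirY norm_dirX norm_dirY
    have b3 := hb (η τ) (primitive η τ) dirY dirX norm_dirY norm_dirX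
    have b4 : C * (‖primitive η τ‖ * ‖primitive η τ‖) ≤ C * (A * A) := by gcongr
    have b5 : C * (‖primitive η τ‖ * ‖η τ‖) ≤ C * (A * ‖η τ‖) := by gcongr
    rw [hj]
    simp only [map_add, add_apply]
    rw [hquad]
    nlinarith
  have hval : ∫ τ, (B / 2 * χ.1 ^ 2 * ‖φ τ‖ ^ 2 + (2 * C * A * ‖η τ‖ + C * A ^ 2)) ∂unitMeasure ≤
      B / 2 * χ.1 ^ 2 * N ^ 2 + 3 * C * A ^ 2 := by
    have i1 : Integrable (fun τ => B / 2 * χ.1 ^ 2 * ‖φ τ‖ ^ 2) unitMeasure :=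
      (integrable_norm_sq hφm).const_mul _
    have i3 : Integrable (fun τ => 2 * C * A * ‖η τ‖) unitMeasure :=
      (integrable_of_memLp_top hηm).norm.const_mul _
    have i2 : Integrable (fun τ => 2 * C * A * ‖η τ‖ + C * A ^ 2) unitMeasure :=
      i3.add (integrable_const _)
    rw [integral_add i1 i2, integral_add i3 (integrable_const _),
      integral_const_mul, integral_const_mul, ← normTwo_sq hφm]
    have : 2 * C * A * ∫ τ, ‖η τ‖ ∂unitMeasure ≤ 2 * C * A * A := by gcongr
    simp only [integral_const, probReal_univ, one_smul]
    nlinarith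
  have hzz : B * (|χ.1| * N) ^ 2 ≤ B * zTwo 0 (primitive η) ^ 2 := by gcongr
  have hfin := hzz.trans (hlow.trans (hup.trans hval))
  have hA2 : 3 * C * A ^ 2 = B / 4 * (χ.1 ^ 2 * N ^ 2) := by
    rw [hA, mul_pow, mul_pow, hσ2, sq_abs]
    field_simp
    norm_num
  have hpos : 0 < B * (χ.1 ^ 2 * N ^ 2) := by positivity
  rw [hA2, mul_pow, sq_abs] at hfin
  nlinarith

/-! ### Linear differential equations with bounded measurable coefficients -/

section LinearODE

variable {V : Type*} [NormedAddCommGroup V] [NormedSpace ℝ V] [FiniteDimensional ℝ V]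

theorem memLp_clm_apply {M : ℝ → V →L[ℝ] V} (hM : MemLp M ⊤ unitMeasure) {y : ℝ → V}
    (hy : MemLp y ⊤ unitMeasure) : MemLp (fun τ => M τ (y τ)) ⊤ unitMeasure := by
  have hc : Continuous fun q : (V →L[ℝ] V) × V => q.1 q.2 := by fun_prop
  have hp : ProperSpace ((V →L[ℝ] V) × V) := FiniteDimensional.proper ℝ _
  exact memLp_comp_continuous (p := fun τ => (M τ, y τ)) hc (memLp_prod_iff.2 ⟨hM, hy⟩)

omit [FiniteDimensional ℝ V] in
theorem memLp_exp_smul (α : ℝ) {y : ℝ → V} (hy : MemLp y ⊤ unitMeasure) :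
    MemLp (fun τ => Real.exp (α * τ) • y τ) ⊤ unitMeasure :=
  MemLp.smul hy (memLp_of_continuousOn (by fun_prop))

omit [FiniteDimensional ℝ V] in
theorem primitive_add {η ζ : ℝ → V} (hη : MemLp η ⊤ unitMeasure) (hζ : MemLp ζ ⊤ unitMeasure)
    {t : ℝ} (ht : t ∈ Icc (0 : ℝ) 1) :
    primitive (fun τ => η τ + ζ τ) t = primitive η t + primitive ζ t :=
  intervalIntegral.integral_add (intervalIntegrable_of_memLp hη (by simp) ht)
    (intervalIntegrable_of_memLp hζ (by simp) ht)

omit [FiniteDimensional ℝ V] in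
theorem primitive_smul (c : ℝ) (η : ℝ → V) (t : ℝ) :
    primitive (fun τ => c • η τ) t = c • primitive η t :=
  intervalIntegral.integral_smul c η

/-- The initial value problem `s' = M s`, `s(0) = s₀`, in integrated form, has a solution on `[0,1]`
that depends linearly on `s₀`.  In the norm weighted by `exp (-α t)`, with `α` large, the integral
operator is a contraction, so that the solution is given by a Neumann series. -/
theorem exists_linear_ode_solution {M : ℝ → V →L[ℝ] V} (hM : MemLp M ⊤ unitMeasure) :
    ∃ Sol : V →ₗ[ℝ] (ℝ → V), ∀ s₀, Continuous (Sol s₀) ∧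
      ∀ t ∈ Icc (0 : ℝ) 1, Sol s₀ t = s₀ + primitive (fun τ => M τ (Sol s₀ τ)) t := by
  have hcV : CompleteSpace V := FiniteDimensional.complete ℝ V
  obtain ⟨C, hC0, hC⟩ := exists_ae_norm_le hM
  have hC' : ∀ᵐ τ, τ ∈ Ioo (0 : ℝ) 1 → ‖M τ‖ ≤ C := (ae_restrict_iff' measurableSet_Ioo).1 hC
  set α : ℝ := 2 * C + 1 with hα
  have hα0 : 0 < α := by positivity
  let I : Set ℝ := Icc 0 1
  let ext : C(I, V) → ℝ → V := fun y => IccExtend zero_le_one y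
  have hext : ∀ y : C(I, V), Continuous (ext y) := fun y => y.continuous.Icc_extend'
  have hextn : ∀ (y : C(I, V)) τ, ‖ext y τ‖ ≤ ‖y‖ := fun y τ => y.norm_coe_le_norm _
  let η : C(I, V) → ℝ → V := fun y τ => Real.exp (α * τ) • M τ (ext y τ)
  have hη : ∀ y, MemLp (η y) ⊤ unitMeasure := fun y =>
    memLp_exp_smul α (memLp_clm_apply hM (memLp_of_continuousOn (hext y).continuousOn))
  have hcont : ∀ y, Continuous fun t : I => Real.exp (-(α * t)) • primitive (η y) t := by
    intro y
    obtain ⟨K, hK⟩ := lipschitzOnWith_primitive (hη y)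
    exact (by fun_prop : Continuous fun t : I => Real.exp (-(α * t))).smul
      (continuousOn_iff_continuous_domRestrict.1 hK.continuousOn)
  let Klin : C(I, V) →ₗ[ℝ] C(I, V) :=
    { toFun := fun y => ⟨_, hcont y⟩
      map_add' := fun y z => by
        ext t
        have : η (y + z) = fun τ => η y τ + η z τ := by
          funext τ
          simp [η, ext, IccExtend]
        simp [this, primitive_add (hη y) (hη z) t.2]
      map_smul' := fun c y => by
        ext t
        have : η (c • y) = fun τ => c • η y τ := by
          funext τ
          simp [η, ext, IccExtend, smul_comm c]
        simp [this, primitive_smul, smul_comm c] }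
  have hbound : ∀ y, ‖Klin y‖ ≤ (1 / 2) * ‖y‖ := by
    intro y
    refine (ContinuousMap.norm_le _ (by positivity)).2 fun t => ?_
    have ht := t.2
    have h1 : ‖primitive (η y) t‖ ≤ ∫ τ in (0 : ℝ)..t, Real.exp (α * τ) * (C * ‖y‖) := by
      refine intervalIntegral.norm_integral_le_of_norm_le ht.1 ?_
        (by apply Continuous.intervalIntegrable; fun_prop)
      have hne : ∀ᵐ τ : ℝ, τ ≠ 1 := by simp [ae_iff, measure_singleton]
      filter_upwards [hC', hne] with τ h1 h2 h3
      rw [norm_smul, Real.norm_eq_abs, Real.abs_exp]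
      refine mul_le_mul_of_nonneg_left ?_ (Real.exp_pos _).le
      exact ((M τ).le_opNorm _).trans (mul_le_mul
        (h1 ⟨h3.1, lt_of_le_of_ne (h3.2.trans ht.2) h2⟩) (hextn y τ) (norm_nonneg _) hC0)
    have h2 : ∫ τ in (0 : ℝ)..t, Real.exp (α * τ) * (C * ‖y‖) =
        (Real.exp (α * t) - 1) / α * (C * ‖y‖) := by
      rw [intervalIntegral.integral_mul_const, intervalIntegral.integral_comp_mul_left
        (fun x => Real.exp x) hα0.ne', integral_exp]
      simp [div_eq_inv_mul]
    have h3 : ‖Klin y t‖ = Real.exp (-(α * t)) * ‖primitive (η y) t‖ := by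
      change ‖Real.exp (-(α * t)) • primitive (η y) t‖ = _
      rw [norm_smul, Real.norm_eq_abs, Real.abs_exp]
    rw [h3]
    rw [h2] at h1
    have he : Real.exp (-(α * t)) * Real.exp (α * t) = 1 := by
      rw [← Real.exp_add]; simp
    have hp := Real.exp_pos (-(α * t))
    calc _ ≤ Real.exp (-(α * t)) * ((Real.exp (α * t) - 1) / α * (C * ‖y‖)) :=
          mul_le_mul_of_nonneg_left h1 hp.le
      _ = (1 - Real.exp (-(α * t))) * (C / α * ‖y‖) := by
          linear_combination (C / α * ‖y‖) * he
      _ ≤ 1 * (1 / 2 * ‖y‖) := by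
          have hCα : C / α ≤ 1 / 2 := by
            rw [div_le_div_iff₀ hα0 two_pos]; linarith
          gcongr
          linarith
      _ = _ := one_mul _
  let K : C(I, V) →L[ℝ] C(I, V) := Klin.mkContinuous (1 / 2) hbound
  have hK : ‖K‖ < 1 := lt_of_le_of_lt (Klin.mkContinuous_norm_le (by norm_num) hbound)
    (by norm_num)
  obtain ⟨U, hU⟩ := isUnit_one_sub_of_norm_lt_one (R := C(I, V) →L[ℝ] C(I, V)) (x := K) hK
  let init : V →ₗ[ℝ] C(I, V) :=
    { toFun := fun s => ⟨fun t => Real.exp (-(α * t)) • s, by fun_prop⟩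
      map_add' := fun s s' => by ext t; simp
      map_smul' := fun c s => by ext t; simp [smul_comm c] }
  let Y : V →ₗ[ℝ] C(I, V) := ((↑U⁻¹ : C(I, V) →L[ℝ] C(I, V)) : C(I, V) →ₗ[ℝ] C(I, V)) ∘ₗ init
  have hY : ∀ s, Y s = init s + K (Y s) := by
    intro s
    have h1 : (↑U : C(I, V) →L[ℝ] C(I, V)) (Y s) = init s := by
      change (↑U * ↑U⁻¹ : C(I, V) →L[ℝ] C(I, V)) (init s) = init s
      rw [U.mul_inv]
      rfl
    rw [hU] at h1
    rw [← h1]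
    simp
  refine ⟨{ toFun := fun s τ => Real.exp (α * τ) • ext (Y s) τ
            map_add' := fun s s' => by funext τ; simp [ext, IccExtend]
            map_smul' := fun c s => by funext τ; simp [ext, IccExtend, smul_comm c] },
    fun s => ⟨?_, fun t ht => ?_⟩⟩
  · exact (by fun_prop : Continuous fun τ : ℝ => Real.exp (α * τ)).smul (hext _)
  · simp only [LinearMap.coe_mk, AddHom.coe_mk, map_smul]
    have h1 : ext (Y s) t = Y s ⟨t, ht⟩ := IccExtend_of_mem _ _ ht
    have h2 : Y s ⟨t, ht⟩ = Real.exp (-(α * t)) • s +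
        Real.exp (-(α * t)) • primitive (η (Y s)) t := by
      conv_lhs => rw [hY s]
      rfl
    rw [h1, h2, smul_add, smul_smul, smul_smul, ← Real.exp_add]
    simp [η]

end LinearODE

/-! ### The Newton system as a linear boundary value problem -/

/-- The state of the Newton system: the variation `x` of the path, the adjoint variable `π`, the
variation `ℓ` of the length, a factor `ζ` of the inhomogeneity, and the accumulated residual of the
equation for the length.  The components `ℓ` and `ζ` are constant along solutions. -/
abbrev State : Type := Plane × Plane × ℝ × ℝ × ℝ

namespace State

/-- Variation of the path. -/
abbrev x (s : State) : Plane := s.1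

/-- Adjoint variable. -/
abbrev adj (s : State) : Plane := s.2.1

/-- Variation of the length. -/
abbrev len (s : State) : ℝ := s.2.2.1

/-- Factor of the inhomogeneity. -/
abbrev inhom (s : State) : ℝ := s.2.2.2.1

/-- Accumulated residual of the equation for the length. -/
abbrev res (s : State) : ℝ := s.2.2.2.2

end State

section Coefficients

/-- Component of the velocity variation along the velocity, determined by the linearized
constraint.  The denominator `‖y‖²` is cut off at `r₀` to keep the coefficient continuous. -/
def tangentialCoeff (r₀ : ℝ) (p : Jet) (s : State) : ℝ :=
  (max (‖p.2.2.1‖ ^ 2) r₀)⁻¹ * (p.1 * s.len - s.inhom * ((‖p.2.2.1‖ ^ 2 - p.1 ^ 2) / 2))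

/-- Component of the velocity variation across the velocity, determined by the transversal part of
the du Bois-Reymond equation; the denominator `transversal Φ p` is cut off at `q₀`. -/
def transversalCoeff (Φ : Jet → ℝ) (r₀ q₀ : ℝ) (p : Jet) (s : State) : ℝ :=
  (max (transversal Φ p) q₀)⁻¹ * (inner ℝ (rot p.2.2.1) s.adj -
    s.inhom * fderiv ℝ Φ p (dirY (rot p.2.2.1)) -
    fderiv ℝ (fderiv ℝ Φ) p (s.len, s.x, tangentialCoeff r₀ p s • p.2.2.1, 0)
      (dirY (rot p.2.2.1)))

/-- Variation of the velocity. -/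
def velocity (Φ : Jet → ℝ) (r₀ q₀ : ℝ) (p : Jet) (s : State) : Plane :=
  tangentialCoeff r₀ p s • p.2.2.1 + transversalCoeff Φ r₀ q₀ p s • rot p.2.2.1

/-- Variation of the multiplier, determined by the tangential part of the du Bois-Reymond
equation. -/
def multiplier (Φ : Jet → ℝ) (r₀ q₀ : ℝ) (p : Jet) (s : State) : ℝ :=
  (max (‖p.2.2.1‖ ^ 2) r₀)⁻¹ * ((inner ℝ p.2.2.1 s.adj -
    s.inhom * fderiv ℝ Φ p (dirY p.2.2.1) -
    fderiv ℝ (fderiv ℝ Φ) p (s.len, s.x, velocity Φ r₀ q₀ p s, 0) (dirY p.2.2.1)) / 2)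

/-- The jet of the Newton direction. -/
def direction (Φ : Jet → ℝ) (r₀ q₀ : ℝ) (p : Jet) (s : State) : Jet :=
  (s.len, s.x, velocity Φ r₀ q₀ p s, multiplier Φ r₀ q₀ p s)

/-- The linearized first variation, a functional on jets. -/
def variation (Φ : Jet → ℝ) (r₀ q₀ : ℝ) (p : Jet) (s : State) : Jet →L[ℝ] ℝ :=
  fderiv ℝ (fderiv ℝ Φ) p (direction Φ r₀ q₀ p s) + s.inhom • fderiv ℝ Φ p

/-- The right-hand side of the differential equation for the state. -/
def stateField (Φ : Jet → ℝ) (r₀ q₀ : ℝ) (p : Jet) (s : State) : State :=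
  (velocity Φ r₀ q₀ p s,
    (InnerProductSpace.toDual ℝ Plane).symm ((variation Φ r₀ q₀ p s).comp dirX), 0, 0,
    variation Φ r₀ q₀ p s dirL)

variable {Φ : Jet → ℝ} {r₀ q₀ : ℝ}

theorem isLinearMap_tangentialCoeff (p : Jet) : IsLinearMap ℝ (tangentialCoeff r₀ p) where
  map_add s t := by
    simp only [tangentialCoeff, State.len, State.inhom, Prod.snd_add, Prod.fst_add]
    ring
  map_smul c s := by
    simp only [tangentialCoeff, State.len, State.inhom, Prod.smul_snd, Prod.smul_fst, smul_eq_mul]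
    ring

theorem isLinearMap_transversalCoeff (p : Jet) : IsLinearMap ℝ (transversalCoeff Φ r₀ q₀ p) where
  map_add s t := by
    have h : ((s + t).len, (s + t).x, tangentialCoeff r₀ p (s + t) • p.2.2.1, (0 : ℝ)) =
        (s.len, s.x, tangentialCoeff r₀ p s • p.2.2.1, (0 : ℝ)) +
        (t.len, t.x, tangentialCoeff r₀ p t • p.2.2.1, (0 : ℝ)) := by
      simp [(isLinearMap_tangentialCoeff p).map_add, add_smul]
      rfl
    rw [transversalCoeff, h]
    simp only [transversalCoeff, State.adj, State.inhom, Prod.snd_add, Prod.fst_add, map_add,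
      add_apply, inner_add_right]
    ring
  map_smul c s := by
    have h : ((c • s).len, (c • s).x, tangentialCoeff r₀ p (c • s) • p.2.2.1, (0 : ℝ)) =
        c • (s.len, s.x, tangentialCoeff r₀ p s • p.2.2.1, (0 : ℝ)) := by
      simp [(isLinearMap_tangentialCoeff p).map_smul, mul_smul]
      rfl
    rw [transversalCoeff, h]
    simp only [transversalCoeff, State.adj, State.inhom, Prod.smul_snd, Prod.smul_fst, map_smul,
      smul_apply, inner_smul_right, smul_eq_mul]
    ring

theorem isLinearMap_velocity (p : Jet) : IsLinearMap ℝ (velocity Φ r₀ q₀ p) where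
  map_add s t := by
    simp only [velocity, (isLinearMap_tangentialCoeff p).map_add,
      (isLinearMap_transversalCoeff p).map_add, add_smul]
    abel
  map_smul c s := by
    simp only [velocity, (isLinearMap_tangentialCoeff p).map_smul,
      (isLinearMap_transversalCoeff p).map_smul, smul_add, smul_assoc]

theorem isLinearMap_multiplier (p : Jet) : IsLinearMap ℝ (multiplier Φ r₀ q₀ p) where
  map_add s t := by
    have h : ((s + t).len, (s + t).x, velocity Φ r₀ q₀ p (s + t), (0 : ℝ)) =
        (s.len, s.x, velocity Φ r₀ q₀ p s, (0 : ℝ)) +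
        (t.len, t.x, velocity Φ r₀ q₀ p t, (0 : ℝ)) := by
      simp [(isLinearMap_velocity p).map_add]
      rfl
    rw [multiplier, h]
    simp only [multiplier, State.adj, State.inhom, Prod.snd_add, Prod.fst_add, map_add,
      add_apply, inner_add_right]
    ring
  map_smul c s := by
    have h : ((c • s).len, (c • s).x, velocity Φ r₀ q₀ p (c • s), (0 : ℝ)) =
        c • (s.len, s.x, velocity Φ r₀ q₀ p s, (0 : ℝ)) := by
      simp [(isLinearMap_velocity p).map_smul]
      rfl
    rw [multiplier, h]
    simp only [multiplier, State.adj, State.inhom, Prod.smul_snd, Prod.smul_fst, map_smul,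
      smul_apply, inner_smul_right, smul_eq_mul]
    ring

theorem isLinearMap_direction (p : Jet) : IsLinearMap ℝ (direction Φ r₀ q₀ p) where
  map_add s t := by
    simp [direction, (isLinearMap_velocity p).map_add, (isLinearMap_multiplier p).map_add]
    rfl
  map_smul c s := by
    simp [direction, (isLinearMap_velocity p).map_smul, (isLinearMap_multiplier p).map_smul]
    rfl

theorem isLinearMap_variation (p : Jet) : IsLinearMap ℝ (variation Φ r₀ q₀ p) where
  map_add s t := by
    simp only [variation, (isLinearMap_direction p).map_add, map_add, State.inhom, Prod.snd_add,
      Prod.fst_add, add_smul]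
    abel
  map_smul c s := by
    simp only [variation, (isLinearMap_direction p).map_smul, map_smul, State.inhom,
      Prod.smul_snd, Prod.smul_fst, smul_add, smul_assoc]

theorem isLinearMap_stateField (p : Jet) : IsLinearMap ℝ (stateField Φ r₀ q₀ p) where
  map_add s t := by
    simp [stateField, (isLinearMap_velocity p).map_add, (isLinearMap_variation p).map_add,
      ContinuousLinearMap.add_comp]
  map_smul c s := by
    simp [stateField, (isLinearMap_velocity p).map_smul, (isLinearMap_variation p).map_smul,
      ContinuousLinearMap.smul_comp]

/-- The coefficient operator of the differential equation for the state. -/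
def stateMap (Φ : Jet → ℝ) (r₀ q₀ : ℝ) (p : Jet) : State →L[ℝ] State :=
  LinearMap.toContinuousLinearMap
    (IsLinearMap.mk' _ (isLinearMap_stateField (Φ := Φ) (r₀ := r₀) (q₀ := q₀) p))

section Continuity

variable (hΦ : ContDiff ℝ 3 Φ) (hr : 0 < r₀) (hq : 0 < q₀)
include hr

theorem continuous_tangentialCoeff :
    Continuous fun z : Jet × State => tangentialCoeff r₀ z.1 z.2 := by
  unfold tangentialCoeff
  refine Continuous.mul (Continuous.inv₀ (by fun_prop) fun z => ?_) (by fun_prop)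
  exact (lt_max_of_lt_right hr).ne'

include hΦ hq

theorem continuous_transversalCoeff :
    Continuous fun z : Jet × State => transversalCoeff Φ r₀ q₀ z.1 z.2 := by
  have h1 := continuous_tangentialCoeff hr
  have h2 := continuous_transversal hΦ
  have h3 := continuous_fderiv_fderiv hΦ
  have h4 : Continuous (fderiv ℝ Φ) := hΦ.continuous_fderiv (by norm_num)
  have h5 := continuous_rot
  unfold transversalCoeff
  refine Continuous.mul (Continuous.inv₀ (by fun_prop) fun z => ?_) (by fun_prop)
  exact (lt_max_of_lt_right hq).ne'

theorem continuous_velocity :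
    Continuous fun z : Jet × State => velocity Φ r₀ q₀ z.1 z.2 := by
  have h1 := continuous_tangentialCoeff hr
  have h2 := continuous_transversalCoeff hΦ hr hq
  have h5 := continuous_rot
  unfold velocity
  fun_prop

theorem continuous_multiplier :
    Continuous fun z : Jet × State => multiplier Φ r₀ q₀ z.1 z.2 := by
  have h1 := continuous_velocity hΦ hr hq
  have h3 := continuous_fderiv_fderiv hΦ
  have h4 : Continuous (fderiv ℝ Φ) := hΦ.continuous_fderiv (by norm_num)
  unfold multiplier
  refine Continuous.mul (Continuous.inv₀ (by fun_prop) fun z => ?_) (by fun_prop)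
  exact (lt_max_of_lt_right hr).ne'

theorem continuous_variation :
    Continuous fun z : Jet × State => variation Φ r₀ q₀ z.1 z.2 := by
  have h1 := continuous_velocity hΦ hr hq
  have h2 := continuous_multiplier hΦ hr hq
  have h3 := continuous_fderiv_fderiv hΦ
  have h4 : Continuous (fderiv ℝ Φ) := hΦ.continuous_fderiv (by norm_num)
  unfold variation direction
  fun_prop

theorem continuous_stateField :
    Continuous fun z : Jet × State => stateField Φ r₀ q₀ z.1 z.2 := by
  have h1 := continuous_velocity hΦ hr hq
  have h2 := continuous_variation hΦ hr hq
  unfold stateField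
  refine h1.prodMk (Continuous.prodMk ?_ (by fun_prop))
  exact (InnerProductSpace.toDual ℝ Plane).symm.continuous.comp (h2.clm_comp continuous_const)

theorem continuous_stateMap : Continuous (stateMap Φ r₀ q₀) := by
  refine continuous_clm_apply.2 fun s => ?_
  exact (continuous_stateField hΦ hr hq).comp (f := fun p : Jet => (p, s)) (by fun_prop)

end Continuity

/-- Where the cutoffs are inactive, the linearized first variation vanishes on variations of the
multiplier. -/
theorem variation_dirM {p : Jet} (s : State) (hp : r₀ ≤ ‖p.2.2.1‖ ^ 2) (hr : 0 < r₀)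
    (hM : ∀ d, fderiv ℝ (fderiv ℝ Φ) p d dirM = 2 * (inner ℝ p.2.2.1 d.2.2.1 - p.1 * d.1))
    (hg : fderiv ℝ Φ p dirM = ‖p.2.2.1‖ ^ 2 - p.1 ^ 2) :
    variation Φ r₀ q₀ p s dirM = 0 := by
  have hp0 : ‖p.2.2.1‖ ^ 2 ≠ 0 := (hr.trans_le hp).ne'
  have hp1 : ‖p.2.2.1‖ ≠ 0 := fun h => hp0 (by simp [h])
  simp only [variation, add_apply, smul_apply, hM, hg, direction, velocity, inner_add_right,
    inner_smul_right, real_inner_self_eq_norm_sq, smul_eq_mul]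
  rw [real_inner_comm, inner_rot_self, tangentialCoeff, max_eq_left hp]
  field_simp
  ring

/-- Where the cutoffs are inactive, the linearized first variation agrees with the adjoint variable
on variations of the velocity: the du Bois-Reymond equation. -/
theorem variation_dirY {p : Jet} (s : State) (hp : r₀ ≤ ‖p.2.2.1‖ ^ 2) (hr : 0 < r₀)
    (hpq : q₀ ≤ transversal Φ p) (hq : 0 < q₀)
    (hM : ∀ d, fderiv ℝ (fderiv ℝ Φ) p dirM d = 2 * (inner ℝ p.2.2.1 d.2.2.1 - p.1 * d.1))
    (z : Plane) : variation Φ r₀ q₀ p s (dirY z) = inner ℝ s.adj z := by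
  have hp0 : ‖p.2.2.1‖ ^ 2 ≠ 0 := (hr.trans_le hp).ne'
  have hp1 : ‖p.2.2.1‖ ≠ 0 := fun h => hp0 (by simp [h])
  have hq0 : transversal Φ p ≠ 0 := (hq.trans_le hpq).ne'
  have hMY : ∀ y, fderiv ℝ (fderiv ℝ Φ) p dirM (dirY y) = 2 * inner ℝ p.2.2.1 y := fun y => by
    rw [hM, dirY_apply]
    simp
  have d1 : direction Φ r₀ q₀ p s = (s.len, s.x, velocity Φ r₀ q₀ p s, (0 : ℝ)) +
      multiplier Φ r₀ q₀ p s • dirM := by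
    simp [direction, dirM]
  have d2 : ((s.len, s.x, velocity Φ r₀ q₀ p s, (0 : ℝ)) : Jet) =
      (s.len, s.x, tangentialCoeff r₀ p s • p.2.2.1, (0 : ℝ)) +
      transversalCoeff Φ r₀ q₀ p s • dirY (rot p.2.2.1) := by
    simp [velocity, dirY_apply]
  have hn : variation Φ r₀ q₀ p s (dirY (rot p.2.2.1)) = inner ℝ s.adj (rot p.2.2.1) := by
    have e : fderiv ℝ (fderiv ℝ Φ) p (dirY (rot p.2.2.1)) (dirY (rot p.2.2.1)) =
      transversal Φ p := rfl
    have e2 : transversalCoeff Φ r₀ q₀ p s * transversal Φ p = inner ℝ (rot p.2.2.1) s.adj -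
        s.inhom * fderiv ℝ Φ p (dirY (rot p.2.2.1)) -
        fderiv ℝ (fderiv ℝ Φ) p (s.len, s.x, tangentialCoeff r₀ p s • p.2.2.1, 0)
          (dirY (rot p.2.2.1)) := by
      rw [transversalCoeff, max_eq_left hpq]
      field_simp
    rw [variation, d1, d2]
    simp only [add_apply, smul_apply, map_add, map_smul, smul_eq_mul, hMY, e, e2]
    rw [real_inner_comm (rot p.2.2.1) p.2.2.1, real_inner_comm, inner_rot_self]
    ring
  have hy : variation Φ r₀ q₀ p s (dirY p.2.2.1) = inner ℝ s.adj p.2.2.1 := by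
    have e2 : multiplier Φ r₀ q₀ p s * (2 * ‖p.2.2.1‖ ^ 2) = inner ℝ p.2.2.1 s.adj -
        s.inhom * fderiv ℝ Φ p (dirY p.2.2.1) -
        fderiv ℝ (fderiv ℝ Φ) p (s.len, s.x, velocity Φ r₀ q₀ p s, 0) (dirY p.2.2.1) := by
      rw [multiplier, max_eq_left hp]
      field_simp
    rw [variation, d1]
    simp only [add_apply, smul_apply, map_add, map_smul, smul_eq_mul, hMY,
      real_inner_self_eq_norm_sq, e2]
    rw [real_inner_comm]
    ring
  have hz := norm_sq_smul_eq p.2.2.1 z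
  have h1 : ‖p.2.2.1‖ ^ 2 * variation Φ r₀ q₀ p s (dirY z) = ‖p.2.2.1‖ ^ 2 * inner ℝ s.adj z := by
    rw [← smul_eq_mul, ← map_smul, ← map_smul, hz, ← inner_smul_right, hz]
    simp only [map_add, map_smul, inner_add_right, inner_smul_right, hn, hy, smul_eq_mul]
  exact mul_left_cancel₀ hp0 h1

end Coefficients

/-! ### Existence of Newton directions -/

theorem primitive_clm {V W : Type*} [NormedAddCommGroup V] [NormedSpace ℝ V]
    [FiniteDimensional ℝ V] [NormedAddCommGroup W] [NormedSpace ℝ W] [FiniteDimensional ℝ W]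
    (f : V →L[ℝ] W) {η : ℝ → V} (hη : MemLp η ⊤ unitMeasure) {t : ℝ} (ht : t ∈ Icc (0 : ℝ) 1) :
    primitive (fun τ => f (η τ)) t = f (primitive η t) := by
  have h1 : CompleteSpace V := FiniteDimensional.complete ℝ V
  have h2 : CompleteSpace W := FiniteDimensional.complete ℝ W
  exact f.intervalIntegral_comp_comm (intervalIntegrable_of_memLp hη (by simp) ht)

section Newton

variable {Φ : Jet → ℝ} {a b : Plane} {χ : Triple} {r₀ q₀ : ℝ}

/-- The pointwise properties of the linearization that make the Newton system a boundary value
problem for a linear differential equation with bounded coefficients. -/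
structure IsRegular (Φ : Jet → ℝ) (χ : Triple) (r₀ q₀ : ℝ) : Prop where
  speed_pos : 0 < r₀
  le_speed : ∀ᵐ τ ∂unitMeasure, r₀ ≤ ‖deriv χ.2.1 τ‖ ^ 2
  transversal_pos : 0 < q₀
  le_transversal : ∀ᵐ τ ∂unitMeasure, q₀ ≤ transversal Φ (jet χ τ)
  constraint : ConstraintStructure Φ χ
  fderiv_dirM : ∀ᵐ τ ∂unitMeasure, fderiv ℝ Φ (jet χ τ) dirM =
    ‖deriv χ.2.1 τ‖ ^ 2 - χ.1 ^ 2

theorem IsRegular.ae_variation (h : IsRegular Φ χ r₀ q₀) :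
    ∀ᵐ τ ∂unitMeasure, ∀ s : State, variation Φ r₀ q₀ (jet χ τ) s dirM = 0 ∧
      ∀ z, variation Φ r₀ q₀ (jet χ τ) s (dirY z) = inner ℝ s.adj z := by
  filter_upwards [h.le_speed, h.le_transversal, h.constraint, h.fderiv_dirM] with τ h1 h2 h3 h4 s
  have e1 : ∀ d, fderiv ℝ (fderiv ℝ Φ) (jet χ τ) d dirM =
      2 * (inner ℝ (jet χ τ).2.2.1 d.2.2.1 - (jet χ τ).1 * d.1) := fun d => (h3 d).1
  have e2 : ∀ d, fderiv ℝ (fderiv ℝ Φ) (jet χ τ) dirM d =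
      2 * (inner ℝ (jet χ τ).2.2.1 d.2.2.1 - (jet χ τ).1 * d.1) := fun d => (h3 d).2
  have e3 : variation Φ r₀ q₀ (jet χ τ) s dirM = 0 :=
    variation_dirM (p := jet χ τ) s h1 h.speed_pos e1 h4
  have e4 : ∀ z, variation Φ r₀ q₀ (jet χ τ) s (dirY z) = inner ℝ s.adj z :=
    variation_dirY (p := jet χ τ) s h1 h.speed_pos h2 h.transversal_pos e2
  exact ⟨e3, e4⟩

/-- Components of an integrated equation for the state. -/
theorem state_components {f s : ℝ → State} {s₀ : State} (hf : MemLp f ⊤ unitMeasure) {t : ℝ}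
    (ht : t ∈ Icc (0 : ℝ) 1) (h : s t = s₀ + primitive f t) :
    (s t).x = s₀.x + primitive (fun τ => (f τ).x) t ∧
    (s t).adj = s₀.adj + primitive (fun τ => (f τ).adj) t ∧
    (s t).len = s₀.len + primitive (fun τ => (f τ).len) t ∧
    (s t).inhom = s₀.inhom + primitive (fun τ => (f τ).inhom) t ∧
    (s t).res = s₀.res + primitive (fun τ => (f τ).res) t := by
  let p1 := ContinuousLinearMap.snd ℝ Plane (Plane × ℝ × ℝ × ℝ)
  let p2 := (ContinuousLinearMap.snd ℝ Plane (ℝ × ℝ × ℝ)).comp p1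
  let p3 := (ContinuousLinearMap.snd ℝ ℝ (ℝ × ℝ)).comp p2
  have e1 := primitive_clm (ContinuousLinearMap.fst ℝ Plane (Plane × ℝ × ℝ × ℝ)) hf ht
  have e2 := primitive_clm ((ContinuousLinearMap.fst ℝ Plane (ℝ × ℝ × ℝ)).comp p1) hf ht
  have e3 := primitive_clm ((ContinuousLinearMap.fst ℝ ℝ (ℝ × ℝ)).comp p2) hf ht
  have e4 := primitive_clm ((ContinuousLinearMap.fst ℝ ℝ ℝ).comp p3) hf ht
  have e5 := primitive_clm ((ContinuousLinearMap.snd ℝ ℝ ℝ).comp p3) hf ht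
  refine ⟨?_, ?_, ?_, ?_, ?_⟩
  · rw [h]; exact congrArg (s₀.x + ·) e1.symm
  · rw [h]; exact congrArg (s₀.adj + ·) e2.symm
  · rw [h]; exact congrArg (s₀.len + ·) e3.symm
  · rw [h]; exact congrArg (s₀.inhom + ·) e4.symm
  · rw [h]; exact congrArg (s₀.res + ·) e5.symm

/-- Along solutions of the state equation, the length variation and the factor of the
inhomogeneity are constant. -/
theorem state_constants {s : ℝ → State} {s₀ : State} {p : ℝ → Jet}
    (hf : MemLp (fun τ => stateField Φ r₀ q₀ (p τ) (s τ)) ⊤ unitMeasure) {t : ℝ}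
    (ht : t ∈ Icc (0 : ℝ) 1)
    (h : s t = s₀ + primitive (fun τ => stateField Φ r₀ q₀ (p τ) (s τ)) t) :
    (s t).len = s₀.len ∧ (s t).inhom = s₀.inhom := by
  obtain ⟨-, -, h3, h4, -⟩ := state_components hf ht h
  have e : primitive (fun _ : ℝ => (0 : ℝ)) t = 0 := by simp [primitive]
  refine ⟨h3.trans ?_, h4.trans ?_⟩
  · exact (congrArg (s₀.len + ·) e).trans (add_zero _)
  · exact (congrArg (s₀.inhom + ·) e).trans (add_zero _)

/-- The weak form of the Newton system for a direction that comes from a solution of the state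
equation: integration by parts turns the du Bois-Reymond equation into the weak equation. -/
theorem weak_form_of_solution (hΦ : ContDiff ℝ 3 Φ) (hχ : MemY a b χ)
    (h : IsRegular Φ χ r₀ q₀) {s : ℝ → State} {s₀ : State}
    (hf : MemLp (fun τ => stateField Φ r₀ q₀ (jet χ τ) (s τ)) ⊤ unitMeasure)
    (heq : ∀ t ∈ Icc (0 : ℝ) 1,
      s t = s₀ + primitive (fun τ => stateField Φ r₀ q₀ (jet χ τ) (s τ)) t)
    (hρ0 : s₀.res = 0) (hρ1 : (s 1).res = 0) {Δ : Triple} (hΔ : MemDeltaY Δ)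
    (hjet : ∀ᵐ τ ∂unitMeasure, jet Δ τ = direction Φ r₀ q₀ (jet χ τ) (s τ))
    {δ : Triple} (hδ : MemDeltaY δ) : hess Φ χ Δ δ + s₀.inhom * grad Φ χ δ = 0 := by
  obtain ⟨f, hfdef⟩ : ∃ f : ℝ → State, f = fun τ => stateField Φ r₀ q₀ (jet χ τ) (s τ) := ⟨_, rfl⟩
  have hconst : ∀ t ∈ Icc (0 : ℝ) 1, (s t).len = s₀.len ∧ (s t).inhom = s₀.inhom :=
    fun t ht => state_constants hf ht (heq t ht)
  rw [← hfdef] at hf heq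
  have hcomp : ∀ t ∈ Icc (0 : ℝ) 1, _ := fun t ht => state_components hf ht (heq t ht)
  have hadj : MemLp (fun τ => (f τ).adj) ⊤ unitMeasure := hf.snd.fst
  have hres : MemLp (fun τ => (f τ).res) ⊤ unitMeasure := hf.snd.snd.snd.snd
  have c5 : ∫ τ, (f τ).res ∂unitMeasure = 0 := by
    obtain ⟨-, -, -, -, h5⟩ := hcomp 1 (by simp)
    rw [hρ1, hρ0, zero_add, primitive_one] at h5
    exact h5.symm
  obtain ⟨K, hK⟩ := lipschitzOnWith_primitive hadj
  obtain ⟨⟨L, hL⟩, hδ0, hδ1⟩ := hδ.1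
  have hπ : LipschitzOnWith K (fun t => s₀.adj + primitive (fun τ => (f τ).adj) t) (Icc 0 1) :=
    LipschitzOnWith.of_dist_le_mul fun x hx y hy => by
      rw [dist_add_left]
      exact hK.dist_le_mul x hx y hy
  have hparts := integral_inner_deriv_add hπ hL hδ0 hδ1
  have i1 := integrable_of_memLp_top
    (memLp_fderiv_fderiv hΦ hχ.memLp_jet hΔ.memLp_jet hδ.memLp_jet)
  have i2 := (integrable_of_memLp_top
    (memLp_fderiv hΦ hχ.memLp_jet hδ.memLp_jet)).const_mul s₀.inhom
  have i3 : Integrable (fun τ => δ.1 * (f τ).res) unitMeasure :=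
    (integrable_of_memLp_top hres).const_mul _
  have hkey : ∀ᵐ τ ∂unitMeasure, fderiv ℝ (fderiv ℝ Φ) (jet χ τ) (jet Δ τ) (jet δ τ) +
      s₀.inhom * fderiv ℝ Φ (jet χ τ) (jet δ τ) - δ.1 * (f τ).res =
      inner ℝ (deriv (fun t => s₀.adj + primitive (fun τ => (f τ).adj) t) τ) (δ.2.1 τ) +
      inner ℝ (s₀.adj + primitive (fun τ => (f τ).adj) τ) (deriv δ.2.1 τ) := by
    filter_upwards [hjet, h.ae_variation, ae_hasDerivAt_primitive hadj, ae_unitMeasure_mem]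
      with τ h1 h2 h3 h4
    have ht := Ioo_subset_Icc_self h4
    have e1 : deriv (fun t => s₀.adj + primitive (fun τ => (f τ).adj) t) τ = (f τ).adj :=
      (h3.const_add s₀.adj).deriv
    have e2 : inner ℝ (f τ).adj (δ.2.1 τ) =
        variation Φ r₀ q₀ (jet χ τ) (s τ) (dirX (δ.2.1 τ)) := by
      rw [hfdef]
      exact InnerProductSpace.toDual_symm_apply
    have e3 : fderiv ℝ (fderiv ℝ Φ) (jet χ τ) (jet Δ τ) (jet δ τ) +
        s₀.inhom * fderiv ℝ Φ (jet χ τ) (jet δ τ) =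
        variation Φ r₀ q₀ (jet χ τ) (s τ) (jet δ τ) := by
      rw [variation, (hconst τ ht).2, h1]
      rfl
    have e4 : (f τ).res = variation Φ r₀ q₀ (jet χ τ) (s τ) dirL := by rw [hfdef]; rfl
    have e5 := (h2 (s τ)).2 (deriv δ.2.1 τ)
    have e6 : jet δ τ = δ.1 • dirL + dirX (δ.2.1 τ) + dirY (deriv δ.2.1 τ) + δ.2.2 τ • dirM :=
      jet_decomposition (jet δ τ)
    rw [e3, e1, e2, ← (hcomp τ ht).2.1, e4, ← e5, e6]
    simp only [map_add, map_smul, (h2 (s τ)).1, smul_eq_mul]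
    ring
  rw [← integral_congr_ae hkey, integral_sub (by exact i1.add i2) i3, integral_add i1 i2,
    integral_const_mul, integral_const_mul, c5, mul_zero, sub_zero] at hparts
  exact hparts

/-- A solution of the state equation with homogeneous boundary values yields a direction that
solves the Newton system, with the right-hand side scaled by the factor of the inhomogeneity. -/
theorem exists_direction_of_solution (hΦ : ContDiff ℝ 3 Φ) (hχ : MemY a b χ)
    (h : IsRegular Φ χ r₀ q₀) {s : ℝ → State} {s₀ : State} (hs : Continuous s)
    (heq : ∀ t ∈ Icc (0 : ℝ) 1,
      s t = s₀ + primitive (fun τ => stateField Φ r₀ q₀ (jet χ τ) (s τ)) t)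
    (hx0 : s₀.x = 0) (hρ0 : s₀.res = 0) (hx1 : (s 1).x = 0) (hρ1 : (s 1).res = 0) :
    ∃ Δ : Triple, MemDeltaY Δ ∧
      (∀ᵐ τ ∂unitMeasure, jet Δ τ = direction Φ r₀ q₀ (jet χ τ) (s τ)) ∧
      ∀ δ, MemDeltaY δ → hess Φ χ Δ δ + s₀.inhom * grad Φ χ δ = 0 := by
  have hr := h.speed_pos
  have hq := h.transversal_pos
  have hpair : MemLp (fun τ => (jet χ τ, s τ)) ⊤ unitMeasure :=
    memLp_prod_iff.2 ⟨hχ.memLp_jet, memLp_of_continuousOn hs.continuousOn⟩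
  have hf : MemLp (fun τ => stateField Φ r₀ q₀ (jet χ τ) (s τ)) ⊤ unitMeasure :=
    memLp_comp_continuous (p := fun τ => (jet χ τ, s τ))
      (Ψ := fun z => stateField Φ r₀ q₀ z.1 z.2) (continuous_stateField hΦ hr hq) hpair
  have hvel : MemLp (fun τ => velocity Φ r₀ q₀ (jet χ τ) (s τ)) ⊤ unitMeasure :=
    memLp_comp_continuous (p := fun τ => (jet χ τ, s τ))
      (Ψ := fun z => velocity Φ r₀ q₀ z.1 z.2) (continuous_velocity hΦ hr hq) hpair
  have hmul : MemLp (fun τ => multiplier Φ r₀ q₀ (jet χ τ) (s τ)) ⊤ unitMeasure :=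
    memLp_comp_continuous (p := fun τ => (jet χ τ, s τ))
      (Ψ := fun z => multiplier Φ r₀ q₀ z.1 z.2) (continuous_multiplier hΦ hr hq) hpair
  obtain ⟨x, hx⟩ : ∃ x, x = primitive fun τ => velocity Φ r₀ q₀ (jet χ τ) (s τ) := ⟨_, rfl⟩
  have c1 : ∀ t ∈ Icc (0 : ℝ) 1, (s t).x = x t := fun t ht => by
    have e := (state_components hf ht (heq t ht)).1
    rw [hx0, zero_add] at e
    rw [e, hx]
    rfl
  have hpath : IsPath 0 0 x :=
    ⟨hx ▸ lipschitzOnWith_primitive hvel, hx ▸ primitive_zero _,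
      by rw [← c1 1 (by simp)]; exact hx1⟩
  obtain ⟨m, hm⟩ : ∃ m : ℝ → ℝ, m = fun τ => multiplier Φ r₀ q₀ (jet χ τ) (s τ) := ⟨_, rfl⟩
  have hΔ : MemDeltaY (s₀.len, x, m) := ⟨hpath, hm ▸ hmul⟩
  have hjet : ∀ᵐ τ ∂unitMeasure,
      jet (s₀.len, x, m) τ = direction Φ r₀ q₀ (jet χ τ) (s τ) := by
    filter_upwards [ae_deriv_primitive hvel, ae_unitMeasure_mem] with τ h1 h2
    have ht := Ioo_subset_Icc_self h2
    rw [← hx] at h1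
    rw [direction, (state_constants hf ht (heq τ ht)).1, c1 τ ht, ← h1]
    simp only [jet, hm]
  exact ⟨_, hΔ, hjet, fun δ hδ => weak_form_of_solution hΦ hχ h hf heq hρ0 hρ1 hΔ hjet hδ⟩

/-- Existence of a Newton direction.  The shooting map that sends the initial values of the adjoint
variable and of the length to the boundary residuals is linear between spaces of the same finite
dimension, and it is injective since the linearized system is. -/
theorem exists_newton_direction (hΦ : ContDiff ℝ 3 Φ) (hχ : MemY a b χ)
    (h : IsRegular Φ χ r₀ q₀)
    (hinj : ∀ Δ, MemDeltaY Δ → (∀ δ, MemDeltaY δ → hess Φ χ Δ δ = 0) → yTwo Δ = 0) :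
    ∃ Δ, MemDeltaY Δ ∧ ∀ δ, MemDeltaY δ → hess Φ χ Δ δ = -grad Φ χ δ := by
  have hr := h.speed_pos
  have hq := h.transversal_pos
  obtain ⟨Sol, hSol⟩ := exists_linear_ode_solution
    (memLp_comp_continuous (continuous_stateMap hΦ hr hq) hχ.memLp_jet)
  let start : Plane × ℝ →ₗ[ℝ] State :=
    { toFun := fun q => (0, q.1, q.2, 0, 0)
      map_add' := fun q q' => by simp
      map_smul' := fun c q => by simp }
  let target : State →ₗ[ℝ] Plane × ℝ :=
    { toFun := fun s => (s.x, s.res)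
      map_add' := fun s s' => rfl
      map_smul' := fun c s => rfl }
  let shoot : Plane × ℝ →ₗ[ℝ] Plane × ℝ :=
    target ∘ₗ LinearMap.proj (1 : ℝ) ∘ₗ Sol ∘ₗ start
  have hshoot : ∀ q, shoot q = target (Sol (start q) 1) := fun q => rfl
  have hinj' : Function.Injective shoot := by
    refine (injective_iff_map_eq_zero shoot).2 fun q hq0 => ?_
    rw [hshoot] at hq0
    obtain ⟨Δ, hΔ, hj, hw⟩ := exists_direction_of_solution hΦ hχ h (hSol (start q)).1
      (hSol (start q)).2 rfl rfl (congrArg Prod.fst hq0) (congrArg Prod.snd hq0)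
    have h0 : yTwo Δ = 0 := hinj Δ hΔ fun δ hδ => by
      have h1 := hw δ hδ
      have h2 : (start q).inhom = 0 := rfl
      rwa [h2, zero_mul, add_zero] at h1
    have hn : normTwo (jet Δ) = 0 :=
      le_antisymm (h0 ▸ MemY.normTwo_jet_le hΔ) (normTwo_nonneg _)
    have hz := ae_eq_zero_of_normTwo_eq_zero hΔ.memLp_jet hn
    have hadj : (fun τ => ((Sol (start q) τ).adj, (Sol (start q) τ).len)) =ᵐ[unitMeasure] 0 := by
      have hc : ∀ t ∈ Icc (0 : ℝ) 1, (Sol (start q) t).inhom = 0 := fun t ht => by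
        have hf := memLp_clm_apply
          (memLp_comp_continuous (continuous_stateMap hΦ hr hq) hχ.memLp_jet)
          (memLp_of_continuousOn (hSol (start q)).1.continuousOn)
        exact (state_constants hf ht ((hSol (start q)).2 t ht)).2
      filter_upwards [hz, hj, h.ae_variation, ae_unitMeasure_mem] with τ h1 h2 h3 h4
      rw [h1] at h2
      have e1 : (Sol (start q) τ).len = 0 := (congrArg Prod.fst h2).symm
      have e2 : (Sol (start q) τ).adj = 0 := by
        have e3 := (h3 (Sol (start q) τ)).2 (Sol (start q) τ).adj
        rw [variation, ← h2, hc τ (Ioo_subset_Icc_self h4)] at e3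
        rw [← inner_self_eq_zero (𝕜 := ℝ), ← e3]
        simp
      rw [e1, e2]
      rfl
    have hcont : Continuous fun τ => ((Sol (start q) τ).adj, (Sol (start q) τ).len) := by
      have := (hSol (start q)).1
      fun_prop
    have h1 := eqOn_zero_of_ae_eq_zero hcont.continuousOn hadj
      (show (0 : ℝ) ∈ Icc (0 : ℝ) 1 by simp)
    have h2 := (hSol (start q)).2 0 (by simp)
    rw [primitive_zero, add_zero] at h2
    simp only [h2] at h1
    exact h1
  have hsurj : Function.Surjective shoot := LinearMap.injective_iff_surjective.1 hinj'
  obtain ⟨q, hq1⟩ := hsurj (-target (Sol (0, 0, 0, 1, 0) 1))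
  have hend : target (Sol (start q + (0, 0, 0, 1, 0)) 1) = 0 := by
    rw [map_add, Pi.add_apply, map_add, ← hshoot, hq1, neg_add_cancel]
  obtain ⟨Δ, hΔ, -, hw⟩ := exists_direction_of_solution hΦ hχ h
    (hSol (start q + (0, 0, 0, 1, 0))).1 (hSol (start q + (0, 0, 0, 1, 0))).2
    (by simp [start]) (by simp [start]) (congrArg Prod.fst hend) (congrArg Prod.snd hend)
  refine ⟨Δ, hΔ, fun δ hδ => ?_⟩
  have h1 := hw δ hδ
  have h2 : (start q + (0, 0, 0, 1, 0)).inhom = 1 := by simp [start]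
  rw [h2, one_mul] at h1
  linarith

end Newton

/-! ### The neighbourhood of the solution -/

theorem yInf_sub_self (χ : Triple) : yInf (χ - χ) = 0 := by
  have : deriv (0 : ℝ → Plane) = 0 := by
    funext t; exact deriv_const t (0 : Plane)
  simp [yInf, normInf, this]

theorem yTwo_sub_comm (χ χ' : Triple) : yTwo (χ - χ') = yTwo (χ' - χ) := by
  have e : χ - χ' = -(χ' - χ) := (neg_sub _ _).symm
  have h1 : ∀ {G : Type} [NormedAddCommGroup G] (φ : ℝ → G), normTwo (-φ) = normTwo φ :=
    fun φ => by rw [normTwo, normTwo, eLpNorm_neg]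
  have h2 : ∀ ξ : ℝ → Plane, deriv (-ξ) = -deriv ξ := fun ξ => by
    funext t; exact deriv.neg
  rw [e, yTwo, zTwo, Prod.fst_neg, Prod.snd_neg, Prod.fst_neg, Prod.snd_neg, h1, h1, h2, h1,
    abs_neg]
  rfl

/-- A path that advances in the direction `u` at rate at least `c` covers a distance of at least
`c`. -/
theorem le_norm_sub_of_advance {a b : Plane} {ξ : ℝ → Plane} (hξ : IsPath a b ξ) {u : Plane}
    (hu : ‖u‖ = 1) {c : ℝ} (hadv : ∀ᵐ τ ∂unitMeasure, c ≤ inner ℝ u (deriv ξ τ)) :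
    c ≤ ‖b - a‖ := by
  obtain ⟨⟨K, hK⟩, h0, h1⟩ := hξ
  have hL := (innerSL ℝ u).lipschitz.comp_lipschitzOnWith hK
  have hftc := integral_deriv_of_lipschitzOnWith hL
  have hle : ∫ _τ, c ∂unitMeasure ≤ ∫ τ, deriv (⇑(innerSL ℝ u) ∘ ξ) τ ∂unitMeasure := by
    refine integral_mono_ae (integrable_const c)
      (integrable_of_memLp_top (memLp_deriv_of_lipschitzOnWith hL)) ?_
    filter_upwards [hadv, ae_differentiableAt_of_lipschitzOnWith hK] with τ h2 h3
    rw [((innerSL ℝ u).hasFDerivAt.comp_hasDerivAt τ h3.hasDerivAt).deriv]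
    exact h2
  rw [hftc] at hle
  simp only [integral_const, probReal_univ, one_smul, Function.comp_apply, h0, h1,
    innerSL_apply_apply, ← inner_sub_right] at hle
  refine hle.trans ((real_inner_le_norm _ _).trans ?_)
  rw [hu, one_mul]

theorem inner_vel_ge_of_near {u : Plane} (hu : ‖u‖ = 1) {p q : Jet} {c R : ℝ}
    (hq : c ≤ inner ℝ u q.2.2.1) (h : ‖p - q‖ ≤ R) : c - R ≤ inner ℝ u p.2.2.1 := by
  have h1 : ‖p.2.2.1 - q.2.2.1‖ ≤ ‖p - q‖ :=
    (norm_fst_le (p.2.2 - q.2.2)).trans ((norm_snd_le (p.2 - q.2)).trans (norm_snd_le (p - q)))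
  have h2 := (abs_le.1 (abs_real_inner_le_norm u (p.2.2.1 - q.2.2.1))).1
  rw [hu, one_mul, inner_sub_right] at h2
  linarith

/-- Triples whose jets are close to those of an advancing path stay inside a set on which the
integrand is smooth. -/
theorem inside_of_near {χ χs : Triple} {u : Plane} (hu : ‖u‖ = 1) {c M R : ℝ} (hc : 0 < c)
    (hM : ∀ᵐ τ ∂unitMeasure, ‖jet χs τ‖ ≤ M)
    (hadv : ∀ᵐ τ ∂unitMeasure, c ≤ inner ℝ u (deriv χs.2.1 τ))
    (h : ∀ᵐ τ ∂unitMeasure, ‖jet χ τ - jet χs τ‖ ≤ R) (hR : R ≤ 1 / 2) (hRc : R ≤ c / 4) :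
    Inside u (c / 4) (M + 2) χ := by
  refine ⟨min (1 / 2) (c / 4), by positivity, ?_⟩
  filter_upwards [hM, hadv, h] with τ h1 h2 h3 p hp
  rw [Metric.mem_closedBall, dist_eq_norm] at hp
  have e1 := min_le_left (1 / 2) (c / 4)
  have e2 := min_le_right (1 / 2) (c / 4)
  have h4 : ‖p - jet χs τ‖ ≤ R + min (1 / 2) (c / 4) := by
    have := norm_sub_le_norm_sub_add_norm_sub p (jet χ τ) (jet χs τ)
    linarith
  constructor
  · have := norm_le_norm_add_norm_sub' p (jet χs τ)
    linarith
  · have := inner_vel_ge_of_near hu (q := jet χs τ) h2 h4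
    linarith

/-- Near a solution that satisfies the second order condition, the Lagrangian is given by a smooth
compactly supported integrand, its linearization is regular, and the linearization at the solution
is stable in `L²`. -/
theorem exists_local_model {v : ℝ} {w : Plane → Plane} (hw : ContDiff ℝ 3 w)
    (hwv : ∀ x, ‖w x‖ < v) {xO xD : Plane} {χs : Triple} (hχs : MemY xO xD χs)
    (hfeas : ∀ᵐ τ ∂unitMeasure, speedConstraint χs.1 χs.2.1 τ = 0)
    {B : ℝ} (hB : 0 < B) (hsecond : SecondOrderCondition v w χs B)
    {c : ℝ} (hc : 0 < c) {u : Plane} (hu : ‖u‖ = 1)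
    (hadv : ∀ᵐ τ ∂unitMeasure, c ≤ inner ℝ u (deriv χs.2.1 τ)) :
    ∃ (Φ : Jet → ℝ) (C γ R₁ : ℝ), ContDiff ℝ 3 Φ ∧ 0 < C ∧ 0 < γ ∧ 0 < R₁ ∧
      (∀ p q, ‖fderiv ℝ (fderiv ℝ Φ) p - fderiv ℝ (fderiv ℝ Φ) q‖ ≤ C * ‖p - q‖) ∧
      (∀ Δ, MemDeltaY Δ → ∀ ε : ℝ, 0 ≤ ε →
        (∀ δ, MemDeltaY δ → |hess Φ χs Δ δ| ≤ ε * yTwo δ) → yTwo Δ ≤ γ * ε) ∧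
      ∀ χ ∈ Nhood xO xD χs R₁,
        (∀ δ, MemDeltaY δ → kktMap v w χ δ = grad Φ χ δ) ∧
        (∀ Δ δ, MemDeltaY Δ → MemDeltaY δ → kktDeriv v w χ Δ δ = hess Φ χ Δ δ) ∧
        ∃ r₀ q₀, IsRegular Φ χ r₀ q₀ := by
  obtain ⟨M, hM0, hM⟩ := exists_ae_norm_le hχs.memLp_jet
  obtain ⟨Φ, hΦ, hcs, he⟩ := exists_smooth_extension hw hwv u
    (show 0 < c / 4 by positivity) (show 0 < M + 2 by positivity)
  obtain ⟨C, hC0, -, hC2, hC3⟩ := exists_bounds_fderiv hΦ hcs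
  -- the speed is constant and positive along the solution
  have hspeed : ∀ᵐ τ ∂unitMeasure, ‖deriv χs.2.1 τ‖ = |χs.1| := by
    filter_upwards [hfeas] with τ h
    rwa [speedConstraint, sub_eq_zero, sq_eq_sq_iff_abs_eq_abs, abs_norm] at h
  have hL : χs.1 ≠ 0 := by
    obtain ⟨τ, h1, h2⟩ := (hspeed.and hadv).exists
    intro h0
    have h3 := real_inner_le_norm u (deriv χs.2.1 τ)
    rw [h1, h0, abs_zero, mul_zero] at h3
    linarith
  have hs0 : ∀ᵐ τ ∂unitMeasure, ‖jet χs τ - jet χs τ‖ ≤ 0 := .of_forall fun τ => by simp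
  have hins : Inside u (c / 4) (M + 2) χs :=
    inside_of_near hu hc hM hadv hs0 (by norm_num) (by positivity)
  have hstruct : ∀ χ, Inside u (c / 4) (M + 2) χ → ConstraintStructure Φ χ := fun χ h => by
    filter_upwards [h.ae_mem] with τ hτ d
    exact ⟨fderiv_fderiv_dirM hΦ he hτ d, fderiv_fderiv_dirM_left hΦ he hτ d⟩
  have hcoer : ∀ (δL : ℝ) (δξ : ℝ → Plane), IsPath 0 0 δξ →
      (∀ᵐ τ ∂unitMeasure, inner ℝ (deriv δξ τ) (deriv χs.2.1 τ) = δL * χs.1) →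
        B * zTwo δL δξ ^ 2 ≤ hess Φ χs (δL, δξ, 0) (δL, δξ, 0) := by
    intro δL δξ h1 h2
    have hY : MemDeltaY (δL, δξ, 0) := memDeltaY_mk_zero h1
    have h3 := hsecond δL δξ h1 h2
    rwa [kktDeriv_eq_integral hw.continuous hwv hΦ hcs he hχs hY hY hins] at h3
  obtain ⟨S, hS0, hS⟩ := exists_constraint_rightInverse hχs.1.memLp_deriv hc hu hL hspeed hadv
  obtain ⟨γ, hγ0, hγ⟩ := stability_of_coercive hΦ hχs hC0 hC2 (hstruct χs hins) hS0 hS hB hcoer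
  have htrans := ae_le_transversal hΦ hχs hC0 hC2 hL hspeed hB hcoer
  -- the transversal coefficient is uniformly continuous on bounded sets of jets
  have hq0 : 0 < B / 4 * χs.1 ^ 2 := by positivity
  have huc := (isCompact_closedBall (0 : Jet) (M + 1)).uniformContinuousOn_of_continuous
    (continuous_transversal hΦ).continuousOn
  obtain ⟨d, hd0, hd⟩ := Metric.uniformContinuousOn_iff.1 huc _ hq0
  set R₁ := min (min (1 / 2) (c / 4)) (d / 2) with hR₁
  have hR₁0 : 0 < R₁ := by positivity
  have r1 : R₁ ≤ 1 / 2 := (min_le_left _ _).trans (min_le_left _ _)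
  have r2 : R₁ ≤ c / 4 := (min_le_left _ _).trans (min_le_right _ _)
  have r3 : R₁ ≤ d / 2 := min_le_right _ _
  refine ⟨Φ, C, γ, R₁, hΦ, hC0, hγ0, hR₁0, hC3, hγ, fun χ hχ => ?_⟩
  have hnear := Nhood.ae_norm_jet_sub_le hχs hχ
  have hin : Inside u (c / 4) (M + 2) χ := inside_of_near hu hc hM hadv hnear r1 r2
  refine ⟨fun δ hδ => kktMap_eq_integral hw.continuous hwv hΦ hcs he hχ.1 hδ hin,
    fun Δ δ hΔ hδ => kktDeriv_eq_integral hw.continuous hwv hΦ hcs he hχ.1 hΔ hδ hin,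
    (c / 2) ^ 2, B / 4 * χs.1 ^ 2, ?_⟩
  refine ⟨by positivity, ?_, hq0, ?_, hstruct χ hin, ?_⟩
  · filter_upwards [hadv, hnear] with τ h1 h2
    have h3 := inner_vel_ge_of_near hu (q := jet χs τ) h1 h2
    have h4 := real_inner_le_norm u (deriv χ.2.1 τ)
    rw [hu, one_mul] at h4
    have h5 : c - R₁ ≤ inner ℝ u (deriv χ.2.1 τ) := h3
    exact pow_le_pow_left₀ (by positivity) (by linarith) 2
  · filter_upwards [htrans, hnear, hM] with τ h1 h2 h3
    have h4 := norm_le_norm_add_norm_sub' (jet χ τ) (jet χs τ)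
    have h5 := hd (jet χ τ) (by rw [mem_closedBall_zero_iff]; linarith) (jet χs τ)
      (by rw [mem_closedBall_zero_iff]; linarith) (by rw [dist_eq_norm]; linarith)
    rw [Real.dist_eq] at h5
    have h6 := (abs_lt.1 h5).1
    linarith
  · filter_upwards [hin.ae_mem] with τ hτ
    exact fderiv_dirM hΦ he hτ

/-! ### The constants -/

theorem omegaOne_ge (v c₀ c₁ c₂ D c B R : ℝ) (hB : 0 < B) :
    4 / B ≤ omegaOne v c₀ c₁ c₂ D c B R := by
  have h1 : (1 : ℝ) ≤ Real.sqrt 2 := Real.one_le_sqrt.2 (by norm_num)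
  have h2 : 4 / B ≤ max (max (4 / B) (1 / kappa v c₀ D c R *
      (1 + 4 * (upperB v c₀ c₁ c₂ D R + R) / B)))
      ((upperB v c₀ c₁ c₂ D R + R) / kappa v c₀ D c R ^ 2) :=
    (le_max_left _ _).trans (le_max_left _ _)
  have h3 : 0 < 4 / B := by positivity
  unfold omegaOne
  refine h2.trans ?_
  exact le_mul_of_one_le_left (h3.le.trans h2) h1

theorem continuousAt_omegaOne (v c₀ c₁ c₂ : ℝ) {D c B : ℝ} (hD : 0 < D) (hc : 0 < c) :
    ContinuousAt (omegaOne v c₀ c₁ c₂ D c B) 0 := by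
  have hpos : ∀ R, 0 < Real.sqrt (3 / 8 + 2 * ((v + c₀) / (v - c₀) + R / D) ^ 2) := fun R =>
    Real.sqrt_pos.2 (by positivity)
  have hκ : ContinuousAt (kappa v c₀ D c) 0 := by
    unfold kappa
    exact ContinuousAt.div (by fun_prop) (by fun_prop) (hpos 0).ne'
  have hκ0 : kappa v c₀ D c 0 ≠ 0 := by
    unfold kappa
    exact (div_pos (by linarith) (hpos 0)).ne'
  have hβ : ContinuousAt (upperB v c₀ c₁ c₂ D) 0 := by
    unfold upperB
    refine continuousAt_const.add (Filter.Tendsto.max (ContinuousAt.tendsto (by fun_prop)) ?_)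
    exact continuousAt_const.div (by fun_prop) (by simpa using hD.ne')
  unfold omegaOne
  refine continuousAt_const.mul
    (Filter.Tendsto.max (Filter.Tendsto.max tendsto_const_nhds ?_) ?_)
  · exact (continuousAt_const.div hκ hκ0).mul (by fun_prop)
  · exact (hβ.add continuousAt_id).div (hκ.pow 2) (pow_ne_zero 2 hκ0)

theorem exists_omegaOne_le (v c₀ c₁ c₂ : ℝ) {D c B : ℝ} (hD : 0 < D) (hc : 0 < c) (hB : 0 < B) :
    ∃ W R₁ : ℝ, 0 < W ∧ 0 < R₁ ∧ ∀ R, 0 < R → R ≤ R₁ → omegaOne v c₀ c₁ c₂ D c B R ≤ W := by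
  have h := (continuousAt_omegaOne v c₀ c₁ c₂ (B := B) hD hc).eventually
    (gt_mem_nhds (lt_add_one (omegaOne v c₀ c₁ c₂ D c B 0)))
  obtain ⟨ε, hε, h⟩ := Metric.eventually_nhds_iff.1 h
  have hW := omegaOne_ge v c₀ c₁ c₂ D c B 0 hB
  have hpos : 0 < 4 / B := by positivity
  refine ⟨omegaOne v c₀ c₁ c₂ D c B 0 + 1, ε / 2, by linarith, half_pos hε, fun R h0 h1 => ?_⟩
  exact (h (by rw [Real.dist_eq, sub_zero, abs_of_pos h0]; linarith)).le

/-! ### Newton's method near the solution -/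

theorem Nhood_mono {xO xD : Plane} {χs : Triple} {R R' : ℝ} (h : R ≤ R') :
    Nhood xO xD χs R ⊆ Nhood xO xD χs R' := fun _ hχ => ⟨hχ.1, hχ.2.trans h⟩

theorem MemDeltaY.sub {Δ δ : Triple} (hΔ : MemDeltaY Δ) (hδ : MemDeltaY δ) :
    MemDeltaY (Δ - δ) :=
  MemY.sub hΔ hδ

/-- Stability of the linearization persists in a neighbourhood, with twice the constant. -/
theorem stability_of_near {Φ : Jet → ℝ} (hΦ : ContDiff ℝ 3 Φ) {C γ R : ℝ} (hC0 : 0 ≤ C)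
    (hR : 0 ≤ R)
    (hC : ∀ p q, ‖fderiv ℝ (fderiv ℝ Φ) p - fderiv ℝ (fderiv ℝ Φ) q‖ ≤ C * ‖p - q‖)
    {xO xD : Plane} {χs χ : Triple} (hs : MemY xO xD χs) (hχ : χ ∈ Nhood xO xD χs R)
    (hstab : ∀ Δ, MemDeltaY Δ → ∀ ε : ℝ, 0 ≤ ε →
      (∀ δ, MemDeltaY δ → |hess Φ χs Δ δ| ≤ ε * yTwo δ) → yTwo Δ ≤ γ * ε)
    (hsmall : γ * (C * R) ≤ 1 / 2) {Δ : Triple} (hΔ : MemDeltaY Δ) {ε : ℝ} (hε : 0 ≤ ε)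
    (hres : ∀ δ, MemDeltaY δ → |hess Φ χ Δ δ| ≤ ε * yTwo δ) : yTwo Δ ≤ 2 * γ * ε := by
  have h0 := yTwo_nonneg Δ
  have h1 := hstab Δ hΔ (ε + C * R * yTwo Δ) (by positivity) fun δ hδ => by
    have h2 := abs_hess_sub_hess_le hΦ hC0 hR hC hχ.1 hs (Nhood.ae_norm_jet_sub_le hs hχ) hΔ hδ
    have h3 := hres δ hδ
    rw [abs_sub_comm] at h2
    have h4 := abs_sub_abs_le_abs_sub (hess Φ χs Δ δ) (hess Φ χ Δ δ)
    linarith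
  have h5 : γ * (C * R) * yTwo Δ ≤ 1 / 2 * yTwo Δ := by gcongr
  linarith

/-- The error after a Newton step is bounded by the Taylor remainder of the gradient. -/
theorem yTwo_newton_error_le {Φ : Jet → ℝ} (hΦ : ContDiff ℝ 3 Φ) {C γ R : ℝ} (hC0 : 0 ≤ C)
    (hR : 0 ≤ R)
    (hC : ∀ p q, ‖fderiv ℝ (fderiv ℝ Φ) p - fderiv ℝ (fderiv ℝ Φ) q‖ ≤ C * ‖p - q‖)
    {xO xD : Plane} {χs χ : Triple} (hs : MemY xO xD χs) (hχ : χ ∈ Nhood xO xD χs R)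
    (hstab : ∀ Δ, MemDeltaY Δ → ∀ ε : ℝ, 0 ≤ ε →
      (∀ δ, MemDeltaY δ → |hess Φ χs Δ δ| ≤ ε * yTwo δ) → yTwo Δ ≤ γ * ε)
    (hsmall : γ * (C * R) ≤ 1 / 2) (hcrit : ∀ δ, MemDeltaY δ → grad Φ χs δ = 0)
    {Δ : Triple} (hΔ : MemDeltaY Δ) (hN : ∀ δ, MemDeltaY δ → hess Φ χ Δ δ = -grad Φ χ δ) :
    yTwo (χ + Δ - χs) ≤ 2 * γ * (C * R * yTwo (χ - χs)) := by
  have hd : MemDeltaY (χs - χ) := hs.sub hχ.1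
  have e : χ + Δ - χs = Δ - (χs - χ) := by abel
  have h0 := yTwo_nonneg (χ - χs)
  rw [e]
  refine stability_of_near hΦ hC0 hR hC hs hχ hstab hsmall (hΔ.sub hd) (by positivity)
    fun δ hδ => ?_
  have hnear := Nhood.ae_norm_jet_sub_le hs hχ
  have h1 := abs_grad_sub_grad_sub_hess_le hΦ hC0 hR hC hs hχ.1
    (hnear.mono fun τ h => by rwa [norm_sub_rev]) hδ
  rw [hcrit δ hδ, zero_sub] at h1
  rw [hess_sub_left hΦ hχ.1 hΔ hd hδ, hN δ hδ, yTwo_sub_comm χ χs, mul_assoc (C * R)]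
  exact h1

end FreeFlight
end

open FreeFlight
theorem mainTheorem1
    -- airspeed, wind field, origin and destination
    (v : ℝ) (w : Plane → Plane) (hw : ContDiff ℝ 3 w) (hwv : ∀ x, ‖w x‖ < v)
    (xO xD : Plane)
    -- a global solution with its multiplier, satisfying the optimality conditions
    (Ls : ℝ) (ξs : ℝ → Plane) (lams : ℝ → ℝ)
    (hglob : IsGlobalSolution v w xO xD Ls ξs)
    (hkkt : IsKKT v w xO xD (Ls, ξs, lams))
    (B : ℝ) (hB : 0 < B) (hsecond : SecondOrderCondition v w (Ls, ξs, lams) B)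
    -- the path advances in a fixed direction
    (c : ℝ) (hc : 0 < c) (u : Plane) (hu : ‖u‖ = 1)
    (hadv : ∀ᵐ τ ∂unitMeasure, c ≤ inner ℝ u (deriv ξs τ))
    -- bounds for the wind on an ellipse that contains the path
    (ℓ : ℝ) (hΩ : ∀ τ ∈ Set.Icc (0 : ℝ) 1, ξs τ ∈ ellipse xO xD ℓ)
    (c₀ c₁ c₂ : ℝ) (hc₀v : c₀ < v)
    (hc₀ : ∀ p ∈ ellipse xO xD ℓ, ‖w p‖ ≤ c₀)
    (hc₁ : ∀ p ∈ ellipse xO xD ℓ, ‖fderiv ℝ w p‖ ≤ c₁)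
    (hc₂ : ∀ p ∈ ellipse xO xD ℓ, ‖iteratedFDeriv ℝ 2 w p‖ ≤ c₂) :
    ∃ Bhat : ℝ, 0 ≤ Bhat ∧ ∃ R₀ : ℝ, 0 < R₀ ∧ ∀ R_C : ℝ, 0 < R_C → R_C ≤ R₀ →
      let χs : Triple := (Ls, ξs, lams)
      let N : Set Triple := Nhood xO xD χs R_C
      let ω₁ : ℝ := omegaOne v c₀ c₁ c₂ ‖xD - xO‖ c B R_C
      let ω₂ : ℝ := omegaTwo Bhat R_C
      let ω : ℝ := ω₁ * ω₂
      -- `ω₂` is a Lipschitz constant of `F'` on the ball in the sense of the `L²`-type norms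
      (∀ χ₁ ∈ N, ∀ χ₂ ∈ N, ∀ δ : Triple, MemDeltaY δ →
        |kktDeriv v w χ₂ (χ₂ - χ₁) δ - kktDeriv v w χ₁ (χ₂ - χ₁) δ|
          ≤ ω₂ * yTwo (χ₂ - χ₁) * yTwo δ) ∧
      ω < 2 ∧
      -- the Newton step is well defined at every point of the ball
      (∀ χ ∈ N, ∃ Δ, IsNewtonStep v w χ Δ ∧ ∀ Δ', IsNewtonStep v w χ Δ' → Same Δ' Δ) ∧
      -- Newton iterates that remain in the ball converge at the stated rate
      (∀ χ : ℕ → Triple, IsNewtonSequence v w χ → (∀ k, χ k ∈ N) →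
        (∀ k, yTwo (χ (k + 1) - χs) ≤ ω / 2 * yTwo (χ k - χs)) ∧
        Filter.Tendsto (fun k => yTwo (χ k - χs)) Filter.atTop (nhds 0)) ∧
      -- the solution is the only KKT point in the ball
      (∀ χ ∈ N, IsKKT v w xO xD χ → Same χ χs) := by
  have hs : MemY xO xD (Ls, ξs, lams) := hkkt.1
  obtain ⟨Φ, C, γ, R₁, hΦ, hC0, hγ0, hR₁, hC, hstab, hmodel⟩ :=
    exists_local_model hw hwv hs hglob.1.2 hB hsecond hc hu hadv
  have hD : 0 < ‖xD - xO‖ := hc.trans_le (le_norm_sub_of_advance hglob.1.1 hu hadv)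
  obtain ⟨W, R₂, hW, hR₂, hω₁⟩ := exists_omegaOne_le v c₀ c₁ c₂ hD hc hB
  -- the first summand serves the Lipschitz estimate, the second the contraction estimate, where
  -- the bound `4 / B ≤ ω₁` is used
  obtain ⟨H, hH⟩ : ∃ H : ℝ, H = 2 * C + γ * C * B := ⟨_, rfl⟩
  have hH0 : 0 ≤ H := by rw [hH]; positivity
  refine ⟨H, hH0, min (min R₁ R₂) (min (1 / (2 * (γ * C))) (1 / ((8 + H) * W))), by positivity,
    fun R hR hRle => ?_⟩
  have hRR₁ : R ≤ R₁ := hRle.trans ((min_le_left _ _).trans (min_le_left _ _))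
  have hRR₂ : R ≤ R₂ := hRle.trans ((min_le_left _ _).trans (min_le_right _ _))
  have hsmall : γ * (C * R) ≤ 1 / 2 := by
    have h := hRle.trans ((min_le_right _ _).trans (min_le_left _ _))
    rw [le_div_iff₀ (by positivity)] at h
    linarith
  have hRW : R * ((8 + H) * W) ≤ 1 := by
    have h := hRle.trans ((min_le_right _ _).trans (min_le_right _ _))
    rwa [le_div_iff₀ (by positivity)] at h
  intro χs N ω₁ ω₂ ω
  have hω₁W : ω₁ ≤ W := hω₁ R hR hRR₂
  have hω₁B : 4 / B ≤ ω₁ := omegaOne_ge _ _ _ _ _ _ _ _ hB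
  have hω₁0 : 0 < ω₁ := lt_of_lt_of_le (by positivity) hω₁B
  have hω₂ : ω₂ = (8 + H) * R := rfl
  have hω₂0 : 0 < ω₂ := by rw [hω₂]; positivity
  have hω0 : 0 < ω := mul_pos hω₁0 hω₂0
  have hω2 : ω < 2 := by
    have h : ω₁ * ω₂ ≤ W * ω₂ := mul_le_mul_of_nonneg_right hω₁W hω₂0.le
    rw [hω₂] at h
    have h' : ω = ω₁ * ((8 + H) * R) := rfl
    linarith
  have hrate : 2 * γ * (C * R) ≤ ω / 2 := by
    have h1 : 4 / B * ((γ * C * B) * R) ≤ ω₁ * ω₂ := by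
      refine mul_le_mul hω₁B ?_ (by positivity) hω₁0.le
      rw [hω₂, hH]
      refine mul_le_mul_of_nonneg_right ?_ hR.le
      linarith
    have h2 : 4 / B * ((γ * C * B) * R) = 4 * (γ * (C * R)) := by field_simp
    have h' : ω = ω₁ * ω₂ := rfl
    linarith
  have hN : ∀ χ ∈ N, χ ∈ Nhood xO xD χs R₁ := fun χ h => Nhood_mono hRR₁ h
  have hsN : χs ∈ N := ⟨hs, by rw [yInf_sub_self]; exact hR.le⟩
  have hcrit : ∀ δ, MemDeltaY δ → grad Φ χs δ = 0 := fun δ hδ => by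
    rw [← (hmodel χs (hN χs hsN)).1 δ hδ]
    exact hkkt.2 δ hδ
  have hstep : ∀ χ ∈ N, ∀ Δ, IsNewtonStep v w χ Δ ↔
      MemDeltaY Δ ∧ ∀ δ, MemDeltaY δ → hess Φ χ Δ δ = -grad Φ χ δ := by
    intro χ hχ Δ
    obtain ⟨h1, h2, -⟩ := hmodel χ (hN χ hχ)
    refine and_congr_right fun hΔ => forall₂_congr fun δ hδ => ?_
    rw [h1 δ hδ, h2 Δ δ hΔ hδ]
  refine ⟨?_, hω2, ?_, ?_, ?_⟩
  · intro χ₁ h₁ χ₂ h₂ δ hδ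
    have hd : MemDeltaY (χ₂ - χ₁) := h₂.1.sub h₁.1
    rw [(hmodel χ₂ (hN χ₂ h₂)).2.1 _ δ hd hδ, (hmodel χ₁ (hN χ₁ h₁)).2.1 _ δ hd hδ]
    have hnear : ∀ᵐ τ ∂unitMeasure, ‖jet χ₂ τ - jet χ₁ τ‖ ≤ 2 * R := by
      filter_upwards [Nhood.ae_norm_jet_sub_le hs h₁, Nhood.ae_norm_jet_sub_le hs h₂] with τ e1 e2
      have e3 := norm_sub_le_norm_sub_add_norm_sub (jet χ₂ τ) (jet χs τ) (jet χ₁ τ)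
      rw [norm_sub_rev (jet χs τ)] at e3
      linarith
    refine (abs_hess_sub_hess_le hΦ hC0.le (by positivity) hC h₂.1 h₁.1 hnear hd hδ).trans ?_
    rw [mul_assoc ω₂]
    have h0 := mul_nonneg (yTwo_nonneg (χ₂ - χ₁)) (yTwo_nonneg δ)
    refine mul_le_mul_of_nonneg_right ?_ h0
    rw [hω₂, hH]
    have : 0 ≤ (8 + γ * C * B) * R := by positivity
    linarith
  · intro χ hχ
    obtain ⟨-, -, r₀, q₀, hreg⟩ := hmodel χ (hN χ hχ)
    have hinj : ∀ Δ, MemDeltaY Δ → (∀ δ, MemDeltaY δ → hess Φ χ Δ δ = 0) → yTwo Δ = 0 := by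
      intro Δ hΔ h
      refine le_antisymm ?_ (yTwo_nonneg Δ)
      have := stability_of_near hΦ hC0.le hR.le hC hs hχ hstab hsmall hΔ le_rfl
        fun δ hδ => by rw [h δ hδ]; simp
      simpa using this
    obtain ⟨Δ, hΔ, hw⟩ := exists_newton_direction hΦ hχ.1 hreg hinj
    refine ⟨Δ, (hstep χ hχ Δ).2 ⟨hΔ, hw⟩, fun Δ' h' => ?_⟩
    obtain ⟨hΔ', hw'⟩ := (hstep χ hχ Δ').1 h'
    refine same_of_yTwo_sub_eq_zero hΔ' hΔ (hinj _ (hΔ'.sub hΔ) fun δ hδ => ?_)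
    rw [hess_sub_left hΦ hχ.1 hΔ' hΔ hδ, hw δ hδ, hw' δ hδ, sub_self]
  · intro χ hseq hmem
    have hcontr : ∀ k, yTwo (χ (k + 1) - χs) ≤ ω / 2 * yTwo (χ k - χs) := by
      intro k
      obtain ⟨Δ, hΔ, hk⟩ := hseq k
      obtain ⟨hΔY, hw⟩ := (hstep (χ k) (hmem k) Δ).1 hΔ
      rw [hk]
      refine (yTwo_newton_error_le hΦ hC0.le hR.le hC hs (hmem k) hstab hsmall hcrit
        hΔY hw).trans ?_
      rw [← mul_assoc]
      exact mul_le_mul_of_nonneg_right hrate (yTwo_nonneg _)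
    refine ⟨hcontr, ?_⟩
    have hpow : ∀ k, yTwo (χ k - χs) ≤ (ω / 2) ^ k * yTwo (χ 0 - χs) := by
      intro k
      induction k with
      | zero => simp
      | succ k ih =>
        refine (hcontr k).trans ?_
        rw [pow_succ', mul_assoc]
        exact mul_le_mul_of_nonneg_left ih (by positivity)
    refine squeeze_zero (fun k => yTwo_nonneg _) hpow ?_
    simpa using (tendsto_pow_atTop_nhds_zero_of_lt_one (by positivity)
      (by linarith : ω / 2 < 1)).mul_const (yTwo (χ 0 - χs))
  · intro χ hχ hK
    have hd : MemDeltaY (χ - χs) := hχ.1.sub hs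
    refine same_of_yTwo_sub_eq_zero hχ.1 hs (le_antisymm ?_ (yTwo_nonneg _))
    have h0 := yTwo_nonneg (χ - χs)
    have h1 := hstab (χ - χs) hd (C * R * yTwo (χ - χs)) (by positivity) fun δ hδ => by
      have h2 := abs_grad_sub_grad_sub_hess_le hΦ hC0.le hR.le hC hχ.1 hs
        (Nhood.ae_norm_jet_sub_le hs hχ) hδ
      have h3 : grad Φ χ δ = 0 := by
        rw [← (hmodel χ (hN χ hχ)).1 δ hδ]
        exact hK.2 δ hδ
      rwa [hcrit δ hδ, h3, sub_zero, zero_sub, abs_neg, ← mul_assoc] at h2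
    have h4 : γ * (C * R) * yTwo (χ - χs) ≤ 1 / 2 * yTwo (χ - χs) := by gcongr
    linarith
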